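/- Let $V$ be a real separable Hilbert space and let $\tfrac12<\beta<\beta'\le 1$, $1-\beta'<\alpha<\beta$. Then there is a constant $c_0=c_0(\alpha,\beta,\beta')>0$, and for all $0<\lambda<\lambda_1$ there is a constant $c_{S,0}=c_{S,0}(\alpha,\beta,\beta',\lambda,\lambda_1)>0$, such that the following holds for all $c_{\alpha,\beta,\beta'}\ge c_0$ and $c_S\ge c_{S,0}$. Assume: (A1) $A$ is a densely defined, symmetric and strictly negative linear operator on $V$ with a compact inverse which generates a strongly continuous (hence analytic and exponentially stable) semigroup $S$ on $V$; $\lambda_1$ is the smallest eigenvalue of $-A$, and $(e_i)$ is a complete orthonormal system of eigenelements of $-A$. (A2) $F:V\to V$ is globally Lipschitz continuous with Lipschitz constant $c_{DF}>0$. (A3) $G:V\to L_2(V)$ (the Hilbert–Schmidt operators, with the Hilbert–Schmidt norm) is twice continuously Fréchet differentiable with bounded first and second derivatives, and $\|DG\|\le c_{DG}$. Moreover $F(0)=0$ and $G(0)=0$, and $\omega:[0,\infty)\to V$ is $\beta'$-Hölder continuous on $[0,T]$ for every $T>0$. Write $\theta_\tau\omega(\cdot)=\omega(\tau+\cdot)-\omega(\tau)$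 and $|\!|\!|w|\!|\!|_{\beta',a,b}=\sup_{a\le s<t\le b}\|w(t)-w(s)\|\,(t-s)^{-\beta'}$. Suppose that there are $\mu\in(0,1/(c_Sc_{DF}))$, an increasing sequence $(T_i)_{i\ge0}$ and a number $D\in(0,\mu]$ such that (S1) $T_0=0$ and $c_{\alpha,\beta,\beta'}\,c_{DG}\,|\!|\!|\theta_{T_i}\omega|\!|\!|_{\beta',0,T_{i+1}-T_i}\,(T_{i+1}-T_i)^{\beta'}+c_{DF}(T_{i+1}-T_i)=c_{DF}\,\mu$ for all $i\ge0$; (S2) $\liminf_{k\to\infty}T_k/k\ge D$; (S3) $\rho^*:=\lambda-\dfrac{c_Sc_{DF}\,\mu}{(1-c_Sc_{DF}\,\mu)D}\,e^{\lambda\mu}>0$. For $u_0\in V$ consider the mild solution of $du=(Au+F(u))\,dt+G(u)\,d\omega$, $u(0)=u_0$, that is, $u:[0,\infty)\to V$ with $$u(t)=S(t)u_0+\int_0^tS(t-r)F(u(r))\,dr+\int_0^tS(t-r)G(u(r))\,d\omega(r),\qquad t\ge0,$$ such that for every $T>0$ the function $u$ is continuous on $[0,T]$ and $\sup_{0<s<t\le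 T}s^{\beta}\,\|u(t)-u(s)\|\,(t-s)^{-\beta}<\infty$. Here the last integral is the pathwise (Young/Zähle) integral $$\int_s^tg\,d\omega=(-1)^\alpha\sum_j\Big(\sum_i\int_s^tD^\alpha_{s+}(e_j,g(\cdot)e_i)[r]\;D^{1-\alpha}_{t-}(e_i,\omega(\cdot))[r]\,dr\Big)e_j,$$ where, for real-valued $h$ and $w$, $$D^\alpha_{s+}h[r]=\frac1{\Gamma(1-\alpha)}\Big(\frac{h(r)}{(r-s)^\alpha}+\alpha\int_s^r\frac{h(r)-h(q)}{(r-q)^{1+\alpha}}\,dq\Big),$$ $$D^{1-\alpha}_{t-}w[r]=\frac{(-1)^{1-\alpha}}{\Gamma(\alpha)}\Big(\frac{w(r)-w(t)}{(t-r)^{1-\alpha}}+(1-\alpha)\int_r^t\frac{w(r)-w(q)}{(q-r)^{2-\alpha}}\,dq\Big),$$ and $(-1)^\alpha(-1)^{1-\alpha}=-1$. Then for every $0<\rho<\rho^*$ this solution satisfies $$\lim_{t\to\infty}\|u(t)\|\,e^{\rho t}=0,$$ and the convergence is uniform with respect to $u_0$ in bounded subsets of $V$. -/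

import Mathlib

open Set Filter Topology MeasureTheory

universe u v

noncomputable section

/-! ### Hilbert–Schmidt operators -/

section HilbertSchmidt

variable {V : Type u} [NormedAddCommGroup V] [InnerProductSpace ℝ V] {ι : Type v}

/-- The linear space of Hilbert–Schmidt operators on `V`, i.e. the bounded operators `z` with
`∑ i, ‖z (e i)‖ ^ 2 < ∞` for a complete orthonormal system `(e i)`. -/
def hilbertSchmidtSubmodule (e : HilbertBasis ι ℝ V) : Submodule ℝ (V →L[ℝ] V) where
  carrier := {z | Summable fun i => ‖z (e i)‖ ^ 2}
  zero_mem' := by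
    change Summable fun i => ‖(0 : V →L[ℝ] V) (e i)‖ ^ 2
    simp [summable_zero]
  add_mem' := by
    intro a c ha hc
    change Summable fun i => ‖(a + c) (e i)‖ ^ 2
    refine Summable.of_nonneg_of_le (fun i => sq_nonneg _) (fun i => ?_)
      ((Summable.add ha hc).mul_left 2)
    have h1 : ‖(a + c) (e i)‖ ≤ ‖a (e i)‖ + ‖c (e i)‖ := norm_add_le _ _
    have h2 : 0 ≤ ‖(a + c) (e i)‖ := norm_nonneg _
    generalize ‖(a + c) (e i)‖ = p at *
    generalize ‖a (e i)‖ = q at *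
    generalize ‖c (e i)‖ = r at *
    nlinarith [sq_nonneg (q - r)]
  smul_mem' := by
    intro r z hz
    change Summable fun i => ‖(r • z) (e i)‖ ^ 2
    have h : (fun i => ‖(r • z) (e i)‖ ^ 2) = fun i => |r| ^ 2 * ‖z (e i)‖ ^ 2 := by
      funext i
      have h1 : (r • z) (e i) = r • z (e i) := rfl
      rw [h1, norm_smul, Real.norm_eq_abs, mul_pow]
    rw [h]
    exact Summable.mul_left _ hz

/-- The space `L₂(V)` of Hilbert–Schmidt operators.  It is a type of its own because it carries the
Hilbert–Schmidt norm and not the operator norm. -/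
def HilbertSchmidt (e : HilbertBasis ι ℝ V) : Type u := hilbertSchmidtSubmodule e

namespace HilbertSchmidt

variable {e : HilbertBasis ι ℝ V}

instance : AddCommGroup (HilbertSchmidt e) :=
  inferInstanceAs (AddCommGroup (hilbertSchmidtSubmodule e))

instance : Module ℝ (HilbertSchmidt e) :=
  inferInstanceAs (Module ℝ (hilbertSchmidtSubmodule e))

/-- A Hilbert–Schmidt operator as a bounded operator. -/
def toCLM (z : HilbertSchmidt e) : V →L[ℝ] V := z.1

/-- The family `(z (e i))` as an element of `ℓ²(ι; V)`; its norm is the Hilbert–Schmidt norm. -/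
def toL2 (e : HilbertBasis ι ℝ V) : HilbertSchmidt e →ₗ[ℝ] lp (fun _ : ι => V) 2 where
  toFun z := ⟨fun i => z.toCLM (e i), memℓp_gen (by
    have h : Summable fun i => ‖z.toCLM (e i)‖ ^ 2 := z.2
    simpa using h)⟩
  map_add' _ _ := rfl
  map_smul' _ _ := rfl

theorem toL2_injective (e : HilbertBasis ι ℝ V) : Function.Injective (toL2 e) := by
  intro z w h
  refine Subtype.ext (?_ : z.toCLM = w.toCLM)
  refine ContinuousLinearMap.ext_on (s := range e) ?_ ?_
  · have h1 := e.dense_span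
    rw [Submodule.dense_iff_topologicalClosure_eq_top]
    exact h1
  · rintro _ ⟨i, rfl⟩
    exact congrFun (congrArg Subtype.val h) i

instance : NormedAddCommGroup (HilbertSchmidt e) :=
  NormedAddCommGroup.induced _ _ (toL2 e) (toL2_injective e)

instance : NormedSpace ℝ (HilbertSchmidt e) :=
  NormedSpace.induced ℝ _ _ (toL2 e)

/-- The Hilbert–Schmidt norm is `‖z‖² = ∑ i, ‖z (e i)‖²`. -/
theorem norm_sq_eq (z : HilbertSchmidt e) : ‖z‖ ^ 2 = ∑' i, ‖z.toCLM (e i)‖ ^ 2 := by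
  have h := lp.norm_rpow_eq_tsum (p := 2) (by simp) (toL2 e z)
  have h2 : ‖z‖ = ‖toL2 e z‖ := rfl
  rw [h2]
  have h3 : ∀ i, (toL2 e z : ∀ _ : ι, V) i = z.toCLM (e i) := fun _ => rfl
  simpa [h3] using h

end HilbertSchmidt

end HilbertSchmidt

/-! ### The linear part -/

section Linear

variable {V : Type u} [NormedAddCommGroup V] [InnerProductSpace ℝ V] {ι : Type v}

/-- `S` (considered on `[0, ∞)`) is the strongly continuous semigroup generated by the unbounded
operator `A`. -/
structure IsSemigroupGeneratedBy (A : V →ₗ.[ℝ] V) (S : ℝ → V →L[ℝ] V) : Prop where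
  map_zero : S 0 = ContinuousLinearMap.id ℝ V
  map_add : ∀ s t : ℝ, 0 ≤ s → 0 ≤ t → S (s + t) = (S s).comp (S t)
  continuousOn : ∀ x : V, ContinuousOn (fun t => S t x) (Ici 0)
  generator : ∀ x y : V,
    (x, y) ∈ A.graph ↔ Tendsto (fun h : ℝ => h⁻¹ • (S h x - x)) (𝓝[>] 0) (𝓝 y)

/-- Assumption on the linear part: `A` is a densely defined, symmetric, strictly negative operator
with a compact inverse, and it generates the semigroup `S`.  (Analyticity and exponential stability
of `S` are consequences of these properties.) -/
structure AssumptionA1 (A : V →ₗ.[ℝ] V) (S : ℝ → V →L[ℝ] V) : Prop where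
  dense_domain : Dense (A.domain : Set V)
  symmetric : ∀ x y : A.domain, inner ℝ (A x) (y : V) = inner ℝ (x : V) (A y)
  strictly_negative : ∀ x : A.domain, (x : V) ≠ 0 → inner ℝ (A x) (x : V) < 0
  compact_inverse : ∃ K : V →L[ℝ] V, IsCompactOperator K ∧
    ∀ x y : V, (x, y) ∈ A.graph ↔ K y = x
  generates : IsSemigroupGeneratedBy A S

/-- The set of eigenvalues of `-A`. -/
def negEigenvalues (A : V →ₗ.[ℝ] V) : Set ℝ :=
  {ν | ∃ x : A.domain, (x : V) ≠ 0 ∧ -(A x) = ν • (x : V)}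

/-- The complete orthonormal system `e` consists of eigenelements of `-A`. -/
def IsEigenbasis (A : V →ₗ.[ℝ] V) (e : HilbertBasis ι ℝ V) : Prop :=
  ∀ i, ∃ ν : ℝ, ∃ x : A.domain, (x : V) = e i ∧ -(A x) = ν • (x : V)

end Linear

/-! ### The nonlinearities -/

section Nonlinear

variable {V : Type u} [NormedAddCommGroup V] [InnerProductSpace ℝ V] {ι : Type v}

/-- `F` is globally Lipschitz continuous with Lipschitz constant `cDF`. -/
def AssumptionA2 (F : V → V) (cDF : ℝ) : Prop :=
  ∀ x y : V, ‖F x - F y‖ ≤ cDF * ‖x - y‖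

/-- `G : V → L₂(V)` is twice continuously Fréchet differentiable, its first derivative is bounded
by `cDG`, and its second derivative is bounded by `cD2G`. -/
structure AssumptionA3 {e : HilbertBasis ι ℝ V} (G : V → HilbertSchmidt e) (cDG cD2G : ℝ) :
    Prop where
  contDiff : ContDiff ℝ 2 G
  bound_one : ∀ x : V, ‖fderiv ℝ G x‖ ≤ cDG
  bound_two : ∀ x : V, ‖fderiv ℝ (fderiv ℝ G) x‖ ≤ cD2G

end Nonlinear

/-! ### Hölder spaces -/

section Holder

variable {E : Type*} [NormedAddCommGroup E]

/-- The set of Hölder quotients `‖w t - w s‖ / (t - s) ^ β`, `a ≤ s < t ≤ b`. -/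
def holderQuotients (β : ℝ) (w : ℝ → E) (a b : ℝ) : Set ℝ :=
  {q | ∃ s t : ℝ, a ≤ s ∧ s < t ∧ t ≤ b ∧ q = ‖w t - w s‖ / (t - s) ^ β}

/-- The Hölder seminorm of `w` on `[a, b]` (meaningful if `w` is `β`-Hölder there). -/
def holderSeminorm (β : ℝ) (w : ℝ → E) (a b : ℝ) : ℝ := sSup (holderQuotients β w a b)

/-- `w ∈ C^β([a, b]; E)`. -/
def IsHolderOn (β : ℝ) (w : ℝ → E) (a b : ℝ) : Prop := BddAbove (holderQuotients β w a b)

/-- `w ∈ C^β_β([a, b]; E)`: `w` is continuous on `[a, b]` and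
`sup_{a < s < t ≤ b} (s - a) ^ β * ‖w t - w s‖ / (t - s) ^ β < ∞`. -/
def IsDampedHolderOn (β : ℝ) (w : ℝ → E) (a b : ℝ) : Prop :=
  ContinuousOn w (Icc a b) ∧
  ∃ C : ℝ, ∀ s t : ℝ, a < s → s < t → t ≤ b → (s - a) ^ β * (‖w t - w s‖ / (t - s) ^ β) ≤ C

/-- The Wiener shift `θ_τ ω (·) = ω (τ + ·) - ω τ`. -/
def wienerShift (τ : ℝ) (w : ℝ → E) : ℝ → E := fun r => w (τ + r) - w τ

end Holder

/-! ### The pathwise integral -/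

section Integral

/-- The fractional derivative `D_{s+}^α g [r]`. -/
def fracDerivLeft (α s : ℝ) (g : ℝ → ℝ) (r : ℝ) : ℝ :=
  1 / Real.Gamma (1 - α) *
    (g r / (r - s) ^ α + α * ∫ q in s..r, (g r - g q) / (r - q) ^ (1 + α))

/-- The fractional derivative `D_{t-}^{1-α} w_{t-} [r]`, where `w_{t-} = w - w t`, without its
constant factor `(-1)^(1-α)`. -/
def fracDerivRight (α t : ℝ) (w : ℝ → ℝ) (r : ℝ) : ℝ :=
  1 / Real.Gamma α *
    ((w r - w t) / (t - r) ^ (1 - α) + (1 - α) * ∫ q in r..t, (w r - w q) / (q - r) ^ (2 - α))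

variable {V : Type u} [NormedAddCommGroup V] [InnerProductSpace ℝ V] {ι : Type v}

/-- The pathwise integral
`∫_s^t g dω = (-1)^α ∑_j (∑_i ∫_s^t D_{s+}^α (e_j, g e_i) [r] D_{t-}^{1-α} (e_i, ω)_{t-} [r] dr) e_j`.
The two constant factors `(-1)^α` and `(-1)^(1-α)` have been multiplied to `-1`. -/
def pathwiseIntegral (e : HilbertBasis ι ℝ V) (α s t : ℝ) (g : ℝ → V →L[ℝ] V) (ω : ℝ → V) : V :=
  -∑' j, (∑' i, ∫ r in s..t,
      fracDerivLeft α s (fun q => inner ℝ (e j) (g q (e i))) r *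
        fracDerivRight α t (fun q => inner ℝ (e i) (ω q)) r) • e j

/-- `u` is a global mild solution, with driving path `ω` and initial condition `u₀`: it lies in
`C^β_β([0, T]; V)` for all `T > 0`, and for all `t ≥ 0`
`u(t) = S(t) u₀ + ∫_0^t S(t-r) F(u(r)) dr + ∫_0^t S(t-r) G(u(r)) dω(r)`. -/
structure IsMildSolution {e : HilbertBasis ι ℝ V} (α β : ℝ) (S : ℝ → V →L[ℝ] V) (F : V → V)
    (G : V → HilbertSchmidt e) (ω : ℝ → V) (u₀ : V) (u : ℝ → V) : Prop where
  regular : ∀ T : ℝ, 0 < T → IsDampedHolderOn β u 0 T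
  equation : ∀ t : ℝ, 0 ≤ t →
    u t = S t u₀ + (∫ r in (0 : ℝ)..t, S (t - r) (F (u r)))
      + pathwiseIntegral e α 0 t (fun r => (S (t - r)).comp (G (u r)).toCLM) ω

end Integral

/-! ### The sequence of times -/

section Times

variable {V : Type u} [NormedAddCommGroup V]

/-- `0 = T 0 < T 1 < …`, and on each interval `[T i, T (i+1)]` the contribution of the noise and
the length of the interval are balanced against `cDF * μ`. -/
structure AssumptionS1 (c cDF cDG β' μ : ℝ) (ω : ℝ → V) (T : ℕ → ℝ) : Prop where
  increasing : StrictMono T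
  zero : T 0 = 0
  balance : ∀ i,
    c * cDG * holderSeminorm β' (wienerShift (T i) ω) 0 (T (i + 1) - T i)
        * (T (i + 1) - T i) ^ β'
      + cDF * (T (i + 1) - T i) = cDF * μ

/-- `D ∈ (0, μ]` is an asymptotic lower bound of `T k / k`. -/
def AssumptionS2 (μ D : ℝ) (T : ℕ → ℝ) : Prop :=
  0 < D ∧ D ≤ μ ∧ D ≤ liminf (fun k : ℕ => T k / (k : ℝ)) atTop

/-- The critical rate `ρ*`. -/
def criticalRate (lam cS cDF μ D : ℝ) : ℝ :=
  lam - cS * cDF * μ / ((1 - cS * cDF * μ) * D) * Real.exp (lam * μ)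

end Times

end

/-! The solution is compared with the linear flow on each interval `[T k, T (k+1)]`; the resulting
discrete contraction is iterated. The semigroup is diagonal in the eigenbasis
(`AssumptionA1.exists_isDiagonalSemigroup`), so smoothing estimates reduce to inequalities for `exp
(-ν t)` that are uniform in the rate `ν ≥ 0`. The pathwise integral of a damped Hölder integrand
with constants `M`, `L` against a path with Hölder constant `W` is at most a constant times `(M + L)
W (t - s) ^ γ` (`abs_youngIntegral_le`). Replacing the path by Steklov averages turns pathwise
integrals into ordinary ones with the same bound (`exists_tendsto_youngIntegral`); additivity and
integration by parts survive in the limit. Integration by parts moves the semigroup out of the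
pathwise integral. What remains is an ordinary integral whose kernel has a singularity at `t` that
is compensated by the factor `(t - r) ^ γ` (`sum_mul_add_integral_le`). All coordinates are
estimated at once by duality: a finite combination of coordinates is the integral of the adjoint
integrand applied to one vector. By the cocycle property the noise on `[a, b]` involves only the
data there. If `κ` dominates the balance in (S1), every admissible pair of constants `M`, `L` of the
solution can be replaced by one whose sum is at most `driftConst β * ‖u a‖ + driftConst β * κ * (M +
L)` (`exists_isDampedHolder_add_le`). Passing to the infimum absorbs the last term when `driftConst
β * κ < 1`, and `norm_le_and_norm_le` gives `‖u b‖ ≤ (exp (-λ₁ (b - a)) + κ C) ‖u a‖`. With `κ = cDF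
* μ`, each step costs at most the factor `exp (-λ Δ + η)`, where `Δ` is its length, `η = x / (1 - x)
* exp (λ μ)` and `x = cS * cDF * μ`. After `k` steps the exponent is `-λ T k + k η`. By (S2), `k ≤ T
k / d` eventually for each positive `d < D`, so every rate below `λ - η / D = ρ*` is attained
(`norm_mul_exp_le_of_contraction`). The bounds depend on the initial value only through its norm,
hence the uniformity. -/

noncomputable section

/-! ### Integrals with algebraic singularities -/

/-- The Euler integral `∫₀¹ y ^ a (1 - y) ^ b dy`. -/
def eulerBeta (a b : ℝ) : ℝ := ∫ y in (0 : ℝ)..1, y ^ a * (1 - y) ^ b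

theorem eulerBeta_nonneg (a b : ℝ) : 0 ≤ eulerBeta a b :=
  intervalIntegral.integral_nonneg zero_le_one fun y hy =>
    mul_nonneg (Real.rpow_nonneg hy.1 _) (Real.rpow_nonneg (by linarith [hy.2]) _)

theorem intervalIntegrable_sub_left_rpow {a : ℝ} (ha : -1 < a) (s t : ℝ) :
    IntervalIntegrable (fun y => (y - s) ^ a) volume s t := by
  have h := (intervalIntegral.intervalIntegrable_rpow' (a := 0) (b := t - s) ha).comp_sub_right s
  simpa using h

theorem intervalIntegrable_sub_right_rpow {a : ℝ} (ha : -1 < a) (s t : ℝ) :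
    IntervalIntegrable (fun y => (t - y) ^ a) volume s t := by
  have h := (intervalIntegral.intervalIntegrable_rpow' (a := t - s) (b := 0) ha).comp_sub_left t
  simpa using h

theorem integral_sub_right_rpow {a : ℝ} (ha : -1 < a) (s t : ℝ) :
    ∫ y in s..t, (t - y) ^ a = (t - s) ^ (a + 1) / (a + 1) := by
  rw [intervalIntegral.integral_comp_sub_left (fun y => y ^ a), sub_self,
    integral_rpow (Or.inl ha), Real.zero_rpow (by linarith), sub_zero]

theorem integral_sub_left_rpow {a : ℝ} (ha : -1 < a) (s t : ℝ) :
    ∫ y in s..t, (y - s) ^ a = (t - s) ^ (a + 1) / (a + 1) := by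
  rw [intervalIntegral.integral_comp_sub_right (fun y => y ^ a), sub_self,
    integral_rpow (Or.inl ha), Real.zero_rpow (by linarith), sub_zero]

/-- Each half of the interval contains only one of the two singularities; the other factor is
continuous there. -/
theorem intervalIntegrable_rpow_mul_rpow {a b s t : ℝ} (ha : -1 < a) (hb : -1 < b) (hst : s < t) :
    IntervalIntegrable (fun y => (y - s) ^ a * (t - y) ^ b) volume s t := by
  refine IntervalIntegrable.trans (b := (s + t) / 2) ?_ ?_
  · refine (intervalIntegrable_sub_left_rpow ha _ _).mul_continuousOn ?_
    rw [uIcc_of_le (by linarith)]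
    refine ContinuousOn.rpow_const (by fun_prop) fun y hy => Or.inl ?_
    linarith [hy.2]
  · refine (intervalIntegrable_sub_right_rpow hb _ _).continuousOn_mul ?_
    rw [uIcc_of_le (by linarith)]
    refine ContinuousOn.rpow_const (by fun_prop) fun y hy => Or.inl ?_
    linarith [hy.1]

/-- Affine substitution. It is valid for non-integrable functions too, so the exponents are
unrestricted. -/
theorem integral_rpow_mul_rpow {a b s t : ℝ} (hst : s < t) :
    ∫ y in s..t, (y - s) ^ a * (t - y) ^ b = (t - s) ^ (a + b + 1) * eulerBeta a b := by
  have hd : 0 < t - s := sub_pos.2 hst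
  have h := intervalIntegral.smul_integral_comp_mul_add
    (fun y => (y - s) ^ a * (t - y) ^ b) (t - s) s (a := 0) (b := 1)
  simp only [mul_zero, zero_add, mul_one, sub_add_cancel, smul_eq_mul] at h
  rw [← h, eulerBeta, Real.rpow_add_one hd.ne', Real.rpow_add hd, mul_comm _ (t - s),
    mul_assoc (t - s)]
  congr 1
  rw [← intervalIntegral.integral_const_mul]
  refine intervalIntegral.integral_congr fun y hy => ?_
  rw [uIcc_of_le zero_le_one] at hy
  have h1 : (t - s) * y + s - s = (t - s) * y := by ring
  have h2 : t - ((t - s) * y + s) = (t - s) * (1 - y) := by ring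
  simp only [h1, h2]
  rw [Real.mul_rpow hd.le hy.1, Real.mul_rpow hd.le (by linarith [hy.2])]
  ring

/-! ### Fubini's theorem on triangles and integration by parts with a singular kernel -/

section Triangle

variable {E : Type*} [NormedAddCommGroup E]

/-- Fubini's theorem on a triangle. -/
theorem integral_triangle_swap [NormedSpace ℝ E] {f : ℝ → ℝ → E} {s t : ℝ} (hst : s ≤ t)
    (hf : IntegrableOn (Function.uncurry f) {z | s < z.2 ∧ z.2 < z.1 ∧ z.1 < t}) :
    ∫ r in s..t, ∫ p in s..r, f r p = ∫ p in s..t, ∫ r in p..t, f r p := by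
  have hm : MeasurableSet {z : ℝ × ℝ | s < z.2 ∧ z.2 < z.1 ∧ z.1 < t} :=
    (measurableSet_lt measurable_const measurable_snd).inter
      ((measurableSet_lt measurable_snd measurable_fst).inter
        (measurableSet_lt measurable_fst measurable_const))
  set T : Set (ℝ × ℝ) := {z | s < z.2 ∧ z.2 < z.1 ∧ z.1 < t} with hT
  have hi := hf.integrable_indicator hm
  -- Both iterated integrals equal integrals over the plane of the function extended by zero off the
  -- triangle.
  have h := integral_integral_swap (f := fun r p => T.indicator (Function.uncurry f) (r, p)) hi
  have h1 : ∫ r in s..t, ∫ p in s..r, f r p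
      = ∫ r, ∫ p, T.indicator (Function.uncurry f) (r, p) := by
    rw [intervalIntegral.integral_of_le hst, integral_Ioc_eq_integral_Ioo,
      ← integral_indicator measurableSet_Ioo]
    refine integral_congr_ae (Eventually.of_forall fun r => ?_)
    by_cases hr : r ∈ Ioo s t
    · simp only [indicator_of_mem hr]
      rw [intervalIntegral.integral_of_le hr.1.le, integral_Ioc_eq_integral_Ioo,
        ← integral_indicator measurableSet_Ioo]
      refine integral_congr_ae (Eventually.of_forall fun p => ?_)
      by_cases hp : p ∈ Ioo s r
      · have : (r, p) ∈ T := ⟨hp.1, hp.2, hr.2⟩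
        simp only [indicator_of_mem hp, indicator_of_mem this, Function.uncurry_apply_pair]
      · have : (r, p) ∉ T := fun hh => hp ⟨hh.1, hh.2.1⟩
        simp only [indicator_of_notMem hp, indicator_of_notMem this]
    · have : ∀ p, (r, p) ∉ T := fun p hh => hr ⟨hh.1.trans hh.2.1, hh.2.2⟩
      simp only [indicator_of_notMem hr, indicator_of_notMem (this _), integral_zero]
  have h2 : ∫ p in s..t, ∫ r in p..t, f r p
      = ∫ p, ∫ r, T.indicator (Function.uncurry f) (r, p) := by
    rw [intervalIntegral.integral_of_le hst, integral_Ioc_eq_integral_Ioo,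
      ← integral_indicator measurableSet_Ioo]
    refine integral_congr_ae (Eventually.of_forall fun p => ?_)
    by_cases hp : p ∈ Ioo s t
    · simp only [indicator_of_mem hp]
      rw [intervalIntegral.integral_of_le hp.2.le, integral_Ioc_eq_integral_Ioo,
        ← integral_indicator measurableSet_Ioo]
      refine integral_congr_ae (Eventually.of_forall fun r => ?_)
      by_cases hr : r ∈ Ioo p t
      · have : (r, p) ∈ T := ⟨hp.1, hr.1, hr.2⟩
        simp only [indicator_of_mem hr, indicator_of_mem this, Function.uncurry_apply_pair]
      · have : (r, p) ∉ T := fun hh => hr ⟨hh.2.1, hh.2.2⟩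
        simp only [indicator_of_notMem hr, indicator_of_notMem this]
    · have : ∀ r, (r, p) ∉ T := fun r hh => hp ⟨hh.1, hh.2.1.trans hh.2.2⟩
      simp only [indicator_of_notMem hp, indicator_of_notMem (this _), integral_zero]
  rw [h1, h2, h]

/-- A product of integrable functions of one endpoint and of the difference is integrable. -/
theorem integrable_mul_comp_sub {φ k : ℝ → ℝ} (hφ : Integrable φ) (hk : Integrable k) :
    Integrable (fun z : ℝ × ℝ => φ z.2 * k (z.1 - z.2)) := by
  have h := hφ.convolution_integrand (ContinuousLinearMap.mul ℝ ℝ) hk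
  simp only [ContinuousLinearMap.mul_apply'] at h
  exact h

/-- Integrability on a triangle of a function that is dominated by a product of integrable functions
of the smaller variable and of the difference. -/
theorem integrableOn_triangle_of_le_lower {f : ℝ × ℝ → E} {s t : ℝ} {φ k : ℝ → ℝ}
    (hf : AEStronglyMeasurable f (volume.restrict {z | s < z.2 ∧ z.2 < z.1 ∧ z.1 < t}))
    (hφ : IntegrableOn φ (Ioo s t)) (hk : IntegrableOn k (Ioo 0 (t - s)))
    (h : ∀ r p, s < p → p < r → r < t → ‖f (r, p)‖ ≤ φ p * k (r - p)) :
    IntegrableOn f {z | s < z.2 ∧ z.2 < z.1 ∧ z.1 < t} := by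
  have hm : MeasurableSet {z : ℝ × ℝ | s < z.2 ∧ z.2 < z.1 ∧ z.1 < t} :=
    (measurableSet_lt measurable_const measurable_snd).inter
      ((measurableSet_lt measurable_snd measurable_fst).inter
        (measurableSet_lt measurable_fst measurable_const))
  refine Integrable.mono' (integrable_mul_comp_sub (hφ.integrable_indicator measurableSet_Ioo)
    (hk.integrable_indicator measurableSet_Ioo)).integrableOn hf ?_
  refine (ae_restrict_iff' hm).2 (Eventually.of_forall ?_)
  rintro ⟨r, p⟩ ⟨h1, h2, h3⟩
  simp only at h1 h2 h3
  rw [indicator_of_mem (show p ∈ Ioo s t from ⟨h1, h2.trans h3⟩),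
    indicator_of_mem (show r - p ∈ Ioo 0 (t - s) from ⟨by linarith, by linarith⟩)]
  exact h r p h1 h2 h3

/-- Integrability on a triangle of a function that is dominated by a product of integrable functions
of the larger variable and of the difference. -/
theorem integrableOn_triangle_of_le_upper {f : ℝ × ℝ → E} {s t : ℝ} {φ k : ℝ → ℝ}
    (hf : AEStronglyMeasurable f (volume.restrict {z | s < z.2 ∧ z.2 < z.1 ∧ z.1 < t}))
    (hφ : IntegrableOn φ (Ioo s t)) (hk : IntegrableOn k (Ioo 0 (t - s)))
    (h : ∀ r p, s < p → p < r → r < t → ‖f (r, p)‖ ≤ φ r * k (r - p)) :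
    IntegrableOn f {z | s < z.2 ∧ z.2 < z.1 ∧ z.1 < t} := by
  have hm : MeasurableSet {z : ℝ × ℝ | s < z.2 ∧ z.2 < z.1 ∧ z.1 < t} :=
    (measurableSet_lt measurable_const measurable_snd).inter
      ((measurableSet_lt measurable_snd measurable_fst).inter
        (measurableSet_lt measurable_fst measurable_const))
  -- The weight now sits on the larger variable, so the kernel is reflected and the coordinates are
  -- swapped.
  have hi := (integrable_mul_comp_sub (hφ.integrable_indicator measurableSet_Ioo)
    (hk.integrable_indicator measurableSet_Ioo).comp_neg).swap
  refine Integrable.mono' hi.integrableOn hf ?_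
  refine (ae_restrict_iff' hm).2 (Eventually.of_forall ?_)
  rintro ⟨r, p⟩ ⟨h1, h2, h3⟩
  simp only at h1 h2 h3
  simp only [Function.comp_apply, Prod.swap_prod_mk, neg_sub]
  rw [indicator_of_mem (show r ∈ Ioo s t from ⟨h1.trans h2, h3⟩),
    indicator_of_mem (show r - p ∈ Ioo 0 (t - s) from ⟨by linarith, by linarith⟩)]
  exact h r p h1 h2 h3

/-- Integration by parts against the singular kernel `τ ^ (-1 - γ)`. -/
theorem integral_rpow_smul_eq_of_hasDerivAt [NormedSpace ℝ E] [CompleteSpace E] {γ ℓ : ℝ} (hγ : 0 < γ) (hγ1 : γ < 1)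
    (hℓ : 0 < ℓ) {f f' : ℝ → E} (hf : ∀ x, HasDerivAt f (f' x) x) (hf' : Continuous f')
    (h0 : f 0 = 0) :
    γ • ∫ τ in (0 : ℝ)..ℓ, τ ^ (-(1 + γ)) • f τ
      = -(ℓ ^ (-γ) • f ℓ) + ∫ τ in (0 : ℝ)..ℓ, τ ^ (-γ) • f' τ := by
  have hfc : Continuous f := continuous_iff_continuousAt.2 fun x => (hf x).continuousAt
  obtain ⟨K, hK⟩ := (isCompact_Icc (a := (0 : ℝ)) (b := ℓ)).exists_bound_of_continuousOn
    hf'.continuousOn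
  -- Since `f 0 = 0`, `f` is of order `τ` at zero. This makes the kernel integrable and the boundary
  -- term at zero vanish.
  have hb : ∀ τ ∈ Icc (0 : ℝ) ℓ, ‖f τ‖ ≤ K * τ := by
    intro τ hτ
    have := Convex.norm_image_sub_le_of_norm_hasDerivWithin_le
      (fun x _ => (hf x).hasDerivWithinAt) hK (convex_Icc 0 ℓ) (left_mem_Icc.2 hℓ.le) hτ
    simpa [h0, abs_of_nonneg hτ.1] using this
  have i1 : IntervalIntegrable (fun τ => τ ^ (-γ) • f' τ) volume 0 ℓ :=
    (intervalIntegral.intervalIntegrable_rpow' (by linarith)).smul_continuousOn hf'.continuousOn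
  have i2 : IntervalIntegrable (fun τ => τ ^ (-(1 + γ)) • f τ) volume 0 ℓ := by
    refine ((intervalIntegral.intervalIntegrable_rpow' (r := -γ) (by linarith)).const_mul K).mono_fun
      ?_ ?_
    · exact ((measurable_id.pow_const _).aestronglyMeasurable).smul hfc.aestronglyMeasurable
    · rw [uIoc_of_le hℓ.le]
      refine (ae_restrict_iff' measurableSet_Ioc).2 (Eventually.of_forall fun τ hτ => ?_)
      have hp := Real.rpow_nonneg hτ.1.le (-(1 + γ))
      beta_reduce
      rw [norm_smul, Real.norm_of_nonneg hp]
      refine le_trans ?_ (le_abs_self _)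
      calc τ ^ (-(1 + γ)) * ‖f τ‖ ≤ τ ^ (-(1 + γ)) * (K * τ) := by
            gcongr; exact hb τ ⟨hτ.1.le, hτ.2⟩
        _ = K * (τ ^ (-(1 + γ)) * τ) := by ring
        _ = K * τ ^ (-γ) := by
            rw [← Real.rpow_add_one hτ.1.ne']; congr 2; ring
  have i3 : IntervalIntegrable (fun τ => (-γ) • (τ ^ (-(1 + γ)) • f τ)) volume 0 ℓ := i2.smul (-γ)
  have key := intervalIntegral.integral_eq_sub_of_hasDerivAt_of_le
    (f := fun τ => τ ^ (-γ) • f τ)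
    (f' := fun τ => τ ^ (-γ) • f' τ + (-γ) • (τ ^ (-(1 + γ)) • f τ)) hℓ.le ?_ ?_ ?_
  · rw [intervalIntegral.integral_add i1 i3, intervalIntegral.integral_smul] at key
    simp only [h0, smul_zero, sub_zero] at key
    rw [← key]
    simp
  · intro τ hτ
    rcases hτ.1.eq_or_lt with h | h
    · subst h
      have : Tendsto (fun τ : ℝ => K * τ ^ (1 - γ)) (𝓝[Icc 0 ℓ] 0) (𝓝 0) := by
        have hc : ContinuousAt (fun τ : ℝ => K * τ ^ (1 - γ)) 0 :=
          continuousAt_const.mul (Real.continuousAt_rpow_const _ _ (Or.inr (by linarith)))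
        have := hc.tendsto.mono_left (nhdsWithin_le_nhds (s := Icc 0 ℓ))
        simpa [Real.zero_rpow (show 1 - γ ≠ 0 by linarith)] using this
      rw [ContinuousWithinAt, h0, smul_zero]
      refine squeeze_zero_norm' ?_ this
      filter_upwards [self_mem_nhdsWithin] with x hx
      rw [norm_smul, Real.norm_of_nonneg (Real.rpow_nonneg hx.1 _)]
      rcases hx.1.eq_or_lt with h | h
      · rw [← h, h0, Real.zero_rpow (by linarith), norm_zero,
          Real.zero_rpow (by linarith)]; simp
      · calc x ^ (-γ) * ‖f x‖ ≤ x ^ (-γ) * (K * x) := by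
              gcongr
              exact hb x hx
          _ = K * (x ^ (-γ) * x) := by ring
          _ = K * x ^ (1 - γ) := by
            rw [← Real.rpow_add_one h.ne']; congr 2; ring
    · exact ((Real.continuousAt_rpow_const _ _ (Or.inl h.ne')).smul
        hfc.continuousAt).continuousWithinAt
  · intro τ hτ
    have h1 := (Real.hasDerivAt_rpow_const (p := -γ) (Or.inl hτ.1.ne')).fun_smul (hf τ)
    convert h1 using 2
    rw [smul_smul]; congr 3; ring
  · exact i1.add i3

end Triangle

/-! ### Classes of Hölder functions -/

section HolderClasses

variable {E : Type*} [NormedAddCommGroup E]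

/-- `g` is continuous on `[s, t]`, bounded by `M`, and `β`-Hölder continuous with constant `L` and a
singularity at `s`. -/
structure IsDampedHolder (β M L : ℝ) (g : ℝ → E) (s t : ℝ) : Prop where
  nonneg_sup : 0 ≤ M
  nonneg_holder : 0 ≤ L
  continuousOn : ContinuousOn g (Icc s t)
  norm_le : ∀ x ∈ Icc s t, ‖g x‖ ≤ M
  holder : ∀ y x, s < y → y < x → x ≤ t → ‖g x - g y‖ ≤ L * ((x - y) ^ β * (y - s) ^ (-β))

/-- `w` is `γ`-Hölder continuous on `[s, t]` with constant `W`. -/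
def IsHolderWithOn (γ W : ℝ) (w : ℝ → E) (s t : ℝ) : Prop :=
  ∀ x y, s ≤ x → x ≤ y → y ≤ t → ‖w y - w x‖ ≤ W * (y - x) ^ γ

theorem IsHolderWithOn.mono {γ W : ℝ} {w : ℝ → E} {s t s' t' : ℝ} (h : IsHolderWithOn γ W w s t)
    (hs : s ≤ s') (ht : t' ≤ t) : IsHolderWithOn γ W w s' t' :=
  fun x y h1 h2 h3 => h x y (hs.trans h1) h2 (h3.trans ht)

/-- Moving the left endpoint to the right only enlarges the weight `(y - s) ^ (-β)`, so one pair of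
constants serves all subintervals. -/
theorem IsDampedHolder.mono {β M L : ℝ} {g : ℝ → E} {s t s' t' : ℝ} (hβ : 0 ≤ β)
    (h : IsDampedHolder β M L g s t) (hs : s ≤ s') (ht : t' ≤ t) :
    IsDampedHolder β M L g s' t' where
  nonneg_sup := h.nonneg_sup
  nonneg_holder := h.nonneg_holder
  continuousOn := h.continuousOn.mono (Icc_subset_Icc hs ht)
  norm_le x hx := h.norm_le x (Icc_subset_Icc hs ht hx)
  holder y x h1 h2 h3 := by
    refine (h.holder y x (hs.trans_lt h1) h2 (h3.trans ht)).trans ?_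
    have := h.nonneg_holder
    gcongr ?_ * (?_ * ?_)
    exact Real.rpow_le_rpow_of_nonpos (by linarith) (by linarith) (by linarith)

theorem IsHolderWithOn.continuousOn {γ W : ℝ} {w : ℝ → E} {s t : ℝ} (hγ : 0 < γ)
    (hw : IsHolderWithOn γ W w s t) : ContinuousOn w (Icc s t) := by
  have hb : ∀ x ∈ Icc s t, ∀ y ∈ Icc s t, ‖w y - w x‖ ≤ W * |y - x| ^ γ := by
    intro x hx y hy
    rcases le_total x y with h | h
    · rw [abs_of_nonneg (sub_nonneg.2 h)]
      exact hw x y hx.1 h hy.2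
    · rw [abs_sub_comm, abs_of_nonneg (sub_nonneg.2 h), norm_sub_rev]
      exact hw y x hy.1 h hx.2
  intro x hx
  rw [ContinuousWithinAt, tendsto_iff_norm_sub_tendsto_zero]
  have hl : Tendsto (fun y => W * |y - x| ^ γ) (𝓝[Icc s t] x) (𝓝 0) := by
    have hc : Continuous (fun y : ℝ => W * |y - x| ^ γ) :=
      continuous_const.mul ((continuous_id.sub continuous_const).abs.rpow_const
        fun _ => Or.inr hγ.le)
    have := (hc.tendsto x).mono_left (nhdsWithin_le_nhds (s := Icc s t))
    simpa [Real.zero_rpow hγ.ne'] using this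
  refine squeeze_zero' (Eventually.of_forall fun _ => norm_nonneg _) ?_ hl
  filter_upwards [self_mem_nhdsWithin] with y hy using hb x hx y hy

/-- The projection of the line to the interval `[s, t]`. -/
def clampTo (s t x : ℝ) : ℝ := max s (min t x)

theorem clampTo_mem {s t : ℝ} (hst : s ≤ t) (x : ℝ) : clampTo s t x ∈ Icc s t :=
  ⟨le_max_left _ _, max_le hst (min_le_left _ _)⟩

theorem clampTo_of_mem {s t x : ℝ} (hx : x ∈ Icc s t) : clampTo s t x = x := by
  rw [clampTo, min_eq_right hx.2, max_eq_right hx.1]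

theorem continuous_clampTo (s t : ℝ) : Continuous (clampTo s t) := by
  unfold clampTo; fun_prop

theorem continuous_comp_clampTo {s t : ℝ} {g : ℝ → E} (hst : s ≤ t) (hg : ContinuousOn g (Icc s t)) :
    Continuous (g ∘ clampTo s t) :=
  hg.comp_continuous (continuous_clampTo s t) (clampTo_mem hst)

end HolderClasses

/-! ### Vector-valued fractional derivatives -/

section FractionalDerivative

variable {E : Type*} [NormedAddCommGroup E] [NormedSpace ℝ E]

/-- The vector-valued left fractional derivative of order `α`. -/
def leftDeriv (α s : ℝ) (g : ℝ → E) (r : ℝ) : E :=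
  (Real.Gamma (1 - α))⁻¹ •
    ((r - s) ^ (-α) • g r + α • ∫ q in s..r, (r - q) ^ (-(1 + α)) • (g r - g q))

/-- The vector-valued right fractional derivative of order `1 - α` of `w - w t`, obtained from the
left one by reflection. -/
def rightDeriv (α t : ℝ) (w : ℝ → E) (r : ℝ) : E :=
  leftDeriv (1 - α) (-t) (fun x => w (-x) - w t) (-r)

theorem rightDeriv_eq (α t : ℝ) (w : ℝ → E) (r : ℝ) :
    rightDeriv α t w r = (Real.Gamma α)⁻¹ • ((t - r) ^ (-(1 - α)) • (w r - w t) +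
      (1 - α) • ∫ q in r..t, (q - r) ^ (-(2 - α)) • (w r - w q)) := by
  have h := intervalIntegral.integral_comp_neg (a := r) (b := t)
    (fun q => (-r - q) ^ (-(1 + (1 - α))) • ((w (- -r) - w t) - (w (-q) - w t)))
  have e1 : -r - -t = t - r := by ring
  have e2 : -(1 + (1 - α)) = -(2 - α) := by ring
  have e3 : 1 - (1 - α) = α := by ring
  have e4 : ∀ q, -r - -q = q - r := fun q => by ring
  simp only [rightDeriv, leftDeriv]
  rw [← h]
  simp only [e1, e2, e3, e4, neg_neg, sub_sub_sub_cancel_right]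

theorem leftDeriv_congr {α s r : ℝ} {g g' : ℝ → E} (hsr : s ≤ r) (h : EqOn g g' (Icc s r)) :
    leftDeriv α s g r = leftDeriv α s g' r := by
  rw [leftDeriv, leftDeriv, h (right_mem_Icc.2 hsr)]
  congr 3
  refine intervalIntegral.integral_congr fun q hq => ?_
  rw [uIcc_of_le hsr] at hq
  simp only [h hq]

/-- The singular integral depends on `r` through both its limit and its integrand. It is a partial
integral of a measurable function on the plane, cut off to a triangle. -/
theorem aestronglyMeasurable_leftDeriv_of_continuous (α s t : ℝ) {g : ℝ → E} (hg : Continuous g) :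
    AEStronglyMeasurable (leftDeriv α s g) (volume.restrict (Ioo s t)) := by
  have hm : MeasurableSet {z : ℝ × ℝ | s < z.2 ∧ z.2 < z.1} :=
    (measurableSet_lt measurable_const measurable_snd).inter
      (measurableSet_lt measurable_snd measurable_fst)
  have hk : StronglyMeasurable (fun z : ℝ × ℝ => {z : ℝ × ℝ | s < z.2 ∧ z.2 < z.1}.indicator
      (fun z => (z.1 - z.2) ^ (-(1 + α)) • (g z.1 - g z.2)) z) := by
    refine StronglyMeasurable.indicator ?_ hm
    exact (((measurable_fst.sub measurable_snd).pow_const _).stronglyMeasurable).smul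
      ((hg.comp continuous_fst).sub (hg.comp continuous_snd)).stronglyMeasurable
  have hi := hk.integral_prod_right' (ν := volume)
  have h2 : AEStronglyMeasurable (fun r => ∫ q in s..r, (r - q) ^ (-(1 + α)) • (g r - g q))
      (volume.restrict (Ioo s t)) := by
    refine hi.aestronglyMeasurable.congr ?_
    refine (ae_restrict_iff' measurableSet_Ioo).2 (Eventually.of_forall fun r hr => ?_)
    beta_reduce
    rw [intervalIntegral.integral_of_le hr.1.le, integral_Ioc_eq_integral_Ioo,
      ← integral_indicator measurableSet_Ioo]
    refine integral_congr_ae (Eventually.of_forall fun q => ?_)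
    by_cases hq : q ∈ Ioo s r
    · have : (r, q) ∈ {z : ℝ × ℝ | s < z.2 ∧ z.2 < z.1} := hq
      simp only [indicator_of_mem hq, indicator_of_mem this]
    · have : (r, q) ∉ {z : ℝ × ℝ | s < z.2 ∧ z.2 < z.1} := hq
      simp only [indicator_of_notMem hq, indicator_of_notMem this]
  have h3 : AEStronglyMeasurable (fun r => (r - s) ^ (-α) • g r) (volume.restrict (Ioo s t)) :=
    ((measurable_id.sub_const s).pow_const (-α)).aestronglyMeasurable.smul hg.aestronglyMeasurable
  exact (h3.add (h2.const_smul α)).const_smul _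

theorem aestronglyMeasurable_leftDeriv (α : ℝ) {s t : ℝ} {g : ℝ → E}
    (hg : ContinuousOn g (Icc s t)) :
    AEStronglyMeasurable (leftDeriv α s g) (volume.restrict (Ioo s t)) := by
  rcases lt_or_ge s t with hst | hst
  -- The derivative at `r` sees only the values on `[s, r]`, so the continuous extension by
  -- `clampTo` does not change it.
  · refine (aestronglyMeasurable_leftDeriv_of_continuous α s t
      (continuous_comp_clampTo hst.le hg)).congr ?_
    refine (ae_restrict_iff' measurableSet_Ioo).2 (Eventually.of_forall fun r hr => ?_)
    refine leftDeriv_congr hr.1.le fun x hx => ?_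
    rw [Function.comp_apply, clampTo_of_mem ⟨hx.1, hx.2.trans hr.2.le⟩]
  · simp [Ioo_eq_empty hst.not_gt]

theorem aestronglyMeasurable_rightDeriv (α : ℝ) {s t : ℝ} {w : ℝ → E}
    (hw : ContinuousOn w (Icc s t)) :
    AEStronglyMeasurable (rightDeriv α t w) (volume.restrict (Ioo s t)) := by
  have h : AEStronglyMeasurable (leftDeriv (1 - α) (-t) (fun x => w (-x) - w t))
      (volume.restrict (Ioo (-t) (-s))) := by
    refine aestronglyMeasurable_leftDeriv _ (ContinuousOn.sub ?_ continuousOn_const)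
    exact hw.comp continuousOn_neg fun x hx => ⟨by linarith [hx.2], by linarith [hx.1]⟩
  have hp : MeasurePreserving (fun x : ℝ => -x) (volume.restrict (Ioo s t))
      (volume.restrict (Ioo (-t) (-s))) := by
    have := (Measure.measurePreserving_neg (volume : Measure ℝ)).restrict_preimage
      (measurableSet_Ioo (a := -t) (b := -s))
    simpa using this
  exact h.comp_measurePreserving hp

/-! ### Bounds for fractional derivatives of Hölder functions -/

section Bounds

variable {α β M L s t : ℝ} {g : ℝ → E}

/-- For `α < β < 1` both exponents in the bound exceed `-1`. Its integral over `[s, r]` scales like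
`(r - s) ^ (-α)`, exactly as the boundary term of the derivative does. -/
theorem IsDampedHolder.norm_kernel_le (hg : IsDampedHolder β M L g s t) {q r : ℝ} (hq : s < q)
    (hqr : q < r) (hr : r ≤ t) : ‖(r - q) ^ (-(1 + α)) • (g r - g q)‖
      ≤ L * ((q - s) ^ (-β) * (r - q) ^ (β - α - 1)) := by
  have h0 : 0 < r - q := sub_pos.2 hqr
  rw [norm_smul, Real.norm_of_nonneg (Real.rpow_nonneg h0.le _)]
  calc (r - q) ^ (-(1 + α)) * ‖g r - g q‖
      ≤ (r - q) ^ (-(1 + α)) * (L * ((r - q) ^ β * (q - s) ^ (-β))) := by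
        gcongr; exact hg.holder q r hq hqr hr
    _ = L * ((q - s) ^ (-β) * ((r - q) ^ (-(1 + α)) * (r - q) ^ β)) := by ring
    _ = _ := by rw [← Real.rpow_add h0]; congr 3; ring

theorem intervalIntegrable_damped_kernel (hβ : β < 1) (hαβ : α < β) (L : ℝ) {s r : ℝ} (hr : s < r) :
    IntervalIntegrable (fun q => L * ((q - s) ^ (-β) * (r - q) ^ (β - α - 1))) volume s r :=
  (intervalIntegrable_rpow_mul_rpow (by linarith) (by linarith) hr).const_mul L

theorem aestronglyMeasurable_kernel (α : ℝ) {r : ℝ} (hr : r ≤ t) (hg : ContinuousOn g (Icc s t)) :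
    AEStronglyMeasurable (fun q => (r - q) ^ (-(1 + α)) • (g r - g q))
      (volume.restrict (Ioc s r)) := by
  refine (((measurable_const.sub measurable_id).pow_const _).aestronglyMeasurable).smul ?_
  refine ContinuousOn.aestronglyMeasurable ?_ measurableSet_Ioc
  exact continuousOn_const.sub (hg.mono fun q hq => ⟨hq.1.le, hq.2.trans hr⟩)

theorem IsDampedHolder.intervalIntegrable_kernel (hβ : β < 1) (hαβ : α < β)
    (hg : IsDampedHolder β M L g s t) {r : ℝ} (hsr : s < r) (hr : r ≤ t) :
    IntervalIntegrable (fun q => (r - q) ^ (-(1 + α)) • (g r - g q)) volume s r := by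
  refine (intervalIntegrable_damped_kernel hβ hαβ L hsr).mono_fun' ?_ ?_
  · rw [uIoc_of_le hsr.le]
    exact aestronglyMeasurable_kernel α hr hg.continuousOn
  · rw [uIoc_of_le hsr.le, ← restrict_Ioo_eq_restrict_Ioc]
    exact (ae_restrict_iff' measurableSet_Ioo).2
      (Eventually.of_forall fun q hq => hg.norm_kernel_le hq.1 hq.2 hr)

/-- The constant in the bound for the left fractional derivative. -/
def leftConst (α β : ℝ) : ℝ := (Real.Gamma (1 - α))⁻¹ * (1 + α * eulerBeta (-β) (β - α - 1))

theorem leftConst_nonneg (hα : 0 < α) (hα1 : α < 1) (β : ℝ) : 0 ≤ leftConst α β := by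
  have h1 := Real.Gamma_pos_of_pos (sub_pos.2 hα1)
  have h2 := eulerBeta_nonneg (-β) (β - α - 1)
  unfold leftConst; positivity

theorem IsDampedHolder.norm_leftDeriv_le (hα : 0 < α) (hβ : β < 1) (hαβ : α < β)
    (hg : IsDampedHolder β M L g s t) {r : ℝ} (hsr : s < r) (hr : r ≤ t) :
    ‖leftDeriv α s g r‖ ≤ leftConst α β * (M + L) * (r - s) ^ (-α) := by
  have hG := Real.Gamma_pos_of_pos (show 0 < 1 - α by linarith)
  have hB := eulerBeta_nonneg (-β) (β - α - 1)
  have hM := hg.nonneg_sup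
  have hL := hg.nonneg_holder
  have hp := Real.rpow_nonneg (sub_pos.2 hsr).le (-α)
  have h1 : ‖∫ q in s..r, (r - q) ^ (-(1 + α)) • (g r - g q)‖
      ≤ L * ((r - s) ^ (-α) * eulerBeta (-β) (β - α - 1)) := by
    refine (intervalIntegral.norm_integral_le_of_norm_le hsr.le ?_
      (intervalIntegrable_damped_kernel hβ hαβ L hsr)).trans ?_
    · rw [← ae_restrict_iff' measurableSet_Ioc, ← restrict_Ioo_eq_restrict_Ioc]
      exact (ae_restrict_iff' measurableSet_Ioo).2
        (Eventually.of_forall fun q hq => hg.norm_kernel_le hq.1 hq.2 hr)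
    · rw [intervalIntegral.integral_const_mul, integral_rpow_mul_rpow hsr]
      rw [show -β + (β - α - 1) + 1 = -α by ring]
  have h2 := hg.norm_le r ⟨hsr.le, hr⟩
  rw [leftDeriv, norm_smul, leftConst, norm_inv, Real.norm_of_nonneg hG.le, mul_assoc, mul_assoc]
  gcongr
  refine (norm_add_le _ _).trans ?_
  rw [norm_smul, norm_smul, Real.norm_of_nonneg hp, Real.norm_of_nonneg hα.le]
  calc (r - s) ^ (-α) * ‖g r‖ + α * ‖∫ q in s..r, (r - q) ^ (-(1 + α)) • (g r - g q)‖
      ≤ (r - s) ^ (-α) * M + α * (L * ((r - s) ^ (-α) * eulerBeta (-β) (β - α - 1))) := by gcongr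
    _ ≤ _ := by
      -- This is the surplus of `(1 + α B) (M + L)` over `M + α B L`, with `B` the Euler integral.
      have : 0 ≤ (r - s) ^ (-α) * (L + α * eulerBeta (-β) (β - α - 1) * M) := by positivity
      linarith

theorem IsDampedHolder.integrableOn_leftDeriv (hα : 0 < α) (hβ : β < 1) (hαβ : α < β)
    (hg : IsDampedHolder β M L g s t) : IntegrableOn (leftDeriv α s g) (Ioo s t) := by
  rcases lt_or_ge s t with hst | hst
  · have hi : IntegrableOn (fun r => leftConst α β * (M + L) * (r - s) ^ (-α)) (Ioo s t) := by
      rw [← integrableOn_Ioc_iff_integrableOn_Ioo,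
        ← intervalIntegrable_iff_integrableOn_Ioc_of_le hst.le]
      exact (intervalIntegrable_sub_left_rpow (by linarith) s t).const_mul _
    refine Integrable.mono' hi (aestronglyMeasurable_leftDeriv α hg.continuousOn) ?_
    exact (ae_restrict_iff' measurableSet_Ioo).2
      (Eventually.of_forall fun q hq => hg.norm_leftDeriv_le hα hβ hαβ hq.1 hq.2.le)
  · simp [Ioo_eq_empty hst.not_gt]

/-- The constant in the bound for the right fractional derivative. -/
def rightConst (α γ : ℝ) : ℝ := (Real.Gamma α)⁻¹ * (1 + (1 - α) / (α + γ - 1))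

theorem rightConst_nonneg {γ : ℝ} (hα : 0 < α) (hα1 : α < 1) (hγ : 1 < α + γ) :
    0 ≤ rightConst α γ := by
  have h1 := Real.Gamma_pos_of_pos hα
  have h2 : 0 < 1 - α := by linarith
  have h3 : 0 < α + γ - 1 := by linarith
  unfold rightConst; positivity

theorem IsHolderWithOn.norm_kernel_le {γ W : ℝ} {w : ℝ → E} (hw : IsHolderWithOn γ W w s t)
    {q r : ℝ} (hr : s ≤ r) (hrq : r < q) (hq : q ≤ t) :
    ‖(q - r) ^ (-(2 - α)) • (w r - w q)‖ ≤ W * (q - r) ^ (α + γ - 2) := by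
  have h0 : 0 < q - r := sub_pos.2 hrq
  rw [norm_smul, Real.norm_of_nonneg (Real.rpow_nonneg h0.le _), norm_sub_rev]
  calc (q - r) ^ (-(2 - α)) * ‖w q - w r‖ ≤ (q - r) ^ (-(2 - α)) * (W * (q - r) ^ γ) := by
        gcongr; exact hw r q hr hrq.le hq
    _ = W * ((q - r) ^ (-(2 - α)) * (q - r) ^ γ) := by ring
    _ = _ := by rw [← Real.rpow_add h0]; congr 2; ring

/-- Here `α + γ > 1` enters: the kernel `(q - r) ^ (α + γ - 2)` is integrable, and the derivative
even vanishes at `t`. -/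
theorem IsHolderWithOn.norm_rightDeriv_le {γ W : ℝ} {w : ℝ → E} (hα : 0 < α) (hα1 : α < 1)
    (hγ : 1 < α + γ) (hw : IsHolderWithOn γ W w s t) {r : ℝ} (hr : s ≤ r) (hrt : r < t) :
    ‖rightDeriv α t w r‖ ≤ rightConst α γ * W * (t - r) ^ (α + γ - 1) := by
  have hG := Real.Gamma_pos_of_pos hα
  have hp := Real.rpow_nonneg (sub_pos.2 hrt).le (-(1 - α))
  have h1 : ‖∫ q in r..t, (q - r) ^ (-(2 - α)) • (w r - w q)‖
      ≤ W * ((t - r) ^ (α + γ - 1) / (α + γ - 1)) := by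
    refine (intervalIntegral.norm_integral_le_of_norm_le hrt.le ?_
      ((intervalIntegrable_sub_left_rpow (a := α + γ - 2) (by linarith) r t).const_mul W)).trans ?_
    · exact Eventually.of_forall fun q hq => hw.norm_kernel_le hr hq.1 hq.2
    · rw [intervalIntegral.integral_const_mul, integral_sub_left_rpow (by linarith),
        show α + γ - 2 + 1 = α + γ - 1 by ring]
  have h2 := hw r t hr hrt.le le_rfl
  rw [rightDeriv_eq, norm_smul, rightConst, norm_inv, Real.norm_of_nonneg hG.le, mul_assoc,
    mul_assoc]
  gcongr
  refine (norm_add_le _ _).trans ?_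
  rw [norm_smul, norm_smul, Real.norm_of_nonneg hp, Real.norm_of_nonneg (by linarith : 0 ≤ 1 - α),
    norm_sub_rev]
  calc (t - r) ^ (-(1 - α)) * ‖w t - w r‖ +
        (1 - α) * ‖∫ q in r..t, (q - r) ^ (-(2 - α)) • (w r - w q)‖
      ≤ (t - r) ^ (-(1 - α)) * (W * (t - r) ^ γ) +
        (1 - α) * (W * ((t - r) ^ (α + γ - 1) / (α + γ - 1))) := by
        gcongr
    _ = W * ((t - r) ^ (-(1 - α)) * (t - r) ^ γ) +
        (1 - α) * (W * ((t - r) ^ (α + γ - 1) / (α + γ - 1))) := by ring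
    _ = (1 + (1 - α) / (α + γ - 1)) * (W * (t - r) ^ (α + γ - 1)) := by
        rw [← Real.rpow_add (sub_pos.2 hrt), show -(1 - α) + γ = α + γ - 1 by ring]; ring
    _ ≤ _ := le_rfl

end Bounds

/-- Dominated convergence for the left fractional derivative. -/
theorem tendsto_leftDeriv {α s r : ℝ} {g : ℝ → E} {gn : ℕ → ℝ → E} {b : ℝ → ℝ} (hsr : s < r)
    (hc : ∀ n, ContinuousOn (gn n) (Icc s r))
    (hlim : ∀ q ∈ Icc s r, Tendsto (fun n => gn n q) atTop (𝓝 (g q)))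
    (hb : ∀ n, ∀ q ∈ Ioo s r, ‖(r - q) ^ (-(1 + α)) • (gn n r - gn n q)‖ ≤ b q)
    (hbi : IntervalIntegrable b volume s r) :
    Tendsto (fun n => leftDeriv α s (gn n) r) atTop (𝓝 (leftDeriv α s g r)) := by
  have hr := hlim r (right_mem_Icc.2 hsr.le)
  refine ((hr.const_smul _).add (Tendsto.const_smul ?_ α)).const_smul _
  refine intervalIntegral.tendsto_integral_filter_of_dominated_convergence b
    (Eventually.of_forall fun n => ?_) (Eventually.of_forall fun n => ?_) hbi
    (Eventually.of_forall fun q hq => ?_)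
  · rw [uIoc_of_le hsr.le]
    exact aestronglyMeasurable_kernel α le_rfl (hc n)
  · rw [uIoc_of_le hsr.le, ← ae_restrict_iff' measurableSet_Ioc, ← restrict_Ioo_eq_restrict_Ioc]
    exact (ae_restrict_iff' measurableSet_Ioo).2 (Eventually.of_forall fun q hq => hb n q hq)
  · rw [uIoc_of_le hsr.le] at hq
    exact (hr.sub (hlim q ⟨hq.1.le, hq.2⟩)).const_smul _

/-- Integration by parts trades the kernel of order `1 + α` for one of order `α`, which is the form
suited to Fubini's theorem. -/
theorem leftDeriv_of_hasDerivAt [CompleteSpace E] {α s r : ℝ} (hα : 0 < α) (hα1 : α < 1)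
    (hsr : s < r) {g g' : ℝ → E} (hg : ∀ x, HasDerivAt g (g' x) x) (hg' : Continuous g') :
    leftDeriv α s g r = (Real.Gamma (1 - α))⁻¹ •
      ((r - s) ^ (-α) • g s + ∫ q in s..r, (r - q) ^ (-α) • g' q) := by
  have hd : ∀ x, HasDerivAt (fun τ => g r - g (r - τ)) (g' (r - x)) x := fun x => by
    have h1 : HasDerivAt (fun τ => r - τ) (-1) x := by simpa using (hasDerivAt_id x).const_sub r
    have := ((hg (r - x)).scomp x h1).const_sub (g r)
    simpa using this
  have h := integral_rpow_smul_eq_of_hasDerivAt hα hα1 (sub_pos.2 hsr) hd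
    (hg'.comp (continuous_const.sub continuous_id)) (by simp)
  have e1 := intervalIntegral.integral_comp_sub_left (a := s) (b := r)
    (fun τ => τ ^ (-(1 + α)) • (g r - g (r - τ))) r
  have e2 := intervalIntegral.integral_comp_sub_left (a := s) (b := r)
    (fun τ => τ ^ (-α) • g' (r - τ)) r
  simp only [sub_sub_cancel, sub_self] at e1 e2
  rw [leftDeriv, e1, e2, h, sub_sub_cancel, smul_sub]
  congr 1
  abel_nf

/-- The reflected form of `leftDeriv_of_hasDerivAt`; there is no boundary term because `w - w t`
vanishes at `t`. -/
theorem rightDeriv_of_hasDerivAt [CompleteSpace E] {α t r : ℝ} (hα : 0 < α) (hα1 : α < 1)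
    (hrt : r < t) {w w' : ℝ → E} (hw : ∀ x, HasDerivAt w (w' x) x) (hw' : Continuous w') :
    rightDeriv α t w r = -((Real.Gamma α)⁻¹ • ∫ q in r..t, (q - r) ^ (α - 1) • w' q) := by
  have hd : ∀ x, HasDerivAt (fun x => w (-x) - w t) (-w' (-x)) x := fun x => by
    have := ((hw (-x)).scomp x (hasDerivAt_neg x)).sub_const (w t)
    simpa using this
  have h := leftDeriv_of_hasDerivAt (α := 1 - α) (by linarith) (by linarith)
    (show -t < -r by linarith) hd (hw'.comp continuous_neg).neg
  have e := intervalIntegral.integral_comp_neg (a := r) (b := t)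
    (fun q => (-r - q) ^ (-(1 - α)) • -w' (-q))
  have e4 : ∀ q, -r - -q = q - r := fun q => by ring
  simp only [neg_neg, sub_self, smul_zero, zero_add, sub_sub_cancel] at h e
  rw [rightDeriv, h, ← e, ← smul_neg, ← intervalIntegral.integral_neg]
  simp only [e4, neg_sub, smul_neg]

end FractionalDerivative

/-! ### Steklov averages -/

section Steklov

variable {E : Type*} [NormedAddCommGroup E] [NormedSpace ℝ E]

/-- The average of `g` over `[x, x + ε]`. -/
def steklov (ε : ℝ) (g : ℝ → E) (x : ℝ) : E := ε⁻¹ • ∫ h in (0 : ℝ)..ε, g (x + h)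

theorem hasDerivAt_steklov [CompleteSpace E] (ε : ℝ) {g : ℝ → E} (hg : Continuous g) (x : ℝ) :
    HasDerivAt (steklov ε g) (ε⁻¹ • (g (x + ε) - g x)) x := by
  have hF : ∀ y, HasDerivAt (fun y => ∫ z in (0 : ℝ)..y, g z) (g y) y := fun y =>
    intervalIntegral.integral_hasDerivAt_right (hg.intervalIntegrable _ _)
      (hg.stronglyMeasurableAtFilter _ _) hg.continuousAt
  have he : steklov ε g = fun y => ε⁻¹ • ((∫ z in (0 : ℝ)..(y + ε), g z) - ∫ z in (0 : ℝ)..y, g z) := by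
    funext y
    rw [steklov, intervalIntegral.integral_comp_add_left, add_zero,
      intervalIntegral.integral_interval_sub_left (hg.intervalIntegrable _ _)
        (hg.intervalIntegrable _ _)]
  rw [he]
  exact (((hF (x + ε)).comp_add_const x ε).sub (hF x)).const_smul _

theorem norm_steklov_sub_le {ε K : ℝ} (hε : 0 < ε) {g : ℝ → E} (hg : Continuous g) {x y : ℝ}
    (h : ∀ z, 0 ≤ z → z ≤ ε → ‖g (x + z) - g (y + z)‖ ≤ K) :
    ‖steklov ε g x - steklov ε g y‖ ≤ K := by
  have hc : ∀ x, IntervalIntegrable (fun z => g (x + z)) volume 0 ε := fun x =>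
    (hg.comp (continuous_const.add continuous_id)).intervalIntegrable _ _
  rw [steklov, steklov, ← smul_sub, ← intervalIntegral.integral_sub (hc x) (hc y), norm_smul,
    norm_inv, Real.norm_of_nonneg hε.le, inv_mul_le_iff₀ hε]
  have := intervalIntegral.norm_integral_le_of_norm_le_const (a := 0) (b := ε) (C := K)
    (f := fun z => g (x + z) - g (y + z)) (fun z hz => by
      rw [uIoc_of_le hε.le] at hz
      exact h z hz.1.le hz.2)
  rwa [sub_zero, abs_of_pos hε, mul_comm] at this

theorem norm_steklov_sub_const_le [CompleteSpace E] {ε K : ℝ} (hε : 0 < ε) {g : ℝ → E}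
    (hg : Continuous g) {x : ℝ} {c : E} (h : ∀ z, 0 ≤ z → z ≤ ε → ‖g (x + z) - c‖ ≤ K) :
    ‖steklov ε g x - c‖ ≤ K := by
  have hc : IntervalIntegrable (fun z => g (x + z)) volume 0 ε :=
    (hg.comp (continuous_const.add continuous_id)).intervalIntegrable _ _
  have e : c = ε⁻¹ • ∫ _ in (0 : ℝ)..ε, c := by
    rw [intervalIntegral.integral_const, sub_zero, smul_smul, inv_mul_cancel₀ hε.ne', one_smul]
  rw [e, steklov, ← smul_sub, ← intervalIntegral.integral_sub hc intervalIntegrable_const, norm_smul,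
    norm_inv, Real.norm_of_nonneg hε.le, inv_mul_le_iff₀ hε]
  have := intervalIntegral.norm_integral_le_of_norm_le_const (a := 0) (b := ε) (C := K)
    (f := fun z => g (x + z) - c) (fun z hz => by
      rw [uIoc_of_le hε.le] at hz
      exact h z hz.1.le hz.2)
  rwa [sub_zero, abs_of_pos hε, mul_comm] at this

theorem tendsto_steklov [CompleteSpace E] {g : ℝ → E} (hg : Continuous g) (x : ℝ) :
    Tendsto (fun n : ℕ => steklov (1 / ((n : ℝ) + 1)) g x) atTop (𝓝 (g x)) := by
  rw [Metric.tendsto_nhds]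
  intro δ hδ
  obtain ⟨η, hη, h⟩ := Metric.continuousAt_iff.1 (hg.continuousAt (x := x)) (δ / 2) (by linarith)
  have hn := (tendsto_one_div_add_atTop_nhds_zero_nat (𝕜 := ℝ)).eventually (gt_mem_nhds hη)
  filter_upwards [hn] with n hn
  rw [dist_eq_norm]
  refine lt_of_le_of_lt (norm_steklov_sub_const_le (by positivity) hg (K := δ / 2) ?_)
    (by linarith)
  intro z hz hz'
  rw [← dist_eq_norm]
  refine (h ?_).le
  rw [Real.dist_eq, add_sub_cancel_left, abs_of_nonneg hz]
  linarith

theorem clampTo_add_sub_le {s t x y z : ℝ} (hxy : x ≤ y) :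
    clampTo s t (y + z) - clampTo s t (x + z) ≤ y - x := by
  unfold clampTo
  rcases max_cases s (min t (y + z)) with ⟨h1, h2⟩ | ⟨h1, h2⟩ <;>
  rcases max_cases s (min t (x + z)) with ⟨h3, h4⟩ | ⟨h3, h4⟩ <;>
  rcases min_cases t (y + z) with ⟨h5, h6⟩ | ⟨h5, h6⟩ <;>
  rcases min_cases t (x + z) with ⟨h7, h8⟩ | ⟨h7, h8⟩ <;> linarith

theorem monotone_clampTo (s t : ℝ) : Monotone (clampTo s t) := fun _ _ h =>
  max_le_max le_rfl (min_le_min le_rfl h)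

/-- The averages look to the right, so translated points are no closer to `s`, and clamping does not
increase distances. Hence the smooth approximants keep the constants `M` and `L`. -/
theorem IsDampedHolder.steklov_clampTo [CompleteSpace E] {β M L s t ε : ℝ} {g : ℝ → E} (hβ : 0 ≤ β)
    (hst : s ≤ t) (hε : 0 < ε) (hg : IsDampedHolder β M L g s t) :
    IsDampedHolder β M L (steklov ε (g ∘ clampTo s t)) s t := by
  have hc := continuous_comp_clampTo hst hg.continuousOn
  refine ⟨hg.nonneg_sup, hg.nonneg_holder, ?_, fun x _ => ?_, fun y x hy hyx hx => ?_⟩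
  · exact (continuous_iff_continuousAt.2 fun x => (hasDerivAt_steklov ε hc x).continuousAt).continuousOn
  · rw [← sub_zero (steklov _ _ _)]
    refine norm_steklov_sub_const_le hε hc fun z _ _ => ?_
    rw [sub_zero]
    exact hg.norm_le _ (clampTo_mem hst _)
  · refine norm_steklov_sub_le hε hc fun z hz _ => ?_
    have hL := hg.nonneg_holder
    have h1 : y ≤ clampTo s t (y + z) := by
      rw [← clampTo_of_mem ⟨hy.le, hyx.le.trans hx⟩]
      refine monotone_clampTo s t ?_
      rw [clampTo_of_mem ⟨hy.le, hyx.le.trans hx⟩]; linarith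
    have h2 := clampTo_add_sub_le (s := s) (t := t) (z := z) hyx.le
    have h3 : clampTo s t (y + z) ≤ clampTo s t (x + z) := monotone_clampTo s t (by linarith)
    -- Both translated points may be clamped to `t`; the increment is then zero.
    rcases h3.eq_or_lt with h3 | h3
    · have : 0 ≤ L * ((x - y) ^ β * (y - s) ^ (-β)) :=
        mul_nonneg hL (mul_nonneg (Real.rpow_nonneg (by linarith) _)
          (Real.rpow_nonneg (by linarith) _))
      simpa [h3] using this
    · refine (hg.holder _ _ (hy.trans_le h1) h3 (clampTo_mem hst _).2).trans ?_
      gcongr ?_ * (?_ * ?_)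
      · exact Real.rpow_nonneg (by linarith) _
      · exact Real.rpow_le_rpow (by linarith) h2 hβ
      · exact Real.rpow_le_rpow_of_nonpos (by linarith) (by linarith) (by linarith)

theorem IsHolderWithOn.steklov_clampTo {γ W s t ε : ℝ} {w : ℝ → E} (hγ : 0 < γ) (hW : 0 ≤ W)
    (hst : s ≤ t) (hε : 0 < ε) (hw : IsHolderWithOn γ W w s t) :
    IsHolderWithOn γ W (steklov ε (w ∘ clampTo s t)) s t := by
  intro x y _ hxy _
  refine norm_steklov_sub_le hε (continuous_comp_clampTo hst (hw.continuousOn hγ)) fun z _ _ => ?_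
  have h3 : clampTo s t (x + z) ≤ clampTo s t (y + z) := monotone_clampTo s t (by linarith)
  exact (hw _ _ (clampTo_mem hst _).1 h3 (clampTo_mem hst _).2).trans (mul_le_mul_of_nonneg_left
    (Real.rpow_le_rpow (sub_nonneg.2 h3) (clampTo_add_sub_le hxy) hγ.le) hW)

end Steklov

/-! ### Inversion of the fractional derivative -/

section Inversion

variable {E : Type*} [NormedAddCommGroup E] [NormedSpace ℝ E]

theorem intervalIntegrable_rpow_smul_leftDeriv {α β M L s x : ℝ} {g : ℝ → E} (hα : 0 < α)
    (hβ : β < 1) (hαβ : α < β) (hsx : s < x) (hg : IsDampedHolder β M L g s x) :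
    IntervalIntegrable (fun r => (x - r) ^ (α - 1) • leftDeriv α s g r) volume s x := by
  have hi := (intervalIntegrable_rpow_mul_rpow (a := -α) (b := α - 1) (by linarith) (by linarith)
    hsx).const_mul (leftConst α β * (M + L))
  refine hi.mono_fun' ?_ ?_
  · rw [uIoc_of_le hsx.le, ← restrict_Ioo_eq_restrict_Ioc]
    exact ((measurable_const.sub measurable_id).pow_const _).aestronglyMeasurable.smul
      (aestronglyMeasurable_leftDeriv α hg.continuousOn)
  · rw [uIoc_of_le hsx.le, ← restrict_Ioo_eq_restrict_Ioc]
    refine (ae_restrict_iff' measurableSet_Ioo).2 (Eventually.of_forall fun r hr => ?_)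
    have h0 := Real.rpow_nonneg (sub_pos.2 hr.2).le (α - 1)
    beta_reduce
    rw [norm_smul, Real.norm_of_nonneg h0]
    calc (x - r) ^ (α - 1) * ‖leftDeriv α s g r‖
        ≤ (x - r) ^ (α - 1) * (leftConst α β * (M + L) * (r - s) ^ (-α)) := by
          gcongr; exact hg.norm_leftDeriv_le hα hβ hαβ hr.1 hr.2.le
      _ = _ := by ring

/-- After Fubini the inner integral of `(r - p) ^ (-α) * (x - r) ^ (α - 1)` over `[p, x]` is a
number `B` independent of `p`, because the exponents add up to `-1`. What is left is `B` times `g s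
+ ∫ g' = g x`. -/
theorem integral_rpow_smul_leftDeriv_of_hasDerivAt [CompleteSpace E] {α β M L s x : ℝ} {g g' : ℝ → E} (hα : 0 < α)
    (hβ : β < 1) (hαβ : α < β) (hsx : s < x) (hg : IsDampedHolder β M L g s x)
    (hd : ∀ x, HasDerivAt g (g' x) x) (hg' : Continuous g') :
    ∫ r in s..x, (x - r) ^ (α - 1) • leftDeriv α s g r
      = ((Real.Gamma (1 - α))⁻¹ * eulerBeta (-α) (α - 1)) • g x := by
  have hG := (Real.Gamma_pos_of_pos (show 0 < 1 - α by linarith)).ne'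
  set B := eulerBeta (-α) (α - 1)
  have hB : ∀ p, p < x → ∫ r in p..x, (r - p) ^ (-α) * (x - r) ^ (α - 1) = B := fun p hp => by
    rw [integral_rpow_mul_rpow hp, show -α + (α - 1) + 1 = 0 by ring, Real.rpow_zero, one_mul]
  have i1 : IntervalIntegrable (fun r => ((r - s) ^ (-α) * (x - r) ^ (α - 1)) • g s) volume s x :=
    (intervalIntegrable_rpow_mul_rpow (by linarith) (by linarith) hsx).smul_continuousOn
      continuousOn_const
  have i2 := (intervalIntegrable_rpow_smul_leftDeriv hα hβ hαβ hsx hg).smul (Real.Gamma (1 - α))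
  have e2 : EqOn (fun r => (x - r) ^ (α - 1) • ∫ p in s..r, (r - p) ^ (-α) • g' p)
      (Real.Gamma (1 - α) • (fun r => (x - r) ^ (α - 1) • leftDeriv α s g r)
        - fun r => ((r - s) ^ (-α) * (x - r) ^ (α - 1)) • g s) (Ioc s x) := by
    intro r hr
    simp only [Pi.sub_apply, Pi.smul_apply]
    rw [leftDeriv_of_hasDerivAt hα (by linarith) hr.1 hd hg', smul_comm _ (_⁻¹), smul_inv_smul₀ hG,
      smul_add, smul_smul, mul_comm, add_sub_cancel_left]
  have e3 : ∫ r in s..x, (x - r) ^ (α - 1) • leftDeriv α s g r = (Real.Gamma (1 - α))⁻¹ •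
      ((∫ r in s..x, ((r - s) ^ (-α) * (x - r) ^ (α - 1)) • g s) +
        ∫ r in s..x, (x - r) ^ (α - 1) • ∫ p in s..r, (r - p) ^ (-α) • g' p) := by
    rw [intervalIntegral.integral_congr_ae (g := (Real.Gamma (1 - α) •
        (fun r => (x - r) ^ (α - 1) • leftDeriv α s g r)
        - fun r => ((r - s) ^ (-α) * (x - r) ^ (α - 1)) • g s)) (f := fun r => (x - r) ^ (α - 1) •
          ∫ p in s..r, (r - p) ^ (-α) • g' p)]
    · simp only [Pi.sub_apply]
      rw [intervalIntegral.integral_sub i2 i1]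
      simp only [Pi.smul_apply]
      rw [intervalIntegral.integral_smul, add_sub_cancel, inv_smul_smul₀ hG]
    · rw [uIoc_of_le hsx.le]
      exact Eventually.of_forall e2
  obtain ⟨K, hK⟩ := (isCompact_Icc (a := s) (b := x)).exists_bound_of_continuousOn
    hg'.continuousOn
  have e4 : ∫ r in s..x, (x - r) ^ (α - 1) • ∫ p in s..r, (r - p) ^ (-α) • g' p
      = B • ∫ p in s..x, g' p := by
    have hswap := integral_triangle_swap (f := fun r p => (x - r) ^ (α - 1) • (r - p) ^ (-α) • g' p)
      hsx.le (integrableOn_triangle_of_le_upper (φ := fun r => K * (x - r) ^ (α - 1))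
        (k := fun τ => τ ^ (-α)) ?_ ?_ ?_ ?_)
    · simp only [intervalIntegral.integral_smul] at hswap
      rw [hswap, ← intervalIntegral.integral_smul]
      refine intervalIntegral.integral_congr_ae ?_
      rw [uIoc_of_le hsx.le]
      have : ∀ᵐ p : ℝ, p ≠ x := by simp [ae_iff, measure_singleton]
      filter_upwards [this] with p hpx hp
      simp only [smul_smul]
      rw [intervalIntegral.integral_smul_const, ← hB p (lt_of_le_of_ne hp.2 hpx)]
      simp only [mul_comm]
    · refine Measurable.aestronglyMeasurable ?_ |>.smul (Measurable.aestronglyMeasurable ?_ |>.smul ?_)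
      · exact (measurable_const.sub measurable_fst).pow_const _
      · exact (measurable_fst.sub measurable_snd).pow_const _
      · exact (hg'.comp continuous_snd).aestronglyMeasurable
    · rw [← integrableOn_Ioc_iff_integrableOn_Ioo,
        ← intervalIntegrable_iff_integrableOn_Ioc_of_le hsx.le]
      exact (intervalIntegrable_sub_right_rpow (by linarith) s x).const_mul _
    · rw [← integrableOn_Ioc_iff_integrableOn_Ioo,
        ← intervalIntegrable_iff_integrableOn_Ioc_of_le (sub_pos.2 hsx).le]
      exact intervalIntegral.intervalIntegrable_rpow' (by linarith)
    · intro r p hp hpr hr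
      simp only [Function.uncurry_apply_pair, norm_smul]
      rw [Real.norm_of_nonneg (Real.rpow_nonneg (sub_pos.2 hr).le _),
        Real.norm_of_nonneg (Real.rpow_nonneg (sub_pos.2 hpr).le _)]
      have h1 := hK p ⟨hp.le, (hpr.trans hr).le⟩
      have h2 := Real.rpow_nonneg (sub_pos.2 hr).le (α - 1)
      have h3 := Real.rpow_nonneg (sub_pos.2 hpr).le (-α)
      calc (x - r) ^ (α - 1) * ((r - p) ^ (-α) * ‖g' p‖)
          ≤ (x - r) ^ (α - 1) * ((r - p) ^ (-α) * K) := by gcongr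
        _ = _ := by ring
  have e5 : ∫ p in s..x, g' p = g x - g s :=
    intervalIntegral.integral_eq_sub_of_hasDerivAt (fun y _ => hd y) (hg'.intervalIntegrable _ _)
  rw [e3, e4, e5, intervalIntegral.integral_smul_const, hB s hsx, ← smul_add, add_sub_cancel,
    smul_smul]

/-- The fractional integral of the fractional derivative is, up to a constant, the identity. -/
theorem integral_rpow_smul_leftDeriv [CompleteSpace E] {α β M L s x : ℝ} {g : ℝ → E} (hα : 0 < α)
    (hβ : β < 1) (hαβ : α < β) (hsx : s < x) (hg : IsDampedHolder β M L g s x) :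
    ∫ r in s..x, (x - r) ^ (α - 1) • leftDeriv α s g r
      = ((Real.Gamma (1 - α))⁻¹ * eulerBeta (-α) (α - 1)) • g x := by
  have hc := continuous_comp_clampTo hsx.le hg.continuousOn
  set gn : ℕ → ℝ → E := fun n => steklov (1 / ((n : ℝ) + 1)) (g ∘ clampTo s x) with hgn
  have hdn : ∀ n, IsDampedHolder β M L (gn n) s x := fun n =>
    hg.steklov_clampTo (by linarith) hsx.le (by positivity)
  have hlim : ∀ q ∈ Icc s x, Tendsto (fun n => gn n q) atTop (𝓝 (g q)) := fun q hq => by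
    have := tendsto_steklov hc q
    rwa [Function.comp_apply, clampTo_of_mem hq] at this
  have hn : ∀ n, ∫ r in s..x, (x - r) ^ (α - 1) • leftDeriv α s (gn n) r
      = ((Real.Gamma (1 - α))⁻¹ * eulerBeta (-α) (α - 1)) • gn n x := fun n =>
    integral_rpow_smul_leftDeriv_of_hasDerivAt hα hβ hαβ hsx (hdn n)
      (fun y => hasDerivAt_steklov _ hc y)
      (((hc.comp (continuous_id.add continuous_const)).sub hc).const_smul _)
  have h1 : Tendsto (fun n => ∫ r in s..x, (x - r) ^ (α - 1) • leftDeriv α s (gn n) r) atTop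
      (𝓝 (((Real.Gamma (1 - α))⁻¹ * eulerBeta (-α) (α - 1)) • g x)) := by
    simp only [hn]
    exact (hlim x (right_mem_Icc.2 hsx.le)).const_smul _
  refine tendsto_nhds_unique ?_ h1
  -- The approximants share `M` and `L`, so one integrable function dominates all of them.
  have hi := (intervalIntegrable_rpow_mul_rpow (a := -α) (b := α - 1) (by linarith) (by linarith)
    hsx).const_mul (leftConst α β * (M + L))
  have hne : ∀ᵐ r : ℝ, r ≠ x := by simp [ae_iff, measure_singleton]
  refine intervalIntegral.tendsto_integral_filter_of_dominated_convergence _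
    (Eventually.of_forall fun n => ?_) (Eventually.of_forall fun n => ?_) hi
    ?_
  · rw [uIoc_of_le hsx.le, ← restrict_Ioo_eq_restrict_Ioc]
    exact ((measurable_const.sub measurable_id).pow_const _).aestronglyMeasurable.smul
      (aestronglyMeasurable_leftDeriv α (hdn n).continuousOn)
  · rw [uIoc_of_le hsx.le]
    filter_upwards [hne] with r hrx hr
    have h0 := Real.rpow_nonneg (sub_nonneg.2 hr.2) (α - 1)
    rw [norm_smul, Real.norm_of_nonneg h0]
    calc (x - r) ^ (α - 1) * ‖leftDeriv α s (gn n) r‖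
        ≤ (x - r) ^ (α - 1) * (leftConst α β * (M + L) * (r - s) ^ (-α)) := by
          gcongr; exact (hdn n).norm_leftDeriv_le hα hβ hαβ hr.1 hr.2
      _ = _ := by ring
  · rw [uIoc_of_le hsx.le]
    refine Eventually.of_forall fun r hr => Tendsto.const_smul ?_ _
    exact tendsto_leftDeriv hr.1
      (fun n => (hdn n).continuousOn.mono (Icc_subset_Icc le_rfl hr.2))
      (fun q hq => hlim q ⟨hq.1, hq.2.trans hr.2⟩)
      (fun n q hq => (hdn n).norm_kernel_le hq.1 hq.2 hr.2)
      (intervalIntegrable_damped_kernel hβ hαβ L hr.1)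

end Inversion

/-! ### The pathwise integral of vector-valued functions -/

section Young

variable {V : Type*} [NormedAddCommGroup V] [InnerProductSpace ℝ V]

/-- The pathwise integral `∫ₛᵗ ⟪g, dw⟫`. -/
def youngIntegral (α : ℝ) (g w : ℝ → V) (s t : ℝ) : ℝ :=
  -∫ r in s..t, inner ℝ (leftDeriv α s g r) (rightDeriv α t w r)

/-- The constant in the bound for the pathwise integral. -/
def youngBound (α β γ : ℝ) : ℝ := leftConst α β * rightConst α γ * eulerBeta (-α) (α + γ - 1)

theorem youngBound_nonneg {α γ : ℝ} (hα : 0 < α) (hα1 : α < 1) (hγ : 1 < α + γ) (β : ℝ) :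
    0 ≤ youngBound α β γ :=
  mul_nonneg (mul_nonneg (leftConst_nonneg hα hα1 β) (rightConst_nonneg hα hα1 hγ))
    (eulerBeta_nonneg _ _)

@[simp] theorem youngIntegral_self (α : ℝ) (g w : ℝ → V) (s : ℝ) : youngIntegral α g w s s = 0 := by
  simp [youngIntegral]

variable {α β γ M L W s t : ℝ} {g w : ℝ → V}

theorem norm_mul_norm_deriv_le (hα : 0 < α) (hβ : β < 1) (hαβ : α < β) (hγ : 1 < α + γ)
    (hg : IsDampedHolder β M L g s t) (hw : IsHolderWithOn γ W w s t) {r : ℝ} (hr : s < r)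
    (hrt : r < t) : ‖leftDeriv α s g r‖ * ‖rightDeriv α t w r‖
      ≤ leftConst α β * (M + L) * (rightConst α γ * W) *
        ((r - s) ^ (-α) * (t - r) ^ (α + γ - 1)) := by
  have h1 := hg.norm_leftDeriv_le hα hβ hαβ hr hrt.le
  have h2 := hw.norm_rightDeriv_le hα (by linarith) hγ hr.le hrt
  have h3 := (norm_nonneg _).trans h1
  calc ‖leftDeriv α s g r‖ * ‖rightDeriv α t w r‖
      ≤ (leftConst α β * (M + L) * (r - s) ^ (-α)) *
        (rightConst α γ * W * (t - r) ^ (α + γ - 1)) := by gcongr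
    _ = _ := by ring

theorem intervalIntegrable_bound (hα1 : α < 1) (hγ : 1 < α + γ) (hst : s < t) (c : ℝ) :
    IntervalIntegrable (fun r => c * ((r - s) ^ (-α) * (t - r) ^ (α + γ - 1))) volume s t :=
  (intervalIntegrable_rpow_mul_rpow (by linarith) (by linarith) hst).const_mul c

theorem intervalIntegrable_norm_mul_norm_deriv (hα : 0 < α) (hβ : β < 1) (hαβ : α < β)
    (hγ : 1 < α + γ) (hγ0 : 0 < γ)
    (hg : IsDampedHolder β M L g s t) (hw : IsHolderWithOn γ W w s t) (hst : s < t) :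
    IntervalIntegrable (fun r => ‖leftDeriv α s g r‖ * ‖rightDeriv α t w r‖) volume s t := by
  refine (intervalIntegrable_bound (by linarith) hγ hst
    (leftConst α β * (M + L) * (rightConst α γ * W))).mono_fun' ?_ ?_
  · rw [uIoc_of_le hst.le, ← restrict_Ioo_eq_restrict_Ioc]
    exact (aestronglyMeasurable_leftDeriv α hg.continuousOn).norm.mul
      (aestronglyMeasurable_rightDeriv α (hw.continuousOn hγ0)).norm
  · rw [uIoc_of_le hst.le, ← restrict_Ioo_eq_restrict_Ioc]
    refine (ae_restrict_iff' measurableSet_Ioo).2 (Eventually.of_forall fun r hr => ?_)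
    beta_reduce
    rw [norm_mul, norm_norm, norm_norm]
    exact norm_mul_norm_deriv_le hα hβ hαβ hγ hg hw hr.1 hr.2

theorem aestronglyMeasurable_inner_deriv (α : ℝ) (hγ0 : 0 < γ) (hg : ContinuousOn g (Icc s t))
    (hw : IsHolderWithOn γ W w s t) :
    AEStronglyMeasurable (fun r => inner ℝ (leftDeriv α s g r) (rightDeriv α t w r))
      (volume.restrict (Ioo s t)) :=
  (aestronglyMeasurable_leftDeriv α hg).inner
    (aestronglyMeasurable_rightDeriv α (hw.continuousOn hγ0))

theorem intervalIntegrable_inner_deriv (hα : 0 < α) (hβ : β < 1) (hαβ : α < β)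
    (hγ : 1 < α + γ) (hγ0 : 0 < γ)
    (hg : IsDampedHolder β M L g s t) (hw : IsHolderWithOn γ W w s t) (hst : s < t) :
    IntervalIntegrable (fun r => inner ℝ (leftDeriv α s g r) (rightDeriv α t w r)) volume s t := by
  refine (intervalIntegrable_norm_mul_norm_deriv hα hβ hαβ hγ hγ0 hg hw hst).mono_fun' ?_ ?_
  · rw [uIoc_of_le hst.le, ← restrict_Ioo_eq_restrict_Ioc]
    exact aestronglyMeasurable_inner_deriv α hγ0 hg.continuousOn hw
  · exact Eventually.of_forall fun r => norm_inner_le_norm _ _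

/-- The product of the two derivative bounds has the integrable singularity `(r - s) ^ (-α)` and the
weight `(t - r) ^ (α + γ - 1)`; scaling gives the power `γ`. -/
theorem abs_youngIntegral_le (hα : 0 < α) (hβ : β < 1) (hαβ : α < β) (hγ : 1 < α + γ)
    (hg : IsDampedHolder β M L g s t) (hw : IsHolderWithOn γ W w s t) (hst : s < t) :
    |youngIntegral α g w s t| ≤ youngBound α β γ * (M + L) * W * (t - s) ^ γ := by
  rw [youngIntegral, abs_neg, ← Real.norm_eq_abs]
  refine (intervalIntegral.norm_integral_le_of_norm_le hst.le ?_
    (intervalIntegrable_bound (by linarith) hγ hst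
      (leftConst α β * (M + L) * (rightConst α γ * W)))).trans ?_
  · rw [← ae_restrict_iff' measurableSet_Ioc, ← restrict_Ioo_eq_restrict_Ioc]
    exact (ae_restrict_iff' measurableSet_Ioo).2 (Eventually.of_forall fun r hr =>
      (norm_inner_le_norm _ _).trans (norm_mul_norm_deriv_le hα hβ hαβ hγ hg hw hr.1 hr.2))
  · rw [intervalIntegral.integral_const_mul, integral_rpow_mul_rpow hst,
      show -α + (α + γ - 1) + 1 = γ by ring, youngBound]
    exact le_of_eq (by ring)

/-- The normalization of the pathwise integral. -/
def youngConst (α : ℝ) : ℝ :=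
  (Real.Gamma α)⁻¹ * ((Real.Gamma (1 - α))⁻¹ * eulerBeta (-α) (α - 1))

/-- After exchanging the integrals, the fractional integral of `leftDeriv` appears, which is a
multiple of `g`. The value of `youngConst α`, which is `1` by Euler's formula, is never needed. -/
theorem youngIntegral_of_hasDerivAt [CompleteSpace V] (hα : 0 < α) (hβ : β < 1) (hαβ : α < β)
    (hg : IsDampedHolder β M L g s t) (hst : s < t) {w' : ℝ → V}
    (hw : ∀ x, HasDerivAt w (w' x) x) (hw' : Continuous w') :
    youngIntegral α g w s t = youngConst α * ∫ r in s..t, inner ℝ (g r) (w' r) := by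
  obtain ⟨K, hK⟩ := (isCompact_Icc (a := s) (b := t)).exists_bound_of_continuousOn
    hw'.continuousOn
  have e1 : youngIntegral α g w s t = (Real.Gamma α)⁻¹ *
      ∫ r in s..t, ∫ q in r..t, (q - r) ^ (α - 1) * inner ℝ (leftDeriv α s g r) (w' q) := by
    rw [youngIntegral, ← intervalIntegral.integral_neg, ← intervalIntegral.integral_const_mul]
    refine intervalIntegral.integral_congr_ae ?_
    rw [uIoc_of_le hst.le]
    have : ∀ᵐ r : ℝ, r ≠ t := by simp [ae_iff, measure_singleton]
    filter_upwards [this] with r hrt hr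
    rw [rightDeriv_of_hasDerivAt hα (by linarith) (lt_of_le_of_ne hr.2 hrt) hw hw', inner_neg_right,
      neg_neg, inner_smul_right]
    congr 1
    have hi : IntervalIntegrable (fun q => (q - r) ^ (α - 1) • w' q) volume r t :=
      (intervalIntegrable_sub_left_rpow (by linarith) r t).smul_continuousOn hw'.continuousOn
    have := (innerSL ℝ (leftDeriv α s g r)).intervalIntegral_comp_comm hi
    simp only [innerSL_apply_apply, inner_smul_right] at this
    exact this.symm
  have e2 : ∀ᵐ q : ℝ, q ∈ uIoc s t →
      ∫ r in s..q, (q - r) ^ (α - 1) * inner ℝ (leftDeriv α s g r) (w' q)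
        = (Real.Gamma (1 - α))⁻¹ * eulerBeta (-α) (α - 1) * inner ℝ (g q) (w' q) := by
    rw [uIoc_of_le hst.le]
    refine Eventually.of_forall fun q hq => ?_
    have hgq := hg.mono (show 0 ≤ β by linarith) le_rfl hq.2
    have hi := intervalIntegrable_rpow_smul_leftDeriv hα hβ hαβ hq.1 hgq
    have := (innerSL ℝ (w' q)).intervalIntegral_comp_comm hi
    simp only [innerSL_apply_apply, inner_smul_right] at this
    rw [integral_rpow_smul_leftDeriv hα hβ hαβ hq.1 hgq, inner_smul_right] at this
    simpa only [real_inner_comm (w' q)] using this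
  have hsub : {z : ℝ × ℝ | s < z.2 ∧ z.2 < z.1 ∧ z.1 < t} ⊆ univ ×ˢ Ioo s t := fun z hz =>
    ⟨mem_univ _, hz.1, hz.2.1.trans hz.2.2⟩
  have hswap := integral_triangle_swap
    (f := fun q r => (q - r) ^ (α - 1) * inner ℝ (leftDeriv α s g r) (w' q)) hst.le
    (integrableOn_triangle_of_le_lower (φ := fun r => ‖leftDeriv α s g r‖ * K)
      (k := fun τ => τ ^ (α - 1)) ?_ ?_ ?_ ?_)
  · rw [e1, ← hswap, intervalIntegral.integral_congr_ae e2, intervalIntegral.integral_const_mul,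
      youngConst]
    ring
  · refine AEStronglyMeasurable.mono_measure ?_ (Measure.restrict_mono hsub le_rfl)
    rw [Measure.volume_eq_prod, ← Measure.prod_restrict]
    refine ((measurable_fst.sub measurable_snd).pow_const _).aestronglyMeasurable.mul ?_
    exact (aestronglyMeasurable_leftDeriv α hg.continuousOn).comp_snd.inner
      (hw'.comp continuous_fst).aestronglyMeasurable
  · exact (hg.integrableOn_leftDeriv hα hβ hαβ).norm.mul_const K
  · rw [← integrableOn_Ioc_iff_integrableOn_Ioo,
      ← intervalIntegrable_iff_integrableOn_Ioc_of_le (sub_pos.2 hst).le]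
    exact intervalIntegral.intervalIntegrable_rpow' (by linarith)
  · intro q r hr hrq hq
    have h3 := Real.rpow_nonneg (sub_pos.2 hrq).le (α - 1)
    simp only [Function.uncurry_apply_pair, norm_mul]
    rw [Real.norm_of_nonneg h3, mul_comm]
    gcongr
    exact (norm_inner_le_norm _ _).trans (by gcongr; exact hK q ⟨(hr.trans hrq).le, hq.le⟩)

theorem tendsto_rightDeriv {wn : ℕ → ℝ → V} {r : ℝ} (hγ : 1 < α + γ) (hγ0 : 0 < γ)
    (hwn : ∀ n, IsHolderWithOn γ W (wn n) s t)
    (hlim : ∀ q ∈ Icc s t, Tendsto (fun n => wn n q) atTop (𝓝 (w q))) (hr : s ≤ r) (hrt : r < t) :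
    Tendsto (fun n => rightDeriv α t (wn n) r) atTop (𝓝 (rightDeriv α t w r)) := by
  refine tendsto_leftDeriv (b := fun q => W * (-r - q) ^ (α + γ - 2)) (by linarith) ?_ ?_ ?_ ?_
  · intro n
    refine ContinuousOn.sub ?_ continuousOn_const
    exact ((hwn n).continuousOn hγ0).comp continuousOn_neg
      fun x hx => ⟨by linarith [hx.2], by linarith [hx.1]⟩
  · intro q hq
    exact (hlim _ ⟨by linarith [hq.2], by linarith [hq.1]⟩).sub
      (hlim t ⟨by linarith, le_rfl⟩)
  · intro n q hq
    have := (hwn n).norm_kernel_le (α := α) (q := -q) hr (by linarith [hq.2]) (by linarith [hq.1])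
    rw [show -q - r = -r - q by ring] at this
    rw [show -(1 + (1 - α)) = -(2 - α) by ring, neg_neg, sub_sub_sub_cancel_right]
    exact this
  · exact (intervalIntegrable_sub_right_rpow (by linarith) _ _).const_mul W

theorem tendsto_youngIntegral {wn : ℕ → ℝ → V} (hα : 0 < α) (hβ : β < 1) (hαβ : α < β)
    (hγ : 1 < α + γ) (hγ0 : 0 < γ) (hg : IsDampedHolder β M L g s t)
    (hwn : ∀ n, IsHolderWithOn γ W (wn n) s t)
    (hlim : ∀ q ∈ Icc s t, Tendsto (fun n => wn n q) atTop (𝓝 (w q))) (hst : s < t) :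
    Tendsto (fun n => youngIntegral α g (wn n) s t) atTop (𝓝 (youngIntegral α g w s t)) := by
  refine Tendsto.neg ?_
  have hne : ∀ᵐ r : ℝ, r ≠ t := by simp [ae_iff, measure_singleton]
  refine intervalIntegral.tendsto_integral_filter_of_dominated_convergence _
    (Eventually.of_forall fun n => ?_) (Eventually.of_forall fun n => ?_)
    (intervalIntegrable_bound (by linarith) hγ hst
      (leftConst α β * (M + L) * (rightConst α γ * W))) ?_
  · rw [uIoc_of_le hst.le, ← restrict_Ioo_eq_restrict_Ioc]
    exact aestronglyMeasurable_inner_deriv α hγ0 hg.continuousOn (hwn n)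
  · rw [uIoc_of_le hst.le]
    filter_upwards [hne] with r hrt hr
    exact (norm_inner_le_norm _ _).trans
      (norm_mul_norm_deriv_le hα hβ hαβ hγ hg (hwn n) hr.1 (lt_of_le_of_ne hr.2 hrt))
  · rw [uIoc_of_le hst.le]
    filter_upwards [hne] with r hrt hr
    exact tendsto_const_nhds.inner
      (tendsto_rightDeriv hγ hγ0 hwn hlim hr.1.le (lt_of_le_of_ne hr.2 hrt))

/-- The pathwise integral is a limit of integrals against continuous functions. -/
theorem exists_tendsto_youngIntegral [CompleteSpace V] (hα : 0 < α) (hβ : β < 1) (hαβ : α < β)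
    (hγ : 1 < α + γ) (hγ0 : 0 < γ) (hW : 0 ≤ W) {a b : ℝ} (hab : a ≤ b)
    (hw : IsHolderWithOn γ W w a b) :
    ∃ v : ℕ → ℝ → V, (∀ n, Continuous (v n)) ∧ ∀ (g : ℝ → V) (M L s t : ℝ), a ≤ s → s ≤ t → t ≤ b →
      IsDampedHolder β M L g s t →
      Tendsto (fun n => youngConst α * ∫ r in s..t, inner ℝ (g r) (v n r)) atTop
        (𝓝 (youngIntegral α g w s t)) ∧
      ∀ n, |youngConst α * ∫ r in s..t, inner ℝ (g r) (v n r)|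
        ≤ youngBound α β γ * (M + L) * W * (t - s) ^ γ := by
  have hc := continuous_comp_clampTo hab (hw.continuousOn hγ0)
  set ε : ℕ → ℝ := fun n => 1 / ((n : ℝ) + 1)
  have hε : ∀ n, 0 < ε n := fun n => by positivity
  -- These are the derivatives of the Steklov averages of `w`. They are fixed before `g` and the
  -- subinterval, so that identities relating several integrals can be passed to the limit.
  set v : ℕ → ℝ → V := fun n x =>
    (ε n)⁻¹ • ((w ∘ clampTo a b) (x + ε n) - (w ∘ clampTo a b) x) with hv
  have hvc : ∀ n, Continuous (v n) := fun n =>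
    ((hc.comp (continuous_id.add continuous_const)).sub hc).const_smul _
  refine ⟨v, hvc, fun g M L s t has hst htb hg => ?_⟩
  rcases hst.eq_or_lt with rfl | hst
  · simp [Real.zero_rpow hγ0.ne']
  have he : ∀ n, youngConst α * ∫ r in s..t, inner ℝ (g r) (v n r)
      = youngIntegral α g (steklov (ε n) (w ∘ clampTo a b)) s t := fun n =>
    (youngIntegral_of_hasDerivAt hα hβ hαβ hg hst (fun x => hasDerivAt_steklov _ hc x) (hvc n)).symm
  have hwn : ∀ n, IsHolderWithOn γ W (steklov (ε n) (w ∘ clampTo a b)) s t := fun n =>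
    (hw.steklov_clampTo hγ0 hW hab (hε n)).mono has htb
  simp only [he]
  refine ⟨tendsto_youngIntegral hα hβ hαβ hγ hγ0 hg hwn (fun q hq => ?_) hst, fun n =>
    abs_youngIntegral_le hα hβ hαβ hγ hg (hwn n) hst⟩
  have := tendsto_steklov hc q
  rwa [Function.comp_apply, clampTo_of_mem ⟨has.trans hq.1, hq.2.trans htb⟩] at this

/-- The fractional derivatives depend on the endpoints, so additivity is not visible in the
definition. It is inherited from the ordinary integrals that approximate all three terms. -/
theorem youngIntegral_add_adjacent [CompleteSpace V] (hα : 0 < α) (hβ : β < 1) (hαβ : α < β)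
    (hγ : 1 < α + γ) (hγ0 : 0 < γ) (hW : 0 ≤ W) (hg : IsDampedHolder β M L g s t)
    (hw : IsHolderWithOn γ W w s t) {m : ℝ} (hsm : s ≤ m) (hmt : m ≤ t) :
    youngIntegral α g w s m + youngIntegral α g w m t = youngIntegral α g w s t := by
  obtain ⟨v, hv, h⟩ := exists_tendsto_youngIntegral hα hβ hαβ hγ hγ0 hW (hsm.trans hmt) hw
  have hβ0 : 0 ≤ β := by linarith
  have h1 := (h g M L s m le_rfl hsm hmt (hg.mono hβ0 le_rfl hmt)).1
  have h2 := (h g M L m t hsm hmt le_rfl (hg.mono hβ0 hsm le_rfl)).1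
  have h3 := (h g M L s t le_rfl (hsm.trans hmt) le_rfl hg).1
  refine tendsto_nhds_unique (h1.add h2) (h3.congr fun n => ?_)
  have hc : ∀ x y, s ≤ x → x ≤ y → y ≤ t →
      IntervalIntegrable (fun r => inner ℝ (g r) (v n r)) volume x y := fun x y hx hxy hy => by
    refine ContinuousOn.intervalIntegrable ?_
    rw [uIcc_of_le hxy]
    exact (hg.continuousOn.mono (Icc_subset_Icc hx hy)).inner (hv n).continuousOn
  rw [← mul_add, intervalIntegral.integral_add_adjacent_intervals
    (hc s m le_rfl hsm hmt) (hc m t hsm hmt le_rfl)]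

theorem youngIntegral_sum (hα : 0 < α) (hβ : β < 1) (hαβ : α < β)
    (hγ : 1 < α + γ) (hγ0 : 0 < γ) (hw : IsHolderWithOn γ W w s t) (hst : s ≤ t) {ι : Type*}
    (J : Finset ι) (a : ι → ℝ) {G : ι → ℝ → V} {MM LL : ι → ℝ}
    (hG : ∀ j, IsDampedHolder β (MM j) (LL j) (G j) s t) :
    youngIntegral α (fun r => ∑ j ∈ J, a j • G j r) w s t
      = ∑ j ∈ J, a j * youngIntegral α (G j) w s t := by
  rcases hst.eq_or_lt with rfl | hst
  · simp
  simp only [youngIntegral, mul_neg, Finset.sum_neg_distrib, ← intervalIntegral.integral_const_mul]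
  rw [← intervalIntegral.integral_finsetSum fun j _ =>
    (intervalIntegrable_inner_deriv hα hβ hαβ hγ hγ0 (hG j) hw hst).const_mul (a j)]
  congr 1
  refine intervalIntegral.integral_congr_ae ?_
  rw [uIoc_of_le hst.le]
  refine Eventually.of_forall fun r hr => ?_
  have : leftDeriv α s (fun r => ∑ j ∈ J, a j • G j r) r = ∑ j ∈ J, a j • leftDeriv α s (G j) r := by
    have hi : ∀ j, IntervalIntegrable
        (fun q => a j • ((r - q) ^ (-(1 + α)) • (G j r - G j q))) volume s r := fun j =>
      ((hG j).intervalIntegrable_kernel hβ hαβ hr.1 hr.2).smul (a j)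
    simp only [leftDeriv]
    have e : ∀ q, (r - q) ^ (-(1 + α)) • (∑ j ∈ J, a j • G j r - ∑ j ∈ J, a j • G j q)
        = ∑ j ∈ J, a j • ((r - q) ^ (-(1 + α)) • (G j r - G j q)) := fun q => by
      rw [← Finset.sum_sub_distrib, Finset.smul_sum]
      refine Finset.sum_congr rfl fun j _ => ?_
      rw [← smul_sub, smul_comm]
    simp only [e]
    rw [intervalIntegral.integral_finsetSum fun j _ => hi j]
    simp only [intervalIntegral.integral_smul, Finset.smul_sum, smul_add]
    rw [← Finset.sum_add_distrib]
    refine Finset.sum_congr rfl fun j _ => ?_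
    simp only [smul_comm (a j)]
  rw [this, sum_inner]
  simp only [inner_smul_left, conj_trivial]

/-- By additivity an increment in the left endpoint is an integral over a short interval, which is
of order `γ`. -/
theorem continuousOn_youngIntegral_left [CompleteSpace V] (hα : 0 < α) (hβ : β < 1) (hαβ : α < β)
    (hγ : 1 < α + γ) (hγ0 : 0 < γ) (hW : 0 ≤ W) (hg : IsDampedHolder β M L g s t)
    (hw : IsHolderWithOn γ W w s t) :
    ContinuousOn (fun r => youngIntegral α g w r t) (Icc s t) := by
  refine IsHolderWithOn.continuousOn (W := youngBound α β γ * (M + L) * W) hγ0 ?_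
  intro x y hx hxy hy
  have hβ0 : 0 ≤ β := by linarith
  beta_reduce
  rw [← youngIntegral_add_adjacent hα hβ hαβ hγ hγ0 hW (hg.mono hβ0 hx le_rfl)
    (hw.mono hx le_rfl) hxy hy, sub_add_cancel_right, norm_neg]
  rcases hxy.eq_or_lt with rfl | hxy
  · simp [Real.zero_rpow hγ0.ne']
  · exact abs_youngIntegral_le hα hβ hαβ hγ (hg.mono hβ0 hx hy) (hw.mono hx hy) hxy

theorem IsDampedHolder.smul_of_hasDerivAt (hβ0 : 0 < β) (hβ : β < 1) (hst : s ≤ t)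
    (hg : IsDampedHolder β M L g s t)
    {φ φ' : ℝ → ℝ} (hφ : ∀ x, HasDerivAt φ (φ' x) x) (hφ' : Continuous φ') :
    ∃ M' L', IsDampedHolder β M' L' (fun r => φ r • g r) s t := by
  have hφc : Continuous φ := continuous_iff_continuousAt.2 fun x => (hφ x).continuousAt
  obtain ⟨A, hA⟩ := (isCompact_Icc (a := s) (b := t)).exists_bound_of_continuousOn
    hφc.continuousOn
  obtain ⟨K, hK⟩ := (isCompact_Icc (a := s) (b := t)).exists_bound_of_continuousOn
    hφ'.continuousOn
  have hM := hg.nonneg_sup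
  have hL := hg.nonneg_holder
  have hA0 : 0 ≤ A := (norm_nonneg _).trans (hA s (left_mem_Icc.2 hst))
  have hK0 : 0 ≤ K := (norm_nonneg _).trans (hK s (left_mem_Icc.2 hst))
  have ht0 : 0 ≤ t - s := sub_nonneg.2 hst
  refine ⟨A * M, A * L + K * (t - s) * M, by positivity, by positivity,
    hφc.continuousOn.smul hg.continuousOn, fun x hx => ?_, fun y x hy hyx hx => ?_⟩
  · rw [norm_smul]
    gcongr
    exacts [hA x hx, hg.norm_le x hx]
  · have hxm : x ∈ Icc s t := ⟨(hy.trans hyx).le, hx⟩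
    have hym : y ∈ Icc s t := ⟨hy.le, hyx.le.trans hx⟩
    have h1 : ‖φ x - φ y‖ ≤ K * (x - y) := by
      have := Convex.norm_image_sub_le_of_norm_hasDerivWithin_le
        (fun z _ => (hφ z).hasDerivWithinAt) hK (convex_Icc s t) hym hxm
      rwa [Real.norm_of_nonneg (sub_pos.2 hyx).le] at this
    have hd1 : 0 < x - y := sub_pos.2 hyx
    have hd2 : 0 < y - s := sub_pos.2 hy
    -- A Lipschitz increment is converted into a damped Hölder one by distributing the spare powers
    -- `1 - β` and `β`, both bounded through `t - s`.
    have h2 : x - y ≤ (t - s) * ((x - y) ^ β * (y - s) ^ (-β)) := by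
      calc x - y = (x - y) ^ (1 - β) * (y - s) ^ β * ((x - y) ^ β * (y - s) ^ (-β)) := by
            rw [mul_mul_mul_comm, ← Real.rpow_add hd1, ← Real.rpow_add hd2]; simp
        _ ≤ (t - s) ^ (1 - β) * (t - s) ^ β * ((x - y) ^ β * (y - s) ^ (-β)) := by
            gcongr
            all_goals linarith
        _ = _ := by
            rw [← Real.rpow_add (by linarith)]; simp
    have e : φ x • g x - φ y • g y = φ x • (g x - g y) + (φ x - φ y) • g y := by
      rw [smul_sub, sub_smul]; abel
    have h3 := hg.holder y x hy hyx hx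
    have h4 := hA x hxm
    have h5 := hg.norm_le y hym
    rw [e]
    calc ‖φ x • (g x - g y) + (φ x - φ y) • g y‖
        ≤ ‖φ x‖ * ‖g x - g y‖ + ‖φ x - φ y‖ * ‖g y‖ := by
          rw [← norm_smul, ← norm_smul]; exact norm_add_le _ _
      _ ≤ A * (L * ((x - y) ^ β * (y - s) ^ (-β))) +
          K * ((t - s) * ((x - y) ^ β * (y - s) ^ (-β))) * M := by
          gcongr
          exact h1.trans (by gcongr)
      _ = _ := by ring

/-- Integration by parts for a product with a smooth function. -/
theorem youngIntegral_smul [CompleteSpace V] (hα : 0 < α) (hβ : β < 1) (hαβ : α < β)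
    (hγ : 1 < α + γ) (hγ0 : 0 < γ) (hW : 0 ≤ W) (hg : IsDampedHolder β M L g s t)
    (hw : IsHolderWithOn γ W w s t) (hst : s ≤ t) {φ φ' : ℝ → ℝ}
    (hφ : ∀ x, HasDerivAt φ (φ' x) x) (hφ' : Continuous φ') :
    youngIntegral α (fun r => φ r • g r) w s t
      = φ s * youngIntegral α g w s t + ∫ r in s..t, φ' r * youngIntegral α g w r t := by
  rcases hst.eq_or_lt with rfl | hst'
  · simp
  have hβ0 : 0 < β := by linarith
  have hφc : Continuous φ := continuous_iff_continuousAt.2 fun x => (hφ x).continuousAt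
  obtain ⟨v, hv, h⟩ := exists_tendsto_youngIntegral hα hβ hαβ hγ hγ0 hW hst hw
  obtain ⟨M', L', hφg⟩ := hg.smul_of_hasDerivAt hβ0 hβ hst hφ hφ'
  obtain ⟨K, hK⟩ := (isCompact_Icc (a := s) (b := t)).exists_bound_of_continuousOn
    hφ'.continuousOn
  have hK0 : 0 ≤ K := (norm_nonneg _).trans (hK s (left_mem_Icc.2 hst))
  have hgr : ∀ r ∈ Icc s t, IsDampedHolder β M L g r t := fun r hr => hg.mono hβ0.le hr.1 le_rfl
  have h1 := (h _ M' L' s t le_rfl hst le_rfl hφg).1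
  have h2 := (h g M L s t le_rfl hst le_rfl hg).1
  set C := youngBound α β γ * (M + L) * W
  have hC : 0 ≤ C := mul_nonneg (mul_nonneg (youngBound_nonneg hα (by linarith) hγ β)
    (add_nonneg hg.nonneg_sup hg.nonneg_holder)) hW
  -- For the approximants the integral over `[r, t]` is differentiable in `r`, so the classical
  -- product rule applies before the limit.
  set X : ℕ → ℝ → ℝ := fun n r => ∫ q in r..t, inner ℝ (g q) (v n q)
  have hc : ∀ n, ContinuousOn (fun r => inner ℝ (g r) (v n r)) (Icc s t) := fun n =>
    hg.continuousOn.inner (hv n).continuousOn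
  have hii : ∀ n, IntervalIntegrable (fun r => inner ℝ (g r) (v n r)) volume s t := fun n =>
    (hc n).intervalIntegrable_of_Icc hst
  have hXd : ∀ n, ∀ r ∈ Ioo s t, HasDerivAt (X n) (-inner ℝ (g r) (v n r)) r := by
    intro n r hr
    refine intervalIntegral.integral_hasDerivAt_left ?_ ?_ ?_
    · refine (hii n).mono_set ?_
      rw [uIcc_of_le hr.2.le, uIcc_of_le hst]
      exact Icc_subset_Icc hr.1.le le_rfl
    · exact ((hc n).mono Ioo_subset_Icc_self).stronglyMeasurableAtFilter isOpen_Ioo r hr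
    · exact (hc n).continuousAt (Icc_mem_nhds hr.1 hr.2)
  have hXc : ∀ n, ContinuousOn (X n) (Icc s t) := fun n => by
    have := intervalIntegral.continuousOn_primitive_interval_left
      (μ := volume) (a := s) (b := t) (f := fun r => inner ℝ (g r) (v n r))
      (by rw [uIcc_of_le hst]; exact (hc n).integrableOn_Icc)
    rwa [uIcc_of_le hst] at this
  have hibp : ∀ n, ∫ r in s..t, inner ℝ (φ r • g r) (v n r)
      = φ s * X n s + ∫ r in s..t, φ' r * X n r := by
    intro n
    have i1 : IntervalIntegrable (fun r => φ' r * X n r) volume s t :=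
      (hφ'.continuousOn.mul (hXc n)).intervalIntegrable_of_Icc hst
    have i2 : IntervalIntegrable (fun r => φ r * -inner ℝ (g r) (v n r)) volume s t :=
      (hφc.continuousOn.mul (hc n).neg).intervalIntegrable_of_Icc hst
    have key := intervalIntegral.integral_eq_sub_of_hasDerivAt_of_le (f := fun r => φ r * X n r)
      hst (hφc.continuousOn.mul (hXc n)) (fun r hr => (hφ r).mul (hXd n r hr)) (i1.add i2)
    rw [intervalIntegral.integral_add i1 i2] at key
    have hXt : X n t = 0 := intervalIntegral.integral_same
    simp only [hXt, mul_zero, zero_sub, mul_neg, intervalIntegral.integral_neg] at key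
    simp only [inner_smul_left, conj_trivial]
    linarith
  have hlim : Tendsto (fun n => youngConst α * ∫ r in s..t, inner ℝ (φ r • g r) (v n r)) atTop
      (𝓝 (φ s * youngIntegral α g w s t + ∫ r in s..t, φ' r * youngIntegral α g w r t)) := by
    have e : ∀ n, youngConst α * ∫ r in s..t, inner ℝ (φ r • g r) (v n r)
        = φ s * (youngConst α * X n s) + ∫ r in s..t, φ' r * (youngConst α * X n r) := by
      intro n
      simp only [hibp n, mul_add, mul_left_comm _ (youngConst α),
        intervalIntegral.integral_const_mul]
    simp only [e]
    refine (h2.const_mul (φ s)).add ?_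
    refine intervalIntegral.tendsto_integral_filter_of_dominated_convergence
      (fun _ => K * (C * (t - s) ^ γ)) (Eventually.of_forall fun n => ?_)
      (Eventually.of_forall fun n => Eventually.of_forall fun r hr => ?_)
      intervalIntegrable_const (Eventually.of_forall fun r hr => ?_)
    · rw [uIoc_of_le hst]
      exact ((hφ'.continuousOn.mul (continuousOn_const.mul (hXc n))).mono
        Ioc_subset_Icc_self).aestronglyMeasurable measurableSet_Ioc
    · rw [uIoc_of_le hst] at hr
      have hr' : r ∈ Icc s t := ⟨hr.1.le, hr.2⟩
      rw [norm_mul]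
      have := (h g M L r t hr'.1 hr.2 le_rfl (hgr r hr')).2 n
      gcongr
      · exact hK r hr'
      · exact this.trans (mul_le_mul_of_nonneg_left
          (Real.rpow_le_rpow (sub_nonneg.2 hr.2) (by linarith [hr.1]) hγ0.le) hC)
    · rw [uIoc_of_le hst] at hr
      have hr' : r ∈ Icc s t := ⟨hr.1.le, hr.2⟩
      exact ((h g M L r t hr'.1 hr.2 le_rfl (hgr r hr')).1).const_mul _
  exact tendsto_nhds_unique h1 hlim

end Young

/-! ### Coordinates -/

section Coordinates

variable {V : Type*} [NormedAddCommGroup V] [InnerProductSpace ℝ V] {ι : Type*}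

theorem HilbertBasis.hasSum_inner_sq (e : HilbertBasis ι ℝ V) (x : V) :
    HasSum (fun j => inner ℝ (e j) x ^ 2) (‖x‖ ^ 2) := by
  have := e.hasSum_inner_mul_inner x x
  rw [real_inner_self_eq_norm_sq] at this
  refine this.congr_fun fun j => ?_
  rw [real_inner_comm, sq]

theorem HilbertBasis.ext_inner (e : HilbertBasis ι ℝ V) {x y : V}
    (h : ∀ j, inner ℝ (e j) x = inner ℝ (e j) y) : x = y := by
  refine e.repr.injective (lp.ext (funext fun j => ?_))
  rw [e.repr_apply_apply, e.repr_apply_apply, h j]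

theorem HilbertBasis.norm_le_of_abs_inner_le (e : HilbertBasis ι ℝ V) {x y : V} {A : ℝ} (hA : 0 ≤ A)
    (h : ∀ j, |inner ℝ (e j) y| ≤ A * |inner ℝ (e j) x|) : ‖y‖ ≤ A * ‖x‖ := by
  refine le_of_sq_le_sq ?_ (by positivity)
  rw [mul_pow]
  refine hasSum_le (fun j => ?_) (e.hasSum_inner_sq y) ((e.hasSum_inner_sq x).mul_left (A ^ 2))
  rw [← mul_pow, ← sq_abs, ← sq_abs (A * _), abs_mul, abs_of_nonneg hA]
  exact pow_le_pow_left₀ (abs_nonneg _) (h j) 2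

/-- A family of coefficients that is bounded in the dual sense is square summable. -/
theorem sum_sq_le_of_forall_sum_mul_le {c : ι → ℝ} {K : ℝ}
    (h : ∀ (J : Finset ι) (φ : ι → ℝ), ∑ j ∈ J, φ j * c j ≤ K * √(∑ j ∈ J, φ j ^ 2))
    (J : Finset ι) : ∑ j ∈ J, c j ^ 2 ≤ K ^ 2 := by
  -- Testing with the family itself gives `X ≤ K * √X`.
  have h1 := h J c
  set X := ∑ j ∈ J, c j ^ 2 with hX
  have hX0 : 0 ≤ X := Finset.sum_nonneg fun _ _ => sq_nonneg _
  have h2 : ∑ j ∈ J, c j * c j = X := Finset.sum_congr rfl fun j _ => (sq (c j)).symm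
  rw [h2] at h1
  have h3 := Real.sq_sqrt hX0
  have h4 := Real.sqrt_nonneg X
  nlinarith [sq_nonneg (√X - K)]

theorem HilbertBasis.norm_le_of_forall_sum_mul_le (e : HilbertBasis ι ℝ V) {x : V} {K : ℝ}
    (hK : 0 ≤ K)
    (h : ∀ (J : Finset ι) (φ : ι → ℝ),
      ∑ j ∈ J, φ j * inner ℝ (e j) x ≤ K * √(∑ j ∈ J, φ j ^ 2)) : ‖x‖ ≤ K := by
  refine le_of_sq_le_sq ?_ hK
  exact hasSum_le_of_sum_le (e.hasSum_inner_sq x) (sum_sq_le_of_forall_sum_mul_le h)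

/-- The bound on partial sums makes the series converge; otherwise `∑'` would be zero by convention.
-/
theorem HilbertBasis.inner_tsum_smul (e : HilbertBasis ι ℝ V) {c : ι → ℝ} {K : ℝ}
    (h : ∀ J : Finset ι, ∑ j ∈ J, c j ^ 2 ≤ K) (j : ι) : inner ℝ (e j) (∑' i, c i • e i) = c j := by
  have hs : Summable fun j => c j ^ 2 :=
    summable_of_sum_le (fun _ => sq_nonneg _) h
  have hm : Memℓp c 2 := memℓp_gen (by simpa using hs)
  have := e.hasSum_repr_symm (⟨c, hm⟩ : lp (fun _ : ι => ℝ) 2)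
  have h2 : ∑' i, c i • e i = e.repr.symm ⟨c, hm⟩ := this.tsum_eq
  rw [h2, ← e.repr_apply_apply, LinearIsometryEquiv.apply_symm_apply]

/-- The range of a compact operator lies in the span of a compact set, which is separable. It
contains the basis, so `V` is separable, and the balls of radius `1/2` about basis vectors, which
are `√2` apart, are disjoint. Countability is needed to integrate series of coordinates. -/
theorem HilbertBasis.countable_of_isCompactOperator (e : HilbertBasis ι ℝ V) {K : V →L[ℝ] V}
    (hK : IsCompactOperator K) (h : ∀ i, e i ∈ range K) : Countable ι := by
  obtain ⟨C, hC, hKC⟩ := hK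
  have h1 : range K ⊆ Submodule.span ℝ C := by
    rintro _ ⟨x, rfl⟩
    obtain ⟨δ, hδ, hb⟩ := Metric.mem_nhds_iff.1 hKC
    have hx : (δ / (2 * (‖x‖ + 1))) • x ∈ Metric.ball (0 : V) δ := by
      rw [mem_ball_zero_iff, norm_smul, Real.norm_of_nonneg (by positivity)]
      have : 0 < ‖x‖ + 1 := by positivity
      rw [div_mul_eq_mul_div, div_lt_iff₀ (by positivity)]
      nlinarith [norm_nonneg x]
    have h2 : K ((δ / (2 * (‖x‖ + 1))) • x) ∈ Submodule.span ℝ C := Submodule.subset_span (hb hx)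
    rw [map_smul] at h2
    exact (Submodule.smul_mem_iff _ (by positivity)).1 h2
  have h2 : TopologicalSpace.IsSeparable (Submodule.span ℝ C : Set V) := hC.isSeparable.span
  have h3 : (univ : Set V) ⊆ closure (Submodule.span ℝ C : Set V) := by
    have hd := (Submodule.dense_iff_topologicalClosure_eq_top.2 e.dense_span)
    rw [← hd.closure_eq]
    refine closure_mono ?_
    refine Submodule.span_le.2 ?_
    rintro _ ⟨i, rfl⟩
    exact h1 (h i)
  have : TopologicalSpace.SeparableSpace V :=
    TopologicalSpace.isSeparable_univ_iff.1 (h2.closure.mono h3)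
  refine Pairwise.countable_of_isOpen_disjoint (s := fun i => Metric.ball (e i) (1 / 2)) ?_
    (fun _ => Metric.isOpen_ball) fun i => ⟨e i, Metric.mem_ball_self (by norm_num)⟩
  intro i j hij
  refine Metric.ball_disjoint_ball ?_
  have h4 : ‖e i - e j‖ ^ 2 = 2 := by
    rw [norm_sub_sq_real, e.orthonormal.1 i, e.orthonormal.1 j, e.orthonormal.2 hij]; norm_num
  rw [dist_eq_norm]
  nlinarith [norm_nonneg (e i - e j)]

end Coordinates

/-! ### The semigroup -/

section Semigroup

variable {V : Type u} [NormedAddCommGroup V] [InnerProductSpace ℝ V] {ι : Type v}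

/-- The semigroup `S` is diagonal with respect to `e`, with rates `ν j ≥ lam`. -/
structure IsDiagonalSemigroup (e : HilbertBasis ι ℝ V) (S : ℝ → V →L[ℝ] V) (ν : ι → ℝ) (lam : ℝ) :
    Prop where
  rate_ge : ∀ j, lam ≤ ν j
  inner_apply : ∀ t, 0 ≤ t → ∀ (x : V) j,
    inner ℝ (e j) (S t x) = Real.exp (-(ν j * t)) * inner ℝ (e j) x
  continuousOn : ∀ x : V, ContinuousOn (fun t => S t x) (Ici 0)

/-- The function `exp (ν s) • S s x` has right derivative zero and is therefore constant. The
generator provides right derivatives only. -/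
theorem IsSemigroupGeneratedBy.apply_eigenvector {A : V →ₗ.[ℝ] V} {S : ℝ → V →L[ℝ] V}
    (h : IsSemigroupGeneratedBy A S) {x : V} {ν : ℝ} (hx : (x, -(ν • x)) ∈ A.graph) {t : ℝ}
    (ht : 0 ≤ t) : S t x = Real.exp (-(ν * t)) • x := by
  have hd : ∀ s, 0 ≤ s → HasDerivWithinAt (fun t => S t x) (-(ν • S s x)) (Ici s) s := by
    intro s hs
    rw [← hasDerivWithinAt_Ioi_iff_Ici, hasDerivWithinAt_iff_tendsto_slope' (by simp)]
    have h1 := ((S s).continuous.tendsto _).comp ((h.generator x _).1 hx)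
    rw [map_neg, map_smul] at h1
    have h2 : Tendsto (fun z => z - s) (𝓝[>] s) (𝓝[>] 0) := by
      refine tendsto_nhdsWithin_iff.2 ⟨?_, ?_⟩
      · have : Tendsto (fun z => z - s) (𝓝 s) (𝓝 (s - s)) := tendsto_id.sub_const s
        rw [sub_self] at this
        exact this.mono_left nhdsWithin_le_nhds
      · filter_upwards [self_mem_nhdsWithin] with z hz using sub_pos.2 (mem_Ioi.1 hz)
    refine (h1.comp h2).congr' ?_
    filter_upwards [self_mem_nhdsWithin] with z hz
    have h3 := h.map_add s (z - s) hs (sub_pos.2 hz).le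
    rw [add_sub_cancel] at h3
    simp only [Function.comp_apply, slope_def_module, map_smul, map_sub, h3,
      ContinuousLinearMap.comp_apply]
  have hexp : ∀ s : ℝ, HasDerivAt (fun s => Real.exp (ν * s)) (Real.exp (ν * s) * ν) s := fun s => by
    simpa using ((hasDerivAt_id s).const_mul ν).exp
  have hcst := constant_of_has_deriv_right_zero (f := fun s => Real.exp (ν * s) • S s x)
    (a := 0) (b := t) ?_ ?_ t (right_mem_Icc.2 ht)
  · simp only [mul_zero, Real.exp_zero, one_smul, h.map_zero, ContinuousLinearMap.id_apply] at hcst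
    conv_rhs => rw [← hcst]
    rw [smul_smul, ← Real.exp_add, neg_add_cancel, Real.exp_zero, one_smul]
  · refine ContinuousOn.smul (by fun_prop) ((h.continuousOn x).mono ?_)
    exact fun s hs => hs.1
  · intro s hs
    have := (hexp s).hasDerivWithinAt.smul (hd s hs.1)
    rw [smul_neg, smul_smul, neg_add_cancel] at this
    exact this

/-- The functionals `⟪e j, S t ·⟫` and `exp (-ν j t) ⟪e j, ·⟫` are bounded and agree on the basis.
The rates are eigenvalues, hence bounded below by the least one. -/
theorem AssumptionA1.exists_isDiagonalSemigroup {A : V →ₗ.[ℝ] V} {S : ℝ → V →L[ℝ] V}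
    {e : HilbertBasis ι ℝ V} {lam : ℝ} (hA : AssumptionA1 A S) (he : IsEigenbasis A e)
    (hl : IsLeast (negEigenvalues A) lam) : ∃ ν, IsDiagonalSemigroup e S ν lam := by
  choose ν x hx hν using he
  have hgr : ∀ i, (e i, -(ν i • e i)) ∈ A.graph := fun i =>
    A.mem_graph_iff.2 ⟨x i, hx i, by simp only; rw [← hx i, ← hν i, neg_neg]⟩
  refine ⟨ν, fun j => hl.2 ⟨x j, ?_, hν j⟩, fun t ht y j => ?_, hA.generates.continuousOn⟩
  · rw [hx j]
    exact e.orthonormal.ne_zero j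
  · have hext : (innerSL ℝ (e j)).comp (S t) = Real.exp (-(ν j * t)) • innerSL ℝ (e j) := by
      refine ContinuousLinearMap.ext_on (s := range e) ?_ ?_
      · rw [Submodule.dense_iff_topologicalClosure_eq_top]
        exact e.dense_span
      · rintro _ ⟨i, rfl⟩
        simp only [ContinuousLinearMap.comp_apply, smul_apply,
          innerSL_apply_apply, smul_eq_mul]
        rw [hA.generates.apply_eigenvector (hgr i) ht, inner_smul_right]
        rcases eq_or_ne j i with rfl | hij
        · rfl
        · rw [e.orthonormal.2 hij, mul_zero, mul_zero]
    simpa using DFunLike.congr_fun hext y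

theorem AssumptionA1.countable {A : V →ₗ.[ℝ] V} {S : ℝ → V →L[ℝ] V}
    {e : HilbertBasis ι ℝ V} (hA : AssumptionA1 A S) (he : IsEigenbasis A e) : Countable ι := by
  obtain ⟨K, hK, h⟩ := hA.compact_inverse
  refine e.countable_of_isCompactOperator hK fun i => ?_
  obtain ⟨ν, x, hx, -⟩ := he i
  exact ⟨A x, (h _ _).1 (A.mem_graph_iff.2 ⟨x, hx, rfl⟩)⟩

namespace IsDiagonalSemigroup

variable {e : HilbertBasis ι ℝ V} {S : ℝ → V →L[ℝ] V} {ν : ι → ℝ} {lam : ℝ}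

theorem norm_apply_le (h : IsDiagonalSemigroup e S ν lam) {t : ℝ} (ht : 0 ≤ t) (x : V) :
    ‖S t x‖ ≤ Real.exp (-(lam * t)) * ‖x‖ := by
  refine e.norm_le_of_abs_inner_le (Real.exp_nonneg _) fun j => ?_
  rw [h.inner_apply t ht, abs_mul, Real.abs_exp]
  have := h.rate_ge j
  gcongr

theorem norm_apply_le_norm (h : IsDiagonalSemigroup e S ν lam) (hlam : 0 ≤ lam) {t : ℝ} (ht : 0 ≤ t)
    (x : V) : ‖S t x‖ ≤ ‖x‖ := by
  refine (h.norm_apply_le ht x).trans (mul_le_of_le_one_left (norm_nonneg _) ?_)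
  exact Real.exp_le_one_iff.2 (neg_nonpos.2 (by positivity))

theorem apply_zero (h : IsDiagonalSemigroup e S ν lam) (x : V) : S 0 x = x :=
  e.ext_inner fun j => by rw [h.inner_apply 0 le_rfl]; simp

theorem apply_apply (h : IsDiagonalSemigroup e S ν lam) {s t : ℝ} (hs : 0 ≤ s) (ht : 0 ≤ t) (x : V) :
    S s (S t x) = S (s + t) x :=
  e.ext_inner fun j => by
    rw [h.inner_apply s hs, h.inner_apply t ht, h.inner_apply (s + t) (by linarith), ← mul_assoc,
      ← Real.exp_add]
    congr 2; ring

theorem one_sub_exp_neg_le_rpow {x θ : ℝ} (hx : 0 ≤ x) (hθ : 0 ≤ θ) (hθ1 : θ ≤ 1) :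
    1 - Real.exp (-x) ≤ x ^ θ := by
  rcases hx.eq_or_lt with rfl | hx0
  · simpa using Real.rpow_nonneg le_rfl θ
  rcases le_total x 1 with h | h
  · calc 1 - Real.exp (-x) ≤ x := by linarith [Real.add_one_le_exp (-x)]
      _ = x ^ (1 : ℝ) := (Real.rpow_one x).symm
      _ ≤ x ^ θ := Real.rpow_le_rpow_of_exponent_ge hx0 h hθ1
  · exact (by linarith [Real.exp_pos (-x)] : 1 - Real.exp (-x) ≤ 1).trans
      (Real.one_le_rpow h hθ)

theorem rpow_mul_exp_neg_le_one {x θ : ℝ} (hx : 0 ≤ x) (hθ : 0 ≤ θ) (hθ1 : θ ≤ 1) :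
    x ^ θ * Real.exp (-x) ≤ 1 := by
  have h1 : x ^ θ ≤ Real.exp x := by
    rcases le_total x 1 with h | h
    · exact (Real.rpow_le_one hx h hθ).trans (Real.one_le_exp hx)
    · calc x ^ θ ≤ x ^ (1 : ℝ) := Real.rpow_le_rpow_of_exponent_le h hθ1
        _ = x := Real.rpow_one x
        _ ≤ Real.exp x := by linarith [Real.add_one_le_exp x]
  calc x ^ θ * Real.exp (-x) ≤ Real.exp x * Real.exp (-x) := by gcongr
    _ = 1 := by rw [← Real.exp_add, add_neg_cancel, Real.exp_zero]

/-- The first factor is at most `(ν δ) ^ θ` and the second at most `(ν τ) ^ (-θ)` for `ν > 0`; the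
rate cancels. -/
theorem one_sub_exp_mul_exp_le {ν δ τ θ : ℝ} (hν : 0 ≤ ν) (hδ : 0 ≤ δ) (hτ : 0 < τ) (hθ : 0 ≤ θ)
    (hθ1 : θ ≤ 1) : (1 - Real.exp (-(ν * δ))) * Real.exp (-(ν * τ)) ≤ δ ^ θ * τ ^ (-θ) := by
  have h1 := one_sub_exp_neg_le_rpow (mul_nonneg hν hδ) hθ hθ1
  have h2 := rpow_mul_exp_neg_le_one (mul_nonneg hν hτ.le) hθ hθ1
  calc (1 - Real.exp (-(ν * δ))) * Real.exp (-(ν * τ))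
      ≤ (ν * δ) ^ θ * Real.exp (-(ν * τ)) := by gcongr
    _ = (ν ^ θ * (τ ^ θ * τ ^ (-θ)) * δ ^ θ) * Real.exp (-(ν * τ)) := by
        rw [Real.mul_rpow hν hδ, ← Real.rpow_add hτ]; simp
    _ = δ ^ θ * τ ^ (-θ) * ((ν * τ) ^ θ * Real.exp (-(ν * τ))) := by
        rw [Real.mul_rpow hν hτ.le]; ring
    _ ≤ δ ^ θ * τ ^ (-θ) * 1 := by gcongr
    _ = _ := mul_one _

theorem mul_exp_neg_le {ν τ : ℝ} (hτ : 0 < τ) : ν * Real.exp (-(ν * τ)) ≤ τ⁻¹ := by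
  have h1 : ν * τ ≤ Real.exp (ν * τ) := by linarith [Real.add_one_le_exp (ν * τ)]
  rw [Real.exp_neg, ← div_eq_mul_inv, div_le_iff₀ (Real.exp_pos _), inv_mul_eq_div,
    le_div_iff₀ hτ]
  exact h1

theorem one_sub_exp_mul_rate_mul_exp_le {ν δ τ θ : ℝ} (hν : 0 ≤ ν) (hδ : 0 ≤ δ) (hτ : 0 < τ)
    (hθ : 0 ≤ θ) (hθ1 : θ ≤ 1) :
    (1 - Real.exp (-(ν * δ))) * (ν * Real.exp (-(ν * τ))) ≤ 4 * δ ^ θ * τ ^ (-θ - 1) := by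
  -- Half of the exponential pays for `ν ^ θ`, the other half for the factor `ν`. The halving costs
  -- `2 ^ θ * 2 ≤ 4`.
  have hτ2 : 0 < τ / 2 := by linarith
  have h1 := one_sub_exp_mul_exp_le hν hδ hτ2 hθ hθ1
  have h2 := mul_exp_neg_le (ν := ν) hτ2
  have h0 : 0 ≤ 1 - Real.exp (-(ν * δ)) :=
    sub_nonneg.2 (Real.exp_le_one_iff.2 (neg_nonpos.2 (mul_nonneg hν hδ)))
  have e1 : Real.exp (-(ν * τ)) = Real.exp (-(ν * (τ / 2))) * Real.exp (-(ν * (τ / 2))) := by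
    rw [← Real.exp_add]; congr 1; ring
  have h3 : (τ / 2) ^ (-θ) ≤ 2 * τ ^ (-θ) := by
    rw [Real.div_rpow hτ.le (by norm_num), Real.rpow_neg (by norm_num : (0 : ℝ) ≤ 2), div_inv_eq_mul,
      mul_comm]
    gcongr
    calc (2 : ℝ) ^ θ ≤ 2 ^ (1 : ℝ) := Real.rpow_le_rpow_of_exponent_le (by norm_num) hθ1
      _ = 2 := Real.rpow_one 2
  calc (1 - Real.exp (-(ν * δ))) * (ν * Real.exp (-(ν * τ)))
      = ((1 - Real.exp (-(ν * δ))) * Real.exp (-(ν * (τ / 2)))) *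
          (ν * Real.exp (-(ν * (τ / 2)))) := by rw [e1]; ring
    _ ≤ (δ ^ θ * (τ / 2) ^ (-θ)) * (τ / 2)⁻¹ := by gcongr
    _ ≤ (δ ^ θ * (2 * τ ^ (-θ))) * (τ / 2)⁻¹ := by gcongr
    _ = 4 * δ ^ θ * (τ ^ (-θ) * τ⁻¹) := by field_simp; norm_num
    _ = _ := by rw [← Real.rpow_neg_one, ← Real.rpow_add hτ]; rfl

/-- This is the source of the weight at the left endpoint: an initial value without regularity has
Hölder increments only up to the factor `τ ^ (-θ)`. -/
theorem norm_apply_sub_apply_le (h : IsDiagonalSemigroup e S ν lam) (hlam : 0 ≤ lam) {δ τ θ : ℝ}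
    (hδ : 0 ≤ δ) (hτ : 0 < τ) (hθ : 0 ≤ θ) (hθ1 : θ ≤ 1) (x : V) :
    ‖S δ (S τ x) - S τ x‖ ≤ δ ^ θ * τ ^ (-θ) * ‖x‖ := by
  refine e.norm_le_of_abs_inner_le (by positivity) fun j => ?_
  have hν := hlam.trans (h.rate_ge j)
  have h0 : 0 ≤ 1 - Real.exp (-(ν j * δ)) :=
    sub_nonneg.2 (Real.exp_le_one_iff.2 (neg_nonpos.2 (mul_nonneg hν hδ)))
  rw [inner_sub_right, h.inner_apply δ hδ, h.inner_apply τ hτ.le,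
    show ∀ a b c : ℝ, a * (b * c) - b * c = -((1 - a) * b * c) by intros; ring, abs_neg, abs_mul,
    abs_of_nonneg (mul_nonneg h0 (Real.exp_nonneg _))]
  exact mul_le_mul_of_nonneg_right (one_sub_exp_mul_exp_le hν hδ hτ hθ hθ1) (abs_nonneg _)

theorem continuousOn_apply (h : IsDiagonalSemigroup e S ν lam) (hlam : 0 ≤ lam) {s t : ℝ}
    {f : ℝ → V} (hf : ContinuousOn f (Icc s t)) :
    ContinuousOn (fun r => S (t - r) (f r)) (Icc s t) := by
  intro r₀ hr₀
  have h1 : ContinuousWithinAt (fun r => S (t - r) (f r₀)) (Icc s t) r₀ := by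
    refine ((h.continuousOn (f r₀)).comp (t := Ici 0) (s := Icc s t) (f := fun r => t - r)
      (by fun_prop) fun r hr => ?_) r₀ hr₀
    exact sub_nonneg.2 hr.2
  have h2 : Tendsto (fun r => S (t - r) (f r - f r₀)) (𝓝[Icc s t] r₀) (𝓝 0) := by
    have h3 : Tendsto (fun r => ‖f r - f r₀‖) (𝓝[Icc s t] r₀) (𝓝 0) :=
      tendsto_iff_norm_sub_tendsto_zero.1 (hf r₀ hr₀)
    refine squeeze_zero_norm' ?_ h3
    filter_upwards [self_mem_nhdsWithin] with r hr
    exact h.norm_apply_le_norm hlam (sub_nonneg.2 hr.2) _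
  have h4 := h2.add h1
  rw [zero_add] at h4
  refine h4.congr fun r => ?_
  rw [map_sub, sub_add_cancel]

end IsDiagonalSemigroup

end Semigroup

/-! ### Coordinates of the pathwise integral -/

section PathwiseIntegral

variable {V : Type u} [NormedAddCommGroup V] [InnerProductSpace ℝ V] {ι : Type v}

/-- Admissible exponents: `α` is the order of the fractional derivative, `β` the Hölder exponent of
the integrand and `γ` that of the integrator. -/
structure IsYoungExponents (α β γ : ℝ) : Prop where
  pos : 0 < α
  lt_left : α < β
  left_lt_one : β < 1
  one_lt_add : 1 < α + γ
  left_lt_right : β < γ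

namespace IsYoungExponents

variable {α β γ : ℝ}

theorem lt_one (h : IsYoungExponents α β γ) : α < 1 := h.lt_left.trans h.left_lt_one

theorem left_pos (h : IsYoungExponents α β γ) : 0 < β := h.pos.trans h.lt_left

theorem right_pos (h : IsYoungExponents α β γ) : 0 < γ := h.left_pos.trans h.left_lt_right

end IsYoungExponents

variable {α β γ M L W s t : ℝ} {g w : ℝ → V}

theorem fracDerivLeft_congr {h h' : ℝ → ℝ} {r : ℝ} (hsr : s ≤ r) (he : EqOn h h' (Icc s r)) :
    fracDerivLeft α s h r = fracDerivLeft α s h' r := by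
  rw [fracDerivLeft, fracDerivLeft, he (right_mem_Icc.2 hsr)]
  congr 3
  refine intervalIntegral.integral_congr fun q hq => ?_
  rw [uIcc_of_le hsr] at hq
  simp only [he hq]

theorem fracDerivLeft_inner [CompleteSpace V] (hβ : β < 1) (hαβ : α < β)
    (hg : IsDampedHolder β M L g s t) (x : V) {r : ℝ} (hsr : s < r) (hr : r ≤ t) :
    fracDerivLeft α s (fun q => inner ℝ x (g q)) r = inner ℝ x (leftDeriv α s g r) := by
  have hi := hg.intervalIntegrable_kernel hβ hαβ hsr hr
  have h1 := (innerSL ℝ x).intervalIntegral_comp_comm hi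
  simp only [innerSL_apply_apply, inner_smul_right, inner_sub_right] at h1
  rw [fracDerivLeft, leftDeriv, inner_smul_right, inner_add_right, inner_smul_right,
    inner_smul_right, ← h1, one_div, Real.rpow_neg (sub_pos.2 hsr).le, div_eq_inv_mul]
  congr 3
  refine intervalIntegral.integral_congr fun q hq => ?_
  rw [uIcc_of_le hsr.le] at hq
  rw [Real.rpow_neg (sub_nonneg.2 hq.2), div_eq_inv_mul]

theorem fracDerivRight_inner [CompleteSpace V] (hγ : 1 < α + γ) (hγ0 : 0 < γ)
    (hw : IsHolderWithOn γ W w s t) (x : V) {r : ℝ} (hsr : s ≤ r) (hr : r < t) :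
    fracDerivRight α t (fun q => inner ℝ x (w q)) r = inner ℝ x (rightDeriv α t w r) := by
  have hi : IntervalIntegrable (fun q => (q - r) ^ (-(2 - α)) • (w r - w q)) volume r t := by
    refine ((intervalIntegrable_sub_left_rpow (a := α + γ - 2) (by linarith) r t).const_mul
      W).mono_fun' ?_ ?_
    · rw [uIoc_of_le hr.le]
      refine ((measurable_id.sub measurable_const).pow_const _).aestronglyMeasurable.smul ?_
      refine ContinuousOn.aestronglyMeasurable ?_ measurableSet_Ioc
      exact continuousOn_const.sub ((hw.continuousOn hγ0).mono
        fun q hq => ⟨hsr.trans hq.1.le, hq.2⟩)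
    · rw [uIoc_of_le hr.le]
      exact (ae_restrict_iff' measurableSet_Ioc).2
        (Eventually.of_forall fun q hq => hw.norm_kernel_le hsr hq.1 hq.2)
  have h1 := (innerSL ℝ x).intervalIntegral_comp_comm hi
  simp only [innerSL_apply_apply, inner_smul_right, inner_sub_right] at h1
  rw [fracDerivRight, rightDeriv_eq, inner_smul_right, inner_add_right, inner_smul_right,
    inner_smul_right, inner_sub_right, ← h1, one_div, Real.rpow_neg (sub_pos.2 hr).le,
    div_eq_inv_mul]
  congr 3
  refine intervalIntegral.integral_congr fun q hq => ?_
  rw [uIcc_of_le hr.le] at hq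
  rw [Real.rpow_neg (sub_nonneg.2 hq.1), div_eq_inv_mul]

/-- Summation over the coordinates recovers the vector-valued pathwise integral. -/
theorem hasSum_integral_fracDeriv [CompleteSpace V] [Countable ι] (e : HilbertBasis ι ℝ V)
    (hx : IsYoungExponents α β γ)
    (hg : IsDampedHolder β M L g s t) (hw : IsHolderWithOn γ W w s t) (hst : s < t) :
    HasSum (fun i => ∫ r in s..t, fracDerivLeft α s (fun q => inner ℝ (e i) (g q)) r *
      fracDerivRight α t (fun q => inner ℝ (e i) (w q)) r) (-youngIntegral α g w s t) := by
  rw [youngIntegral, neg_neg]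
  have hne : ∀ᵐ r : ℝ, r ≠ t := by simp [ae_iff, measure_singleton]
  have hcongr : ∀ i, ∫ r in s..t, fracDerivLeft α s (fun q => inner ℝ (e i) (g q)) r *
      fracDerivRight α t (fun q => inner ℝ (e i) (w q)) r
      = ∫ r in s..t, inner ℝ (leftDeriv α s g r) (e i) * inner ℝ (e i) (rightDeriv α t w r) := by
    intro i
    refine intervalIntegral.integral_congr_ae ?_
    rw [uIoc_of_le hst.le]
    filter_upwards [hne] with r hrt hr
    rw [fracDerivLeft_inner hx.left_lt_one hx.lt_left hg _ hr.1 hr.2,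
      fracDerivRight_inner hx.one_lt_add hx.right_pos hw _ hr.1.le (lt_of_le_of_ne hr.2 hrt),
      real_inner_comm]
  simp only [hcongr]
  have hmeas : ∀ i, AEStronglyMeasurable
      (fun r => inner ℝ (leftDeriv α s g r) (e i) * inner ℝ (e i) (rightDeriv α t w r))
      (volume.restrict (Ioo s t)) := fun i =>
    ((aestronglyMeasurable_leftDeriv α hg.continuousOn).inner aestronglyMeasurable_const).mul
      (aestronglyMeasurable_const.inner
        (aestronglyMeasurable_rightDeriv α (hw.continuousOn hx.right_pos)))
  have hsq : ∀ (x : V), Summable fun i => inner ℝ (e i) x ^ 2 := fun x =>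
    (e.hasSum_inner_sq x).summable
  -- The Cauchy–Schwarz inequality for the coordinates dominates the whole series by the product of
  -- the norms, which is integrable for the two derivatives.
  have habs : ∀ x y : V, (Summable fun i => ‖inner ℝ x (e i) * inner ℝ (e i) y‖) ∧
      ∑' i, ‖inner ℝ x (e i) * inner ℝ (e i) y‖ ≤ ‖x‖ * ‖y‖ := by
    intro x y
    have hsum : Summable fun i => ‖inner ℝ x (e i) * inner ℝ (e i) y‖ := by
      refine Summable.of_nonneg_of_le (fun i => norm_nonneg _) (fun i => ?_)
        ((hsq x).add (hsq y))
      rw [norm_mul, Real.norm_eq_abs, Real.norm_eq_abs, real_inner_comm,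
        ← sq_abs (inner ℝ (e i) x), ← sq_abs (inner ℝ (e i) y)]
      nlinarith [sq_nonneg (|inner ℝ (e i) x| - |inner ℝ (e i) y|),
        sq_nonneg (|inner ℝ (e i) x|), sq_nonneg (|inner ℝ (e i) y|)]
    refine ⟨hsum, hsum.tsum_le_of_sum_le fun J => ?_⟩
    have h1 : ∑ i ∈ J, ‖inner ℝ x (e i) * inner ℝ (e i) y‖
        = ∑ i ∈ J, |inner ℝ (e i) x| * |inner ℝ (e i) y| :=
      Finset.sum_congr rfl fun i _ => by
        rw [norm_mul, Real.norm_eq_abs, Real.norm_eq_abs, real_inner_comm]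
    have hb : ∀ z : V, ∑ i ∈ J, |inner ℝ (e i) z| ^ 2 ≤ ‖z‖ ^ 2 := fun z => by
      simp only [sq_abs]
      exact sum_le_hasSum J (fun i _ => sq_nonneg _) (e.hasSum_inner_sq z)
    rw [h1]
    refine le_of_sq_le_sq ((Finset.sum_mul_sq_le_sq_mul_sq J _ _).trans ?_) (by positivity)
    rw [mul_pow]
    exact mul_le_mul (hb x) (hb y) (Finset.sum_nonneg fun i _ => by positivity) (by positivity)
  refine intervalIntegral.hasSum_integral_of_dominated_convergence
    (fun i r => ‖inner ℝ (leftDeriv α s g r) (e i) * inner ℝ (e i) (rightDeriv α t w r)‖)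
    (fun i => ?_) (fun i => Eventually.of_forall fun r _ => le_rfl)
    (Eventually.of_forall fun r _ => (habs _ _).1) ?_
    (Eventually.of_forall fun r _ => e.hasSum_inner_mul_inner _ _)
  · rw [uIoc_of_le hst.le, ← restrict_Ioo_eq_restrict_Ioc]
    exact hmeas i
  · refine (intervalIntegrable_norm_mul_norm_deriv hx.pos hx.left_lt_one hx.lt_left hx.one_lt_add
      hx.right_pos hg hw hst).mono_fun' ?_ (Eventually.of_forall fun r => ?_)
    · rw [uIoc_of_le hst.le, ← restrict_Ioo_eq_restrict_Ioc]
      refine AEMeasurable.aestronglyMeasurable ?_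
      exact AEMeasurable.tsum fun i => (hmeas i).norm.aemeasurable
    · beta_reduce
      rw [Real.norm_of_nonneg (tsum_nonneg fun i => norm_nonneg _)]
      exact (habs _ _).2

end PathwiseIntegral

/-! ### Hilbert–Schmidt operators and their adjoints -/

section Adjoint

variable {V : Type u} [NormedAddCommGroup V] [InnerProductSpace ℝ V] {ι : Type v}
  {e : HilbertBasis ι ℝ V}

theorem AssumptionA3.norm_sub_le {G : V → HilbertSchmidt e} {cDG cD2G : ℝ}
    (hG : AssumptionA3 G cDG cD2G) (x y : V) : ‖G x - G y‖ ≤ cDG * ‖x - y‖ :=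
  Convex.norm_image_sub_le_of_norm_fderiv_le (𝕜 := ℝ)
    (fun z _ => hG.contDiff.differentiable (by norm_num) z) (fun z _ => hG.bound_one z)
    convex_univ (mem_univ y) (mem_univ x)

theorem AssumptionA3.nonneg {G : V → HilbertSchmidt e} {cDG cD2G : ℝ}
    (hG : AssumptionA3 G cDG cD2G) : 0 ≤ cDG := (norm_nonneg _).trans (hG.bound_one 0)

variable [CompleteSpace V]

/-- The adjoint of a Hilbert–Schmidt operator. -/
def HilbertSchmidt.adj (z : HilbertSchmidt e) : V →L[ℝ] V := ContinuousLinearMap.adjoint z.toCLM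

theorem HilbertSchmidt.inner_adj (z : HilbertSchmidt e) (x y : V) :
    inner ℝ x (z.adj y) = inner ℝ y (z.toCLM x) := by
  rw [adj, ContinuousLinearMap.adjoint_inner_right, real_inner_comm]

/-- Parseval's identity for `z.adj y`, with the Cauchy–Schwarz inequality in each term `⟪y, z (e
i)⟫`. -/
theorem HilbertSchmidt.norm_adj_apply_le (z : HilbertSchmidt e) (y : V) :
    ‖z.adj y‖ ≤ ‖z‖ * ‖y‖ := by
  refine le_of_sq_le_sq ?_ (by positivity)
  have hs : Summable fun i => ‖z.toCLM (e i)‖ ^ 2 := z.2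
  rw [mul_pow, z.norm_sq_eq]
  refine hasSum_le (fun i => ?_) (e.hasSum_inner_sq (z.adj y)) (hs.hasSum.mul_right _)
  rw [z.inner_adj, ← sq_abs, ← mul_pow, mul_comm]
  exact pow_le_pow_left₀ (abs_nonneg _) (abs_real_inner_le_norm _ _) 2

theorem HilbertSchmidt.adj_sub_apply (z z' : HilbertSchmidt e) (y : V) :
    (z - z').adj y = z.adj y - z'.adj y := by
  have : (z - z').toCLM = z.toCLM - z'.toCLM := rfl
  rw [adj, adj, adj, this, map_sub]; rfl

/-- Testing the operator-valued integrand with `y` makes it vector-valued. That the constants are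
proportional to `‖y‖` is what makes the duality argument work. -/
theorem IsDampedHolder.adj_apply {G : V → HilbertSchmidt e} {c β M L s t : ℝ} {u : ℝ → V}
    (hc : 0 ≤ c) (hG : ∀ x y, ‖G x - G y‖ ≤ c * ‖x - y‖) (hG0 : G 0 = 0)
    (hu : IsDampedHolder β M L u s t) (y : V) :
    IsDampedHolder β (c * M * ‖y‖) (c * L * ‖y‖) (fun r => (G (u r)).adj y) s t := by
  have hM := hu.nonneg_sup
  have hL := hu.nonneg_holder
  have hsub : ∀ a b, ‖(G a).adj y - (G b).adj y‖ ≤ c * ‖a - b‖ * ‖y‖ := fun a b => by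
    rw [← HilbertSchmidt.adj_sub_apply]
    exact (HilbertSchmidt.norm_adj_apply_le _ _).trans (by gcongr; exact hG a b)
  refine ⟨by positivity, by positivity, ?_, fun x hx => ?_, fun a b ha hab hb => ?_⟩
  · refine Continuous.comp_continuousOn (g := fun x => (G x).adj y) ?_ hu.continuousOn
    refine (LipschitzWith.of_dist_le_mul (K := (c * ‖y‖).toNNReal) fun a b => ?_).continuous
    rw [dist_eq_norm, dist_eq_norm, Real.coe_toNNReal _ (by positivity)]
    exact (hsub a b).trans (le_of_eq (by ring))
  · have := hsub (u x) 0
    have h0 : (G 0).adj y = 0 := by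
      have := HilbertSchmidt.norm_adj_apply_le (G 0) y
      rw [hG0, norm_zero, zero_mul] at this
      rw [hG0]; exact norm_le_zero_iff.1 this
    rw [h0, sub_zero, sub_zero] at this
    exact this.trans (by gcongr; exact hu.norm_le x hx)
  · calc _ ≤ c * ‖u b - u a‖ * ‖y‖ := hsub _ _
      _ ≤ c * (L * ((b - a) ^ β * (a - s) ^ (-β))) * ‖y‖ := by
          gcongr; exact hu.holder a b ha hab hb
      _ = _ := by ring

end Adjoint

/-! ### The stochastic convolution in coordinates -/

section Convolution

theorem sqrt_sum_sq_mul_le {ι : Type*} (J : Finset ι) (φ c : ι → ℝ) {A : ℝ} (hA : 0 ≤ A)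
    (hc : ∀ j ∈ J, |c j| ≤ A) : √(∑ j ∈ J, (φ j * c j) ^ 2) ≤ A * √(∑ j ∈ J, φ j ^ 2) := by
  refine Real.sqrt_le_iff.2 ⟨by positivity, ?_⟩
  rw [mul_pow, Real.sq_sqrt (Finset.sum_nonneg fun _ _ => sq_nonneg _), Finset.mul_sum]
  refine Finset.sum_le_sum fun j hj => ?_
  rw [mul_pow, mul_comm, ← sq_abs (c j)]
  exact mul_le_mul_of_nonneg_right (pow_le_pow_left₀ (abs_nonneg _) (hc j hj) 2) (sq_nonneg _)

/-- A bound in the dual sense for convolutions with singular diagonal kernels. -/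
theorem sum_mul_add_integral_le {ι : Type*} (J : Finset ι) (φ c : ι → ℝ) (h k : ι → ℝ → ℝ)
    {s t γ θ E A : ℝ} (hst : s < t) (hE : 0 ≤ E) (hA : 0 ≤ A) (hθ : θ < γ)
    (hh : ∀ r, s ≤ r → r < t → ∀ a : ι → ℝ,
      ∑ j ∈ J, a j * h j r ≤ E * (t - r) ^ γ * √(∑ j ∈ J, a j ^ 2))
    (hc : ∀ j ∈ J, |c j| ≤ A * (t - s) ^ (-θ))
    (hk : ∀ j ∈ J, ∀ r, s ≤ r → r < t → |k j r| ≤ A * (t - r) ^ (-θ - 1))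
    (hi : ∀ j ∈ J, IntervalIntegrable (fun r => k j r * h j r) volume s t) :
    ∑ j ∈ J, φ j * (c j * h j s + ∫ r in s..t, k j r * h j r)
      ≤ E * A * (1 + 1 / (γ - θ)) * (t - s) ^ (γ - θ) * √(∑ j ∈ J, φ j ^ 2) := by
  set N := √(∑ j ∈ J, φ j ^ 2)
  have hN : 0 ≤ N := Real.sqrt_nonneg _
  have hd : 0 < t - s := sub_pos.2 hst
  -- The kernel coefficients are absorbed into the test family, so `hh` applies with `φ j * c j`.
  have h1 : ∑ j ∈ J, φ j * (c j * h j s) ≤ E * A * (t - s) ^ (γ - θ) * N := by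
    calc ∑ j ∈ J, φ j * (c j * h j s) = ∑ j ∈ J, (φ j * c j) * h j s := by simp only [mul_assoc]
      _ ≤ E * (t - s) ^ γ * √(∑ j ∈ J, (φ j * c j) ^ 2) := hh s le_rfl hst _
      _ ≤ E * (t - s) ^ γ * (A * (t - s) ^ (-θ) * N) := by
          gcongr; exact sqrt_sum_sq_mul_le J φ c (by positivity) hc
      _ = E * A * ((t - s) ^ γ * (t - s) ^ (-θ)) * N := by ring
      _ = _ := by rw [← Real.rpow_add hd]; rfl
  have h2 : ∑ j ∈ J, φ j * ∫ r in s..t, k j r * h j r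
      ≤ E * A * N * ((t - s) ^ (γ - θ) / (γ - θ)) := by
    have e1 : ∑ j ∈ J, φ j * ∫ r in s..t, k j r * h j r
        = ∫ r in s..t, ∑ j ∈ J, φ j * (k j r * h j r) := by
      rw [intervalIntegral.integral_finsetSum fun j hj => (hi j hj).const_mul (φ j)]
      simp only [intervalIntegral.integral_const_mul]
    have e2 : ∫ r in s..t, E * A * N * (t - r) ^ (γ - θ - 1)
        = E * A * N * ((t - s) ^ (γ - θ) / (γ - θ)) := by
      rw [intervalIntegral.integral_const_mul, integral_sub_right_rpow (by linarith),
        sub_add_cancel]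
    rw [e1, ← e2]
    -- For each `r` the test family is `φ j * k j r`. The factor `(t - r) ^ γ` compensates the
    -- kernel of order `θ + 1`, since `θ < γ`.
    refine intervalIntegral.integral_mono_on_of_le_Ioo hst.le
      (by simpa only [Finset.sum_fn] using
        IntervalIntegrable.sum J fun j hj => (hi j hj).const_mul (φ j))
      ((intervalIntegrable_sub_right_rpow (by linarith) s t).const_mul _) fun r hr => ?_
    have hr0 : 0 < t - r := sub_pos.2 hr.2
    calc ∑ j ∈ J, φ j * (k j r * h j r) = ∑ j ∈ J, (φ j * k j r) * h j r := by
          simp only [mul_assoc]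
      _ ≤ E * (t - r) ^ γ * √(∑ j ∈ J, (φ j * k j r) ^ 2) := hh r hr.1.le hr.2 _
      _ ≤ E * (t - r) ^ γ * (A * (t - r) ^ (-θ - 1) * N) := by
          gcongr
          exact sqrt_sum_sq_mul_le J φ (fun j => k j r) (by positivity)
            fun j hj => hk j hj r hr.1.le hr.2
      _ = E * A * N * ((t - r) ^ γ * (t - r) ^ (-θ - 1)) := by ring
      _ = _ := by rw [← Real.rpow_add hr0]; congr 2; ring
  calc ∑ j ∈ J, φ j * (c j * h j s + ∫ r in s..t, k j r * h j r)
      = ∑ j ∈ J, φ j * (c j * h j s) + ∑ j ∈ J, φ j * ∫ r in s..t, k j r * h j r := by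
        rw [← Finset.sum_add_distrib]; simp only [mul_add]
    _ ≤ E * A * (t - s) ^ (γ - θ) * N + E * A * N * ((t - s) ^ (γ - θ) / (γ - θ)) :=
        add_le_add h1 h2
    _ = _ := by ring

theorem youngIntegral_const_smul {V : Type u} [NormedAddCommGroup V] [InnerProductSpace ℝ V]
    {α β γ M L W s t : ℝ} (hx : IsYoungExponents α β γ) {g w : ℝ → V} (a : ℝ)
    (hg : IsDampedHolder β M L g s t) (hw : IsHolderWithOn γ W w s t) (hst : s ≤ t) :
    youngIntegral α (fun r => a • g r) w s t = a * youngIntegral α g w s t := by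
  simpa using youngIntegral_sum hx.pos hx.left_lt_one hx.lt_left hx.one_lt_add hx.right_pos hw hst
    {()} (fun _ => a) (G := fun _ => g) (fun _ => hg)

variable {V : Type u} [NormedAddCommGroup V] [InnerProductSpace ℝ V] [CompleteSpace V] {ι : Type v}

/-- The coordinate `j` of `∫ₛᵗ G(u) dω`. -/
def integralCoord {e : HilbertBasis ι ℝ V} (α : ℝ) (G : V → HilbertSchmidt e) (ω u : ℝ → V)
    (s t : ℝ) (j : ι) : ℝ := youngIntegral α (fun r => (G (u r)).adj (e j)) ω s t

/-- The coordinate `j` of `∫ₛᵗ S(t - r) G(u(r)) dω(r)`. -/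
def convolutionCoord {e : HilbertBasis ι ℝ V} (α : ℝ) (ν : ι → ℝ) (G : V → HilbertSchmidt e)
    (ω u : ℝ → V) (s t : ℝ) (j : ι) : ℝ :=
  youngIntegral α (fun r => Real.exp (-(ν j * (t - r))) • (G (u r)).adj (e j)) ω s t

variable {e : HilbertBasis ι ℝ V} {G : V → HilbertSchmidt e} {ω u : ℝ → V} {ν : ι → ℝ}
  {α β γ M L W c s t : ℝ}

theorem hasDerivAt_exp_rate (ν t x : ℝ) :
    HasDerivAt (fun r => Real.exp (-(ν * (t - r)))) (ν * Real.exp (-(ν * (t - x)))) x := by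
  have h : HasDerivAt (fun r => -(ν * (t - r))) (-(ν * -1)) x :=
    (((hasDerivAt_id' x).const_sub t).const_mul ν).neg
  have h2 := h.exp
  convert h2 using 1
  ring

/-- By linearity the sum is a single integral, tested with `y = ∑ a j • e j`, whose norm is the root
on the right. The bound does not depend on the number of coordinates. -/
theorem sum_mul_integralCoord_le (hx : IsYoungExponents α β γ) (hc : 0 ≤ c)
    (hG : ∀ x y, ‖G x - G y‖ ≤ c * ‖x - y‖) (hG0 : G 0 = 0)
    (hu : IsDampedHolder β M L u s t) (hω : IsHolderWithOn γ W ω s t) (hst : s < t)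
    (J : Finset ι) (a : ι → ℝ) :
    ∑ j ∈ J, a j * integralCoord α G ω u s t j
      ≤ youngBound α β γ * c * W * (M + L) * (t - s) ^ γ * √(∑ j ∈ J, a j ^ 2) := by
  set y := ∑ j ∈ J, a j • e j with hy
  have h1 : ∑ j ∈ J, a j * integralCoord α G ω u s t j
      = youngIntegral α (fun r => (G (u r)).adj y) ω s t := by
    have := youngIntegral_sum hx.pos hx.left_lt_one hx.lt_left hx.one_lt_add hx.right_pos hω hst.le
      J a (fun j => hu.adj_apply hc hG hG0 (e j))
    simp only [integralCoord]
    rw [← this]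
    simp only [hy, map_sum, map_smul]
  have h2 : ‖y‖ = √(∑ j ∈ J, a j ^ 2) := by
    rw [← Real.sqrt_sq (norm_nonneg y), ← real_inner_self_eq_norm_sq, hy,
      e.orthonormal.inner_sum]
    simp only [conj_trivial, sq]
  have h3 := abs_youngIntegral_le hx.pos hx.left_lt_one hx.lt_left hx.one_lt_add
    (hu.adj_apply hc hG hG0 y) hω hst
  rw [h1, ← h2]
  exact (le_abs_self _).trans (h3.trans (le_of_eq (by ring)))

/-- Keeping the exponential inside the integrand would produce Hölder constants depending on `ν j`.
Integration by parts moves it into an ordinary integral instead. -/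
theorem convolutionCoord_eq (hx : IsYoungExponents α β γ) (hc : 0 ≤ c) (hW : 0 ≤ W)
    (hG : ∀ x y, ‖G x - G y‖ ≤ c * ‖x - y‖) (hG0 : G 0 = 0)
    (hu : IsDampedHolder β M L u s t) (hω : IsHolderWithOn γ W ω s t) (hst : s ≤ t) (j : ι) :
    convolutionCoord α ν G ω u s t j
      = Real.exp (-(ν j * (t - s))) * integralCoord α G ω u s t j
        + ∫ r in s..t, ν j * Real.exp (-(ν j * (t - r))) * integralCoord α G ω u r t j :=
  youngIntegral_smul hx.pos hx.left_lt_one hx.lt_left hx.one_lt_add hx.right_pos hW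
    (hu.adj_apply hc hG hG0 (e j)) hω hst (hasDerivAt_exp_rate (ν j) t) (by fun_prop)

theorem continuousOn_integralCoord (hx : IsYoungExponents α β γ) (hc : 0 ≤ c) (hW : 0 ≤ W)
    (hG : ∀ x y, ‖G x - G y‖ ≤ c * ‖x - y‖) (hG0 : G 0 = 0)
    (hu : IsDampedHolder β M L u s t) (hω : IsHolderWithOn γ W ω s t) (j : ι) :
    ContinuousOn (fun r => integralCoord α G ω u r t j) (Icc s t) :=
  continuousOn_youngIntegral_left hx.pos hx.left_lt_one hx.lt_left hx.one_lt_add hx.right_pos hW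
    (hu.adj_apply hc hG hG0 (e j)) hω

/-- The stochastic convolution is bounded like the integral itself. -/
theorem sum_mul_convolutionCoord_le (hx : IsYoungExponents α β γ) (hc : 0 ≤ c) (hW : 0 ≤ W)
    (hG : ∀ x y, ‖G x - G y‖ ≤ c * ‖x - y‖) (hG0 : G 0 = 0)
    (hu : IsDampedHolder β M L u s t) (hω : IsHolderWithOn γ W ω s t) (hst : s < t)
    (hν : ∀ j, 0 ≤ ν j) (J : Finset ι) (φ : ι → ℝ) :
    ∑ j ∈ J, φ j * convolutionCoord α ν G ω u s t j
      ≤ youngBound α β γ * c * W * (M + L) * (1 + 1 / γ) * (t - s) ^ γ * √(∑ j ∈ J, φ j ^ 2) := by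
  have hK := youngBound_nonneg hx.pos hx.lt_one hx.one_lt_add β
  have hML : 0 ≤ M + L := add_nonneg hu.nonneg_sup hu.nonneg_holder
  simp only [convolutionCoord_eq hx hc hW hG hG0 hu hω hst.le]
  have := sum_mul_add_integral_le J φ (fun j => Real.exp (-(ν j * (t - s))))
    (fun j r => integralCoord α G ω u r t j) (fun j r => ν j * Real.exp (-(ν j * (t - r))))
    (θ := 0) (A := 1) (γ := γ) (E := youngBound α β γ * c * W * (M + L)) hst (by positivity)
    zero_le_one hx.right_pos ?_ ?_ ?_ ?_
  · simpa using this
  · intro r hr hrt a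
    exact sum_mul_integralCoord_le hx hc hG hG0 (hu.mono hx.left_pos.le hr le_rfl)
      (hω.mono hr le_rfl) hrt J a
  · intro j _
    rw [Real.abs_exp, neg_zero, Real.rpow_zero, mul_one]
    exact Real.exp_le_one_iff.2 (neg_nonpos.2 (mul_nonneg (hν j) (sub_pos.2 hst).le))
  · intro j _ r _ hrt
    rw [abs_of_nonneg (mul_nonneg (hν j) (Real.exp_nonneg _)), neg_zero, zero_sub,
      Real.rpow_neg_one, one_mul]
    exact IsDiagonalSemigroup.mul_exp_neg_le (sub_pos.2 hrt)
  · intro j _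
    refine ContinuousOn.intervalIntegrable_of_Icc hst.le ?_
    exact ContinuousOn.mul (by fun_prop) (continuousOn_integralCoord hx hc hW hG hG0 hu hω j)

/-- Smoothing of the increments of the stochastic convolution under the semigroup. -/
theorem sum_mul_exp_sub_one_mul_convolutionCoord_le (hx : IsYoungExponents α β γ) (hc : 0 ≤ c)
    (hW : 0 ≤ W) (hG : ∀ x y, ‖G x - G y‖ ≤ c * ‖x - y‖) (hG0 : G 0 = 0)
    (hu : IsDampedHolder β M L u s t) (hω : IsHolderWithOn γ W ω s t) (hst : s < t)
    (hν : ∀ j, 0 ≤ ν j) {δ : ℝ} (hδ : 0 ≤ δ) (J : Finset ι) (φ : ι → ℝ) :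
    ∑ j ∈ J, φ j * ((Real.exp (-(ν j * δ)) - 1) * convolutionCoord α ν G ω u s t j)
      ≤ youngBound α β γ * c * W * (M + L) * (4 * δ ^ β) * (1 + 1 / (γ - β)) * (t - s) ^ (γ - β) *
        √(∑ j ∈ J, φ j ^ 2) := by
  have hK := youngBound_nonneg hx.pos hx.lt_one hx.one_lt_add β
  have hML : 0 ≤ M + L := add_nonneg hu.nonneg_sup hu.nonneg_holder
  have hexp : ∀ j, 0 ≤ 1 - Real.exp (-(ν j * δ)) := fun j =>
    sub_nonneg.2 (Real.exp_le_one_iff.2 (neg_nonpos.2 (mul_nonneg (hν j) hδ)))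
  have e1 : ∀ j, (Real.exp (-(ν j * δ)) - 1) * convolutionCoord α ν G ω u s t j
      = (Real.exp (-(ν j * δ)) - 1) * Real.exp (-(ν j * (t - s))) * integralCoord α G ω u s t j
        + ∫ r in s..t, (Real.exp (-(ν j * δ)) - 1) * (ν j * Real.exp (-(ν j * (t - r)))) *
          integralCoord α G ω u r t j := fun j => by
    rw [convolutionCoord_eq hx hc hW hG hG0 hu hω hst.le, mul_add, mul_assoc,
      ← intervalIntegral.integral_const_mul]
    simp only [mul_assoc]
  simp only [e1]
  -- The kernel has a singularity of order `1 + β`, integrable against `(t - r) ^ γ` because `β <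
  -- γ`; the increment contributes `δ ^ β`.
  refine sum_mul_add_integral_le J φ
    (fun j => (Real.exp (-(ν j * δ)) - 1) * Real.exp (-(ν j * (t - s))))
    (fun j r => integralCoord α G ω u r t j)
    (fun j r => (Real.exp (-(ν j * δ)) - 1) * (ν j * Real.exp (-(ν j * (t - r)))))
    (θ := β) (A := 4 * δ ^ β) (γ := γ) (E := youngBound α β γ * c * W * (M + L)) hst (by positivity)
    (by positivity) hx.left_lt_right ?_ ?_ ?_ ?_
  · intro r hr hrt a
    exact sum_mul_integralCoord_le hx hc hG hG0 (hu.mono hx.left_pos.le hr le_rfl)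
      (hω.mono hr le_rfl) hrt J a
  · intro j _
    have hp : 0 ≤ δ ^ β * (t - s) ^ (-β) :=
      mul_nonneg (Real.rpow_nonneg hδ _) (Real.rpow_nonneg (sub_pos.2 hst).le _)
    rw [abs_mul, abs_sub_comm, abs_of_nonneg (hexp j), Real.abs_exp]
    refine (IsDiagonalSemigroup.one_sub_exp_mul_exp_le (hν j) hδ (sub_pos.2 hst) hx.left_pos.le
      hx.left_lt_one.le).trans ?_
    linarith
  · intro j _ r _ hrt
    rw [abs_mul, abs_sub_comm, abs_of_nonneg (hexp j),
      abs_of_nonneg (mul_nonneg (hν j) (Real.exp_nonneg _))]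
    exact IsDiagonalSemigroup.one_sub_exp_mul_rate_mul_exp_le (hν j) hδ (sub_pos.2 hrt)
      hx.left_pos.le hx.left_lt_one.le
  · intro j _
    refine ContinuousOn.intervalIntegrable_of_Icc hst.le ?_
    exact ContinuousOn.mul (by fun_prop) (continuousOn_integralCoord hx hc hW hG hG0 hu hω j)

/-- The cocycle property of the stochastic convolution. -/
theorem convolutionCoord_cocycle (hx : IsYoungExponents α β γ) (hc : 0 ≤ c) (hW : 0 ≤ W)
    (hG : ∀ x y, ‖G x - G y‖ ≤ c * ‖x - y‖) (hG0 : G 0 = 0)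
    (hu : IsDampedHolder β M L u s t) (hω : IsHolderWithOn γ W ω s t) {m : ℝ} (hsm : s ≤ m)
    (hmt : m ≤ t) (j : ι) :
    convolutionCoord α ν G ω u s t j = Real.exp (-(ν j * (t - m))) *
      convolutionCoord α ν G ω u s m j + convolutionCoord α ν G ω u m t j := by
  have hd := hu.adj_apply hc hG hG0 (e j)
  obtain ⟨M', L', h1⟩ := hd.smul_of_hasDerivAt hx.left_pos hx.left_lt_one (hsm.trans hmt)
    (hasDerivAt_exp_rate (ν j) t) (by fun_prop)
  obtain ⟨M'', L'', h2⟩ := (hd.mono hx.left_pos.le le_rfl hmt).smul_of_hasDerivAt hx.left_pos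
    hx.left_lt_one hsm (hasDerivAt_exp_rate (ν j) m) (by fun_prop)
  simp only [convolutionCoord]
  rw [← youngIntegral_add_adjacent hx.pos hx.left_lt_one hx.lt_left hx.one_lt_add hx.right_pos hW
    h1 hω hsm hmt, ← youngIntegral_const_smul hx _ h2 (hω.mono le_rfl hmt) hsm]
  congr 2
  funext r
  rw [smul_smul, ← Real.exp_add]
  congr 2; ring

/-- The coordinates of the stochastic convolution. -/
theorem inner_pathwiseIntegral [Countable ι] (hx : IsYoungExponents α β γ) (hc : 0 ≤ c) (hW : 0 ≤ W)
    (hG : ∀ x y, ‖G x - G y‖ ≤ c * ‖x - y‖) (hG0 : G 0 = 0) {S : ℝ → V →L[ℝ] V} {lam : ℝ}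
    (hS : IsDiagonalSemigroup e S ν lam) (hlam : 0 ≤ lam)
    (hu : IsDampedHolder β M L u s t) (hω : IsHolderWithOn γ W ω s t) (hst : s ≤ t) (j : ι) :
    inner ℝ (e j) (pathwiseIntegral e α s t (fun r => (S (t - r)).comp (G (u r)).toCLM) ω)
      = convolutionCoord α ν G ω u s t j := by
  rcases hst.eq_or_lt with rfl | hst
  · simp [pathwiseIntegral, convolutionCoord]
  have hν : ∀ j, 0 ≤ ν j := fun j => hlam.trans (hS.rate_ge j)
  have h1 : ∀ j, (∑' i, ∫ r in s..t,
      fracDerivLeft α s (fun q => inner ℝ (e j) (((S (t - q)).comp (G (u q)).toCLM) (e i))) r *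
        fracDerivRight α t (fun q => inner ℝ (e i) (ω q)) r)
      = -convolutionCoord α ν G ω u s t j := by
    intro j
    obtain ⟨M', L', hd⟩ := (hu.adj_apply hc hG hG0 (e j)).smul_of_hasDerivAt hx.left_pos
      hx.left_lt_one hst.le (hasDerivAt_exp_rate (ν j) t) (by fun_prop)
    rw [convolutionCoord, ← (hasSum_integral_fracDeriv e hx hd hω hst).tsum_eq]
    refine tsum_congr fun i => intervalIntegral.integral_congr fun r hr => ?_
    rw [uIcc_of_le hst.le] at hr
    congr 1
    refine fracDerivLeft_congr hr.1 fun q hq => ?_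
    rw [ContinuousLinearMap.comp_apply, hS.inner_apply _ (by linarith [hq.2, hr.2]),
      inner_smul_right, HilbertSchmidt.inner_adj]
  have hK := youngBound_nonneg hx.pos hx.lt_one hx.one_lt_add β
  have hML : 0 ≤ M + L := add_nonneg hu.nonneg_sup hu.nonneg_holder
  -- Square summability of the coordinates makes the outer series of `pathwiseIntegral` converge.
  have h2 := sum_sq_le_of_forall_sum_mul_le
    (sum_mul_convolutionCoord_le hx hc hW hG hG0 hu hω hst hν)
  rw [pathwiseIntegral]
  simp only [h1, neg_smul, tsum_neg, neg_neg]
  exact e.inner_tsum_smul h2 j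

end Convolution

/-! ### Estimates for mild solutions -/

section MildSolution

variable {V : Type u} [NormedAddCommGroup V] [InnerProductSpace ℝ V] {ι : Type v}

/-- The quantitative assumptions on the coefficients of the evolution equation. -/
structure IsEvolutionSystem (e : HilbertBasis ι ℝ V) (S : ℝ → V →L[ℝ] V) (ν : ι → ℝ) (F : V → V)
    (G : V → HilbertSchmidt e) (ω : ℝ → V) (α β γ lam cF cG : ℝ) : Prop where
  exponents : IsYoungExponents α β γ
  semigroup : IsDiagonalSemigroup e S ν lam
  rate_nonneg : 0 ≤ lam
  nonneg_left : 0 ≤ cF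
  nonneg_right : 0 ≤ cG
  lipschitz_left : ∀ x y, ‖F x - F y‖ ≤ cF * ‖x - y‖
  lipschitz_right : ∀ x y, ‖G x - G y‖ ≤ cG * ‖x - y‖
  left_zero : F 0 = 0
  right_zero : G 0 = 0
  holder : ∀ T, ∃ W, 0 ≤ W ∧ IsHolderWithOn γ W ω 0 T

theorem IsMildSolution.exists_isDampedHolder {e : HilbertBasis ι ℝ V} {S : ℝ → V →L[ℝ] V}
    {F : V → V} {G : V → HilbertSchmidt e} {ω u : ℝ → V} {u₀ : V} {α β : ℝ}
    (hu : IsMildSolution α β S F G ω u₀ u) (hβ : 0 ≤ β) (T : ℝ) :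
    ∃ M L, IsDampedHolder β M L u 0 T := by
  -- The interval `[0, |T| + 1]` is nondegenerate for every real `T` and contains `[0, T]`.
  obtain ⟨hc, C, hC⟩ := hu.regular (|T| + 1) (by positivity)
  obtain ⟨M, hM⟩ := isCompact_Icc.exists_bound_of_continuousOn hc
  have hT : T ≤ |T| + 1 := by linarith [le_abs_self T]
  refine ⟨M, |C|, IsDampedHolder.mono (s := 0) (t := |T| + 1) hβ ⟨?_, abs_nonneg _, hc, hM, ?_⟩
    le_rfl hT⟩
  · exact (norm_nonneg _).trans (hM 0 ⟨le_rfl, by positivity⟩)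
  · intro y x hy hyx hx
    have h1 := hC y x hy hyx hx
    have hp : 0 < (x - y) ^ β := Real.rpow_pos_of_pos (sub_pos.2 hyx) _
    have hq : 0 < (y - 0) ^ β := Real.rpow_pos_of_pos (by linarith) _
    rw [mul_div_assoc', div_le_iff₀ hp] at h1
    rw [Real.rpow_neg (by linarith), ← div_eq_mul_inv, mul_div_assoc', le_div_iff₀ hq, mul_comm]
    exact h1.trans (by gcongr; exact le_abs_self C)

/-- The convolution of the semigroup with the drift. -/
def driftConvolution (S : ℝ → V →L[ℝ] V) (F : V → V) (u : ℝ → V) (s t : ℝ) : V :=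
  ∫ r in s..t, S (t - r) (F (u r))

/-- The contribution of the driving path to a mild solution on `[s, t]`. -/
def noiseConvolution (S : ℝ → V →L[ℝ] V) (F : V → V) (u : ℝ → V) (s t : ℝ) : V :=
  u t - S (t - s) (u s) - driftConvolution S F u s t

namespace IsEvolutionSystem

variable {e : HilbertBasis ι ℝ V} {S : ℝ → V →L[ℝ] V} {ν : ι → ℝ}
  {F : V → V} {G : V → HilbertSchmidt e} {ω u : ℝ → V} {u₀ : V} {α β γ lam cF cG : ℝ}

theorem norm_drift_le (h : IsEvolutionSystem e S ν F G ω α β γ lam cF cG) (x : V) :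
    ‖F x‖ ≤ cF * ‖x‖ := by
  simpa [h.left_zero] using h.lipschitz_left x 0

theorem continuousOn_semigroup_drift (h : IsEvolutionSystem e S ν F G ω α β γ lam cF cG) {s t : ℝ}
    (hu : ContinuousOn u (Icc s t)) : ContinuousOn (fun r => S (t - r) (F (u r))) (Icc s t) := by
  refine h.semigroup.continuousOn_apply h.rate_nonneg ?_
  refine Continuous.comp_continuousOn (g := F) ?_ hu
  refine (LipschitzWith.of_dist_le_mul (K := cF.toNNReal) fun a b => ?_).continuous
  rw [dist_eq_norm, dist_eq_norm, Real.coe_toNNReal _ h.nonneg_left]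
  exact h.lipschitz_left a b

theorem norm_driftConvolution_le (h : IsEvolutionSystem e S ν F G ω α β γ lam cF cG) {s t M : ℝ}
    (hst : s ≤ t) (hM : ∀ r ∈ Icc s t, ‖u r‖ ≤ M) :
    ‖driftConvolution S F u s t‖ ≤ cF * M * (t - s) := by
  have h1 := intervalIntegral.norm_integral_le_of_norm_le_const (a := s) (b := t) (C := cF * M)
    (f := fun r => S (t - r) (F (u r))) fun r hr => by
      rw [uIoc_of_le hst] at hr
      refine (h.semigroup.norm_apply_le_norm h.rate_nonneg (sub_nonneg.2 hr.2) _).trans ?_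
      refine (h.norm_drift_le _).trans (mul_le_mul_of_nonneg_left ?_ h.nonneg_left)
      exact hM r ⟨hr.1.le, hr.2⟩
  rwa [abs_of_nonneg (sub_nonneg.2 hst)] at h1

variable [CompleteSpace V]

theorem semigroup_driftConvolution (h : IsEvolutionSystem e S ν F G ω α β γ lam cF cG) {s t δ : ℝ}
    (hst : s ≤ t) (hδ : 0 ≤ δ) (hu : ContinuousOn u (Icc s t)) :
    S δ (driftConvolution S F u s t) = ∫ r in s..t, S (t + δ - r) (F (u r)) := by
  rw [driftConvolution, ← ContinuousLinearMap.intervalIntegral_comp_comm _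
    ((h.continuousOn_semigroup_drift hu).intervalIntegrable_of_Icc hst)]
  refine intervalIntegral.integral_congr fun r hr => ?_
  rw [uIcc_of_le hst] at hr
  rw [h.semigroup.apply_apply hδ (sub_nonneg.2 hr.2)]
  congr 2; ring

theorem driftConvolution_cocycle (h : IsEvolutionSystem e S ν F G ω α β γ lam cF cG) {s m t : ℝ}
    (hsm : s ≤ m) (hmt : m ≤ t) (hu : ContinuousOn u (Icc s t)) :
    driftConvolution S F u s t
      = S (t - m) (driftConvolution S F u s m) + driftConvolution S F u m t := by
  have hc := h.continuousOn_semigroup_drift hu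
  rw [h.semigroup_driftConvolution hsm (sub_nonneg.2 hmt)
    (hu.mono (Icc_subset_Icc le_rfl hmt)), add_sub_cancel, driftConvolution, driftConvolution,
    intervalIntegral.integral_add_adjacent_intervals]
  · exact (hc.mono (Icc_subset_Icc le_rfl hmt)).intervalIntegrable_of_Icc hsm
  · exact (hc.mono (Icc_subset_Icc hsm le_rfl)).intervalIntegrable_of_Icc hmt

theorem norm_semigroup_driftConvolution_sub_le (h : IsEvolutionSystem e S ν F G ω α β γ lam cF cG)
    {s t M δ : ℝ} (hst : s ≤ t) (hδ : 0 ≤ δ) (hu : ContinuousOn u (Icc s t))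
    (hM : ∀ r ∈ Icc s t, ‖u r‖ ≤ M) :
    ‖S δ (driftConvolution S F u s t) - driftConvolution S F u s t‖
      ≤ cF * M * δ ^ β * ((t - s) ^ (1 - β) / (1 - β)) := by
  have hx := h.exponents
  have hcF := h.nonneg_left
  have hi : IntervalIntegrable (fun r => S (t - r) (F (u r))) volume s t :=
    (h.continuousOn_semigroup_drift hu).intervalIntegrable_of_Icc hst
  rw [driftConvolution, ← ContinuousLinearMap.intervalIntegral_comp_comm _ hi,
    ← intervalIntegral.integral_sub ?_ hi]
  · have hb := ((intervalIntegrable_sub_right_rpow (a := -β) (by linarith [hx.left_lt_one])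
      s t).const_mul (cF * M * δ ^ β))
    refine (intervalIntegral.norm_integral_le_of_norm_le hst ?_ hb).trans (le_of_eq ?_)
    · have hne : ∀ᵐ r : ℝ, r ≠ t := by simp [ae_iff, measure_singleton]
      filter_upwards [hne] with r hrt hr
      refine (h.semigroup.norm_apply_sub_apply_le h.rate_nonneg hδ
        (sub_pos.2 (lt_of_le_of_ne hr.2 hrt)) hx.left_pos.le hx.left_lt_one.le _).trans ?_
      have hp : 0 ≤ δ ^ β * (t - r) ^ (-β) :=
        mul_nonneg (Real.rpow_nonneg hδ _) (Real.rpow_nonneg (sub_nonneg.2 hr.2) _)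
      have h1 : ‖F (u r)‖ ≤ cF * M :=
        (h.norm_drift_le _).trans (by gcongr; exact hM r ⟨hr.1.le, hr.2⟩)
      calc δ ^ β * (t - r) ^ (-β) * ‖F (u r)‖ ≤ δ ^ β * (t - r) ^ (-β) * (cF * M) := by gcongr
        _ = _ := by ring
    · rw [intervalIntegral.integral_const_mul,
        integral_sub_right_rpow (by linarith [hx.left_lt_one]), neg_add_eq_sub]
  · exact ((S δ).continuous.comp_continuousOn
      (h.continuousOn_semigroup_drift hu)).intervalIntegrable_of_Icc hst

variable [Countable ι]

theorem inner_mild (h : IsEvolutionSystem e S ν F G ω α β γ lam cF cG)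
    (hu : IsMildSolution α β S F G ω u₀ u) {t : ℝ} (ht : 0 ≤ t) (j : ι) :
    inner ℝ (e j) (u t) = Real.exp (-(ν j * t)) * inner ℝ (e j) u₀
      + inner ℝ (e j) (driftConvolution S F u 0 t) + convolutionCoord α ν G ω u 0 t j := by
  obtain ⟨M, L, hd⟩ := hu.exists_isDampedHolder h.exponents.left_pos.le t
  obtain ⟨W, hW, hω⟩ := h.holder t
  rw [hu.equation t ht, inner_add_right, inner_add_right, h.semigroup.inner_apply t ht,
    inner_pathwiseIntegral h.exponents h.nonneg_right hW h.lipschitz_right h.right_zero h.semigroup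
      h.rate_nonneg hd hω ht]
  rfl

theorem apply_zero (h : IsEvolutionSystem e S ν F G ω α β γ lam cF cG)
    (hu : IsMildSolution α β S F G ω u₀ u) : u 0 = u₀ := by
  refine e.ext_inner fun j => ?_
  rw [h.inner_mild hu le_rfl j]
  simp [driftConvolution, convolutionCoord]

/-- The mild equation at `s`, propagated by `S (t - s)`, is subtracted from the one at `t`. The
cocycle properties cancel everything before `s`, so the equation restarts there. -/
theorem inner_noiseConvolution (h : IsEvolutionSystem e S ν F G ω α β γ lam cF cG)
    (hu : IsMildSolution α β S F G ω u₀ u) {s t : ℝ} (hs : 0 ≤ s) (hst : s ≤ t) (j : ι) :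
    inner ℝ (e j) (noiseConvolution S F u s t) = convolutionCoord α ν G ω u s t j := by
  obtain ⟨M, L, hd⟩ := hu.exists_isDampedHolder h.exponents.left_pos.le t
  obtain ⟨W, hW, hω⟩ := h.holder t
  have h1 := h.inner_mild hu (hs.trans hst) j
  have h2 := h.inner_mild hu hs j
  rw [h.driftConvolution_cocycle hs hst hd.continuousOn,
    convolutionCoord_cocycle h.exponents h.nonneg_right hW h.lipschitz_right h.right_zero hd hω hs
      hst, inner_add_right, h.semigroup.inner_apply _ (sub_nonneg.2 hst)] at h1
  have h3 : Real.exp (-(ν j * t)) = Real.exp (-(ν j * (t - s))) * Real.exp (-(ν j * s)) := by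
    rw [← Real.exp_add]; congr 1; ring
  rw [noiseConvolution, inner_sub_right, inner_sub_right, h1,
    h.semigroup.inner_apply _ (sub_nonneg.2 hst), h2, h3]
  ring

variable {M L W a s t : ℝ}

theorem norm_noiseConvolution_le (h : IsEvolutionSystem e S ν F G ω α β γ lam cF cG)
    (hu : IsMildSolution α β S F G ω u₀ u) (hs : 0 ≤ s) (hst : s < t)
    (hd : IsDampedHolder β M L u s t) (hW : 0 ≤ W) (hω : IsHolderWithOn γ W ω s t) :
    ‖noiseConvolution S F u s t‖
      ≤ youngBound α β γ * cG * W * (M + L) * (1 + 1 / γ) * (t - s) ^ γ := by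
  have hx := h.exponents
  have hK := youngBound_nonneg hx.pos hx.lt_one hx.one_lt_add β
  have hML : 0 ≤ M + L := add_nonneg hd.nonneg_sup hd.nonneg_holder
  have hc := h.nonneg_right
  have hγ := hx.right_pos
  have ht := sub_pos.2 hst
  refine e.norm_le_of_forall_sum_mul_le (by positivity) fun J φ => ?_
  simp only [h.inner_noiseConvolution hu hs hst.le]
  exact sum_mul_convolutionCoord_le hx hc hW h.lipschitz_right h.right_zero hd hω hst
    (fun j => h.rate_nonneg.trans (h.semigroup.rate_ge j)) J φ

theorem norm_semigroup_noiseConvolution_sub_le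
    (h : IsEvolutionSystem e S ν F G ω α β γ lam cF cG)
    (hu : IsMildSolution α β S F G ω u₀ u) (hs : 0 ≤ s) (hst : s < t)
    (hd : IsDampedHolder β M L u s t) (hW : 0 ≤ W) (hω : IsHolderWithOn γ W ω s t) {δ : ℝ}
    (hδ : 0 ≤ δ) :
    ‖S δ (noiseConvolution S F u s t) - noiseConvolution S F u s t‖
      ≤ youngBound α β γ * cG * W * (M + L) * (4 * δ ^ β) * (1 + 1 / (γ - β)) *
        (t - s) ^ (γ - β) := by
  have hx := h.exponents
  have hK := youngBound_nonneg hx.pos hx.lt_one hx.one_lt_add β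
  have hML : 0 ≤ M + L := add_nonneg hd.nonneg_sup hd.nonneg_holder
  have hc := h.nonneg_right
  have hγ : 0 < γ - β := sub_pos.2 hx.left_lt_right
  have ht := sub_pos.2 hst
  refine e.norm_le_of_forall_sum_mul_le (by positivity) fun J φ => ?_
  simp only [inner_sub_right, h.semigroup.inner_apply δ hδ, h.inner_noiseConvolution hu hs hst.le,
    ← sub_one_mul]
  exact sum_mul_exp_sub_one_mul_convolutionCoord_le hx hc hW h.lipschitz_right h.right_zero hd hω
    hst (fun j => h.rate_nonneg.trans (h.semigroup.rate_ge j)) hδ J φ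

end IsEvolutionSystem

/-- The constant in front of the initial condition and of the drift in the a priori estimate. -/
def driftConst (β : ℝ) : ℝ := 2 + 1 / (1 - β)

/-- The constant in front of the noise in the a priori estimate. -/
def noiseConst (α β γ : ℝ) : ℝ :=
  youngBound α β γ * (4 * (1 + 1 / (γ - β)) + 2 * (1 + 1 / γ))

theorem IsYoungExponents.noiseConst_nonneg {α β γ : ℝ} (hx : IsYoungExponents α β γ) :
    0 ≤ noiseConst α β γ := by
  have hK := youngBound_nonneg hx.pos hx.lt_one hx.one_lt_add β
  have h1 : 0 < γ - β := sub_pos.2 hx.left_lt_right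
  have h2 := hx.right_pos
  unfold noiseConst; positivity

theorem IsYoungExponents.two_le_driftConst {α β γ : ℝ} (hx : IsYoungExponents α β γ) :
    2 ≤ driftConst β := by
  have h1 : 0 < 1 - β := sub_pos.2 hx.left_lt_one
  have : 0 < 1 / (1 - β) := by positivity
  unfold driftConst; linarith

namespace IsEvolutionSystem

variable {e : HilbertBasis ι ℝ V} {S : ℝ → V →L[ℝ] V} {ν : ι → ℝ}
  {F : V → V} {G : V → HilbertSchmidt e} {ω u : ℝ → V} {u₀ : V} {α β γ lam cF cG : ℝ}
  {M L W a b : ℝ} [CompleteSpace V] [Countable ι]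

theorem norm_sub_semigroup_le (h : IsEvolutionSystem e S ν F G ω α β γ lam cF cG)
    (hu : IsMildSolution α β S F G ω u₀ u) (ha : 0 ≤ a) (hd : IsDampedHolder β M L u a b)
    (hW : 0 ≤ W) (hω : IsHolderWithOn γ W ω a b) {t : ℝ} (hat : a ≤ t) (htb : t ≤ b) :
    ‖u t - S (t - a) (u a)‖ ≤ cF * M * (b - a) +
      youngBound α β γ * (1 + 1 / γ) * (cG * W * (b - a) ^ γ * (M + L)) := by
  have hx := h.exponents
  have hK := youngBound_nonneg hx.pos hx.lt_one hx.one_lt_add β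
  have hM := hd.nonneg_sup
  have hL := hd.nonneg_holder
  have hcF := h.nonneg_left
  have hc := h.nonneg_right
  have hγ := hx.right_pos
  rcases hat.eq_or_lt with rfl | hat
  · have h0 : u a - S (a - a) (u a) = 0 := by rw [sub_self, h.semigroup.apply_zero, sub_self]
    rw [h0, norm_zero]
    have hab := sub_nonneg.2 htb
    positivity
  · have hdt := hd.mono hx.left_pos.le le_rfl htb
    have h1 := h.norm_driftConvolution_le hat.le hdt.norm_le
    have h2 := h.norm_noiseConvolution_le hu ha hat hdt hW (hω.mono le_rfl htb)
    have e1 : u t - S (t - a) (u a) = driftConvolution S F u a t + noiseConvolution S F u a t := by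
      rw [noiseConvolution]; abel
    have hta : 0 ≤ t - a := sub_nonneg.2 hat.le
    rw [e1]
    calc ‖driftConvolution S F u a t + noiseConvolution S F u a t‖
        ≤ cF * M * (t - a) +
          youngBound α β γ * cG * W * (M + L) * (1 + 1 / γ) * (t - a) ^ γ :=
          (norm_add_le _ _).trans (add_le_add h1 h2)
      _ ≤ cF * M * (b - a) +
          youngBound α β γ * cG * W * (M + L) * (1 + 1 / γ) * (b - a) ^ γ := by gcongr
      _ = _ := by ring

theorem norm_sub_le (h : IsEvolutionSystem e S ν F G ω α β γ lam cF cG)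
    (hu : IsMildSolution α β S F G ω u₀ u) (ha : 0 ≤ a) (hd : IsDampedHolder β M L u a b)
    (hW : 0 ≤ W) (hω : IsHolderWithOn γ W ω a b) {s t : ℝ} (has : a < s) (hst : s < t)
    (htb : t ≤ b) :
    ‖u t - u s‖ ≤ (‖u a‖ + (1 + 1 / (1 - β)) * (cF * M * (b - a)) +
      youngBound α β γ * (4 * (1 + 1 / (γ - β)) + (1 + 1 / γ)) *
        (cG * W * (b - a) ^ γ * (M + L))) * ((t - s) ^ β * (s - a) ^ (-β)) := by
  have hx := h.exponents
  have hK := youngBound_nonneg hx.pos hx.lt_one hx.one_lt_add β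
  have hM := hd.nonneg_sup
  have hL := hd.nonneg_holder
  have hcF := h.nonneg_left
  have hc := h.nonneg_right
  have hγ := hx.right_pos
  have hβ := hx.left_pos
  have hβ1 : 0 < 1 - β := sub_pos.2 hx.left_lt_one
  have hγβ : 0 < γ - β := sub_pos.2 hx.left_lt_right
  have hsb := hst.le.trans htb
  have hds := hd.mono hβ.le le_rfl hsb
  have hdt := hd.mono hβ.le has.le htb
  have hδ : 0 < t - s := sub_pos.2 hst
  have hτ : 0 < s - a := sub_pos.2 has
  have hb : 0 < b - a := by linarith
  set δ := t - s with hδ'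
  set τ := s - a with hτ'
  set P := δ ^ β * τ ^ (-β) with hP
  have hP0 : 0 ≤ P := by positivity
  have hpow : ∀ p : ℝ, 0 ≤ p → ∀ q : ℝ, 0 ≤ q → δ ^ p * τ ^ q ≤ (b - a) ^ (p + q) := fun p hp q hq => by
    rw [Real.rpow_add hb]
    gcongr
    · linarith
    · linarith
  have k1 := h.semigroup.norm_apply_sub_apply_le h.rate_nonneg hδ.le hτ hβ.le hx.left_lt_one.le (u a)
  have k2 := h.norm_semigroup_driftConvolution_sub_le has.le hδ.le hds.continuousOn hds.norm_le
  have k3 := h.norm_semigroup_noiseConvolution_sub_le hu ha has hds hW (hω.mono le_rfl hsb) hδ.le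
  have k4 := h.norm_driftConvolution_le hst.le hdt.norm_le
  have k5 := h.norm_noiseConvolution_le hu (ha.trans has.le) hst hdt hW (hω.mono has.le htb)
  -- All powers of `δ` and `τ` are reduced to the damped Hölder weight `P`; the remaining ones,
  -- nonnegative since `β < 1` and `β < γ`, are bounded by powers of `b - a`.
  have l2 : δ ^ β * τ ^ (1 - β) ≤ P * (b - a) := by
    have : τ ^ (1 - β) = τ ^ (-β) * τ := by rw [← Real.rpow_add_one hτ.ne']; congr 1; ring
    rw [this, hP, ← mul_assoc]
    gcongr
    linarith
  have l3 : δ ^ β * τ ^ (γ - β) ≤ P * (b - a) ^ γ := by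
    have : τ ^ (γ - β) = τ ^ (-β) * τ ^ γ := by rw [← Real.rpow_add hτ]; congr 1; ring
    rw [this, hP, ← mul_assoc]
    gcongr
    linarith
  have l4 : δ ≤ P * (b - a) := by
    calc δ = P * (δ ^ (1 - β) * τ ^ β) := by
          rw [hP, mul_mul_mul_comm, ← Real.rpow_add hδ, ← Real.rpow_add hτ]; simp
      _ ≤ P * (b - a) ^ ((1 - β) + β) := by gcongr; exact hpow _ hβ1.le _ hβ.le
      _ = _ := by rw [sub_add_cancel, Real.rpow_one]
  have l5 : δ ^ γ ≤ P * (b - a) ^ γ := by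
    calc δ ^ γ = P * (δ ^ (γ - β) * τ ^ β) := by
          rw [hP, mul_mul_mul_comm, ← Real.rpow_add hδ, ← Real.rpow_add hτ]; simp
      _ ≤ P * (b - a) ^ ((γ - β) + β) := by gcongr; exact hpow _ hγβ.le _ hβ.le
      _ = _ := by rw [sub_add_cancel]
  -- The semigroup over time `δ` acts on the linear, drift and noise parts at time `s`; the last two
  -- terms are the new contributions on `[s, t]`.
  have e1 : u t - u s = (S δ (S τ (u a)) - S τ (u a))
      + (S δ (driftConvolution S F u a s) - driftConvolution S F u a s)
      + (S δ (noiseConvolution S F u a s) - noiseConvolution S F u a s)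
      + driftConvolution S F u s t + noiseConvolution S F u s t := by
    simp only [noiseConvolution, map_sub, ← hδ', ← hτ']
    abel
  rw [e1]
  set K := youngBound α β γ
  refine (norm_add_le_of_le (norm_add_le_of_le (norm_add_le_of_le (norm_add_le_of_le k1 k2) k3) k4)
    k5).trans ?_
  calc P * ‖u a‖ + cF * M * δ ^ β * (τ ^ (1 - β) / (1 - β)) +
        K * cG * W * (M + L) * (4 * δ ^ β) * (1 + 1 / (γ - β)) * τ ^ (γ - β) + cF * M * δ +
        K * cG * W * (M + L) * (1 + 1 / γ) * δ ^ γ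
      = P * ‖u a‖ + cF * M * (1 / (1 - β)) * (δ ^ β * τ ^ (1 - β)) +
        K * cG * W * (M + L) * (4 * (1 + 1 / (γ - β))) * (δ ^ β * τ ^ (γ - β)) + cF * M * δ +
        K * cG * W * (M + L) * (1 + 1 / γ) * δ ^ γ := by ring
    _ ≤ P * ‖u a‖ + cF * M * (1 / (1 - β)) * (P * (b - a)) +
        K * cG * W * (M + L) * (4 * (1 + 1 / (γ - β))) * (P * (b - a) ^ γ) +
        cF * M * (P * (b - a)) + K * cG * W * (M + L) * (1 + 1 / γ) * (P * (b - a) ^ γ) := by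
        gcongr
    _ = _ := by ring

/-- The a priori estimate on an interval. -/
theorem exists_isDampedHolder_add_le (h : IsEvolutionSystem e S ν F G ω α β γ lam cF cG)
    (hu : IsMildSolution α β S F G ω u₀ u) (ha : 0 ≤ a) (hab : a ≤ b)
    (hd : IsDampedHolder β M L u a b) (hW : 0 ≤ W) (hω : IsHolderWithOn γ W ω a b) {c κ : ℝ}
    (hc : noiseConst α β γ ≤ c) (hκ : c * cG * W * (b - a) ^ γ + cF * (b - a) ≤ κ) :
    ∃ M' L', IsDampedHolder β M' L' u a b ∧
      M' + L' ≤ driftConst β * ‖u a‖ + driftConst β * κ * (M + L) := by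
  have hx := h.exponents
  have hK := youngBound_nonneg hx.pos hx.lt_one hx.one_lt_add β
  have hM := hd.nonneg_sup
  have hL := hd.nonneg_holder
  have hcF := h.nonneg_left
  have hcG := h.nonneg_right
  have hγ := hx.right_pos
  have hβ1 : 0 < 1 - β := sub_pos.2 hx.left_lt_one
  have hγβ : 0 < γ - β := sub_pos.2 hx.left_lt_right
  have hba := sub_nonneg.2 hab
  refine ⟨‖u a‖ + (cF * M * (b - a) +
      youngBound α β γ * (1 + 1 / γ) * (cG * W * (b - a) ^ γ * (M + L))),
    ‖u a‖ + (1 + 1 / (1 - β)) * (cF * M * (b - a)) +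
      youngBound α β γ * (4 * (1 + 1 / (γ - β)) + (1 + 1 / γ)) *
        (cG * W * (b - a) ^ γ * (M + L)),
    ⟨by positivity, by positivity, hd.continuousOn, fun t ht => ?_, fun s t hs hst ht =>
      h.norm_sub_le hu ha hd hW hω hs hst ht⟩, ?_⟩
  · have h1 := h.norm_sub_semigroup_le hu ha hd hW hω ht.1 ht.2
    have h2 := h.semigroup.norm_apply_le_norm h.rate_nonneg (sub_nonneg.2 ht.1) (u a)
    calc ‖u t‖ = ‖S (t - a) (u a) + (u t - S (t - a) (u a))‖ := by rw [add_sub_cancel]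
      _ ≤ _ := norm_add_le_of_le h2 h1
  · have h2 := hx.two_le_driftConst
    -- Adding the supremum bound and the Hölder bound gives the initial value twice; the sums of the
    -- drift and noise coefficients are `driftConst` and `noiseConst`.
    have e1 : ‖u a‖ + (cF * M * (b - a) +
        youngBound α β γ * (1 + 1 / γ) * (cG * W * (b - a) ^ γ * (M + L))) +
        (‖u a‖ + (1 + 1 / (1 - β)) * (cF * M * (b - a)) +
        youngBound α β γ * (4 * (1 + 1 / (γ - β)) + (1 + 1 / γ)) *
          (cG * W * (b - a) ^ γ * (M + L)))
        = 2 * ‖u a‖ + driftConst β * (cF * M * (b - a)) +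
          noiseConst α β γ * (cG * W * (b - a) ^ γ * (M + L)) := by
      rw [driftConst, noiseConst]; ring
    have hX : 0 ≤ cG * W * (b - a) ^ γ * (M + L) := by positivity
    have hn := hx.noiseConst_nonneg
    have hD : 0 ≤ driftConst β := by linarith
    rw [e1]
    calc 2 * ‖u a‖ + driftConst β * (cF * M * (b - a)) +
          noiseConst α β γ * (cG * W * (b - a) ^ γ * (M + L))
        ≤ driftConst β * ‖u a‖ + driftConst β * (cF * (M + L) * (b - a)) +
          driftConst β * (c * (cG * W * (b - a) ^ γ * (M + L))) := by
          have h3 : noiseConst α β γ * (cG * W * (b - a) ^ γ * (M + L))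
              ≤ driftConst β * (c * (cG * W * (b - a) ^ γ * (M + L))) := by
            have : 0 ≤ c * (cG * W * (b - a) ^ γ * (M + L)) := mul_nonneg (hn.trans hc) hX
            nlinarith [mul_le_mul_of_nonneg_right hc hX]
          gcongr
          linarith
      _ = driftConst β * ‖u a‖ +
          driftConst β * (c * cG * W * (b - a) ^ γ + cF * (b - a)) * (M + L) := by ring
      _ ≤ _ := by gcongr

/-- The growth and the contraction of a mild solution on an interval. -/
theorem norm_le_and_norm_le (h : IsEvolutionSystem e S ν F G ω α β γ lam cF cG)
    (hu : IsMildSolution α β S F G ω u₀ u) (ha : 0 ≤ a) (hab : a ≤ b) (hW : 0 ≤ W)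
    (hω : IsHolderWithOn γ W ω a b) {c κ : ℝ} (hc : noiseConst α β γ ≤ c)
    (hκ : c * cG * W * (b - a) ^ γ + cF * (b - a) ≤ κ) (hq : driftConst β * κ < 1) :
    (∀ t ∈ Icc a b, ‖u t‖ ≤ driftConst β / (1 - driftConst β * κ) * ‖u a‖) ∧
    ‖u b‖ ≤ Real.exp (-(lam * (b - a))) * ‖u a‖ +
      κ * (driftConst β / (1 - driftConst β * κ) * ‖u a‖) := by
  have hx := h.exponents
  have hK := youngBound_nonneg hx.pos hx.lt_one hx.one_lt_add β
  have hcF := h.nonneg_left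
  have hcG := h.nonneg_right
  have hγ := hx.right_pos
  have hγβ : 0 < γ - β := sub_pos.2 hx.left_lt_right
  have hba := sub_nonneg.2 hab
  have hn := hx.noiseConst_nonneg
  have hc0 := hn.trans hc
  have hκ0 : 0 ≤ κ := by
    refine le_trans ?_ hκ
    positivity
  -- The infimum of the admissible sums `M + L` serves as the norm of `u` on `[a, b]`. Applied to
  -- near-minimizers, the a priori estimate bounds it by itself with factor `driftConst β * κ < 1`,
  -- which is absorbed.
  set N : Set ℝ := {n | ∃ M L, IsDampedHolder β M L u a b ∧ n = M + L} with hN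
  have hne : N.Nonempty := by
    obtain ⟨M, L, hd⟩ := hu.exists_isDampedHolder hx.left_pos.le b
    exact ⟨_, M, L, hd.mono hx.left_pos.le ha le_rfl, rfl⟩
  have hbd : BddBelow N := ⟨0, by
    rintro _ ⟨M, L, hd, rfl⟩
    exact add_nonneg hd.nonneg_sup hd.nonneg_holder⟩
  have hD : 0 ≤ driftConst β := by linarith [hx.two_le_driftConst]
  have hinf : sInf N ≤ driftConst β / (1 - driftConst β * κ) * ‖u a‖ := by
    have h1 : sInf N ≤ driftConst β * ‖u a‖ + driftConst β * κ * sInf N := by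
      have h2 : ∀ n ∈ N, sInf N ≤ driftConst β * ‖u a‖ + driftConst β * κ * n := by
        rintro _ ⟨M, L, hd, rfl⟩
        obtain ⟨M', L', hd', hle⟩ := h.exists_isDampedHolder_add_le hu ha hab hd hW hω hc hκ
        exact (csInf_le hbd ⟨M', L', hd', rfl⟩).trans hle
      refine le_of_forall_pos_le_add fun ε hε => ?_
      obtain ⟨n, hn, hlt⟩ := exists_lt_of_csInf_lt hne (show sInf N < sInf N + ε by linarith)
      have h3 := h2 n hn
      have h4 : driftConst β * κ * n ≤ driftConst β * κ * (sInf N + ε) := by gcongr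
      have h5 : driftConst β * κ * ε ≤ 1 * ε := by gcongr
      nlinarith
    rw [div_mul_eq_mul_div, le_div_iff₀ (by linarith)]
    linarith
  have hle : ∀ x y : ℝ, 0 ≤ y → (∀ n ∈ N, x ≤ y * n) → x ≤ y * sInf N := by
    intro x y hy hxy
    refine le_of_forall_pos_le_add fun ε hε => ?_
    obtain ⟨n, hn, hlt⟩ := exists_lt_of_csInf_lt hne
      (show sInf N < sInf N + ε / (y + 1) by linarith [show 0 < ε / (y + 1) by positivity])
    have h1 : y * n ≤ y * (sInf N + ε / (y + 1)) := by gcongr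
    have h2 : y * (ε / (y + 1)) ≤ ε := by
      rw [mul_div_assoc', div_le_iff₀ (by linarith)]; nlinarith
    have := hxy n hn
    linarith
  refine ⟨fun t ht => ?_, ?_⟩
  · refine le_trans ?_ hinf
    refine le_csInf hne ?_
    rintro _ ⟨M, L, hd, rfl⟩
    exact (hd.norm_le t ht).trans (by linarith [hd.nonneg_holder])
  -- At the endpoint the linear part keeps its exponential decay, so only the deviation from it is
  -- estimated, with the factor `κ`.
  · have h1 : ‖u b - S (b - a) (u a)‖ ≤ κ * sInf N := by
      refine hle _ _ hκ0 ?_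
      rintro _ ⟨M, L, hd, rfl⟩
      have hM := hd.nonneg_sup
      have hL := hd.nonneg_holder
      refine (h.norm_sub_semigroup_le hu ha hd hW hω hab le_rfl).trans ?_
      have h2 : youngBound α β γ * (1 + 1 / γ) ≤ c := by
        refine le_trans ?_ hc
        rw [noiseConst]
        refine mul_le_mul_of_nonneg_left ?_ hK
        have : 0 ≤ 1 / (γ - β) := by positivity
        have : 0 ≤ 1 / γ := by positivity
        linarith
      calc cF * M * (b - a) + youngBound α β γ * (1 + 1 / γ) * (cG * W * (b - a) ^ γ * (M + L))
          ≤ cF * (M + L) * (b - a) + c * (cG * W * (b - a) ^ γ * (M + L)) := by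
            gcongr
            linarith
        _ = (c * cG * W * (b - a) ^ γ + cF * (b - a)) * (M + L) := by ring
        _ ≤ κ * (M + L) := by gcongr
    have h2 := h.semigroup.norm_apply_le hba (u a)
    calc ‖u b‖ = ‖S (b - a) (u a) + (u b - S (b - a) (u a))‖ := by rw [add_sub_cancel]
      _ ≤ _ := norm_add_le_of_le h2 (h1.trans (by gcongr))

end IsEvolutionSystem

end MildSolution

/-! ### Hölder seminorms of the driving path -/

section DrivingPath

variable {V : Type u} [NormedAddCommGroup V] {β : ℝ} {ω : ℝ → V}

theorem IsHolderOn.exists_isHolderWithOn (hβ : 0 < β)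
    (hω : ∀ T : ℝ, 0 < T → IsHolderOn β ω 0 T) (T : ℝ) :
    ∃ W, 0 ≤ W ∧ IsHolderWithOn β W ω 0 T := by
  obtain ⟨C, hC⟩ := hω (|T| + 1) (by positivity)
  refine ⟨|C|, abs_nonneg _, fun x y hx hxy hy => ?_⟩
  rcases hxy.eq_or_lt with rfl | hxy
  · simp [Real.zero_rpow hβ.ne']
  · have h1 : ‖ω y - ω x‖ / (y - x) ^ β ≤ |C| :=
      (hC ⟨x, y, hx, hxy, by linarith [le_abs_self T], rfl⟩).trans (le_abs_self C)
    rwa [div_le_iff₀ (Real.rpow_pos_of_pos (sub_pos.2 hxy) _)] at h1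

theorem holderSeminorm_nonneg (w : ℝ → V) (a b : ℝ) : 0 ≤ holderSeminorm β w a b := by
  refine Real.sSup_nonneg ?_
  rintro _ ⟨s, t, -, hst, -, rfl⟩
  exact div_nonneg (norm_nonneg _) (Real.rpow_nonneg (sub_pos.2 hst).le _)

/-- The quotients of the shifted path are quotients of `ω` on `[0, b]`. This gives the boundedness
without which `sSup` would carry no information. -/
theorem isHolderWithOn_holderSeminorm (hβ : 0 < β) {a b : ℝ} (ha : 0 ≤ a)
    (hω : IsHolderOn β ω 0 b) :
    IsHolderWithOn β (holderSeminorm β (wienerShift a ω) 0 (b - a)) ω a b := by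
  have hbdd : BddAbove (holderQuotients β (wienerShift a ω) 0 (b - a)) := by
    refine BddAbove.mono ?_ hω
    rintro _ ⟨s, t, hs, hst, ht, rfl⟩
    refine ⟨a + s, a + t, by linarith, by linarith, by linarith, ?_⟩
    simp only [wienerShift, sub_sub_sub_cancel_right, add_sub_add_left_eq_sub]
  intro x y hx hxy hy
  rcases hxy.eq_or_lt with rfl | hxy
  · simp [Real.zero_rpow hβ.ne']
  · rw [← div_le_iff₀ (Real.rpow_pos_of_pos (sub_pos.2 hxy) _)]
    refine le_csSup hbdd ⟨x - a, y - a, by linarith, by linarith, by linarith, ?_⟩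
    simp only [wienerShift, add_sub_cancel, sub_sub_sub_cancel_right]

end DrivingPath

/-! ### Exponential stability -/

section Stability

variable {V : Type u} [NormedAddCommGroup V]

/-- The times of an admissible sequence grow at least linearly. -/
theorem eventually_mul_le_of_lt_liminf {T : ℕ → ℝ} (hT : ∀ k, 0 ≤ T k) {d : ℝ}
    (hd : d < liminf (fun k : ℕ => T k / (k : ℝ)) atTop) :
    ∀ᶠ k : ℕ in atTop, (k : ℝ) * d ≤ T k := by
  -- The real-valued `liminf` is meaningful only for quotients bounded below, here by zero.
  have hb : IsBoundedUnder (· ≥ ·) atTop fun k : ℕ => T k / (k : ℝ) :=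
    isBoundedUnder_of ⟨0, fun k => div_nonneg (hT k) (Nat.cast_nonneg k)⟩
  filter_upwards [eventually_lt_of_lt_liminf hd hb, eventually_gt_atTop 0] with k hk hk0
  rw [lt_div_iff₀ (Nat.cast_pos.2 hk0)] at hk
  linarith

theorem exists_mem_Ico_of_tendsto_atTop {T : ℕ → ℝ} (hT0 : T 0 = 0) (hT : Tendsto T atTop atTop)
    {t : ℝ} (ht : 0 ≤ t) : ∃ k, T k ≤ t ∧ t < T (k + 1) := by
  by_contra! hcon
  have : ∀ k, T k ≤ t := fun k => by
    induction k with
    | zero => rwa [hT0]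
    | succ k ih => exact hcon k ih
  obtain ⟨k, hk⟩ := (hT.eventually_gt_atTop t).exists
  exact absurd (this k) (not_le.2 hk)

/-- A discrete Gronwall argument: contraction along a sequence of times with at least linear growth
implies exponential decay. -/
theorem norm_mul_exp_le_of_contraction {u : ℝ → V} {T : ℕ → ℝ} {lam η μ d C ρ : ℝ} {k₀ : ℕ}
    (hT0 : T 0 = 0) (hT : Monotone T) (hμ : ∀ k, T (k + 1) - T k ≤ μ)
    (hd : 0 < d) (hη : 0 ≤ η) (hC : 0 ≤ C) (hρ : 0 ≤ ρ) (hσ : ρ < lam - η / d)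
    (hstep : ∀ k, ‖u (T (k + 1))‖ ≤ Real.exp (-(lam * (T (k + 1) - T k)) + η) * ‖u (T k)‖)
    (hbd : ∀ k, ∀ t ∈ Icc (T k) (T (k + 1)), ‖u t‖ ≤ C * ‖u (T k)‖)
    (hlin : ∀ k, k₀ ≤ k → (k : ℝ) * d ≤ T k) {t : ℝ} (ht : T k₀ ≤ t) :
    ‖u t‖ * Real.exp (ρ * t) ≤ C * Real.exp (lam * μ) *
      Real.exp (-((lam - η / d - ρ) * t)) * ‖u 0‖ := by
  have hlam : 0 < lam := by
    have : 0 ≤ η / d := by positivity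
    linarith
  have hTt : Tendsto T atTop atTop := by
    have h1 : Tendsto (fun k : ℕ => (k : ℝ) * d) atTop atTop :=
      tendsto_natCast_atTop_atTop.atTop_mul_const hd
    exact tendsto_atTop_mono' _ (eventually_atTop.2 ⟨k₀, hlin⟩) h1
  have hTnn : ∀ k, 0 ≤ T k := fun k => by rw [← hT0]; exact hT (Nat.zero_le k)
  have hind : ∀ k : ℕ, ‖u (T k)‖ ≤ Real.exp (-(lam * T k) + k * η) * ‖u 0‖ := by
    intro k
    induction k with
    | zero => simp [hT0]
    | succ k ih =>
      calc ‖u (T (k + 1))‖ ≤ Real.exp (-(lam * (T (k + 1) - T k)) + η) *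
            (Real.exp (-(lam * T k) + k * η) * ‖u 0‖) := (hstep k).trans (by gcongr)
        _ = _ := by
          rw [← mul_assoc, ← Real.exp_add]
          congr 2
          push_cast
          ring
  obtain ⟨k, hk1, hk2⟩ := exists_mem_Ico_of_tendsto_atTop hT0 hTt ((hTnn k₀).trans ht)
  have hk : k₀ ≤ k := by
    by_contra! hlt
    have := hT (show k + 1 ≤ k₀ from hlt)
    linarith
  -- The linear growth of the times converts the loss per step into a loss per unit of time.
  have hkη : (k : ℝ) * η ≤ η / d * T k := by
    have := mul_le_mul_of_nonneg_left (hlin k hk) (show 0 ≤ η / d by positivity)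
    calc (k : ℝ) * η = η / d * (k * d) := by field_simp
      _ ≤ _ := this
  -- Passing from `T k` to `t` costs at most the factor `exp (lam * μ)`.
  have htμ : t - μ ≤ T k := by linarith [hμ k]
  have hexp : -(lam * T k) + k * η + ρ * t ≤ lam * μ + -((lam - η / d - ρ) * t) := by
    have h1 : 0 ≤ lam - η / d := by linarith
    have h2 := mul_le_mul_of_nonneg_left htμ h1
    have h3 : (lam - η / d) * μ ≤ lam * μ := by
      have : 0 ≤ μ := by linarith
      have : 0 ≤ η / d := by positivity
      nlinarith
    nlinarith
  calc ‖u t‖ * Real.exp (ρ * t)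
      ≤ C * (Real.exp (-(lam * T k) + k * η) * ‖u 0‖) * Real.exp (ρ * t) := by
        gcongr
        exact (hbd k t ⟨hk1, hk2.le⟩).trans (by gcongr; exact hind k)
    _ = C * Real.exp (-(lam * T k) + k * η + ρ * t) * ‖u 0‖ := by rw [Real.exp_add _ (ρ * t)]; ring
    _ ≤ C * Real.exp (lam * μ + -((lam - η / d - ρ) * t)) * ‖u 0‖ := by gcongr
    _ = _ := by rw [Real.exp_add]; ring

end Stability

end

/-! ### Choice of the constants and proof of exponential stability -/

theorem theorem3p2 (α β β' : ℝ) (hβ : 1 / 2 < β) (hββ' : β < β') (hβ' : β' ≤ 1)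
    (hα : 1 - β' < α) (hαβ : α < β) :
    -- the constant `c_{α,β,β'}`, and `c_S`, which may depend on `λ` and `λ₁` as well
    ∃ c₀ : ℝ, 0 < c₀ ∧ ∀ lam lam1 : ℝ, 0 < lam → lam < lam1 → ∃ cS₀ : ℝ, 0 < cS₀ ∧
    ∀ c cS : ℝ, c₀ ≤ c → cS₀ ≤ cS →
    -- the equation
    ∀ (V : Type u) [NormedAddCommGroup V] [InnerProductSpace ℝ V] [CompleteSpace V]
      (ι : Type v) (e : HilbertBasis ι ℝ V) (A : V →ₗ.[ℝ] V) (S : ℝ → V →L[ℝ] V)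
      (F : V → V) (G : V → HilbertSchmidt e) (cDF cDG cD2G : ℝ),
    AssumptionA1 A S → IsEigenbasis A e → IsLeast (negEigenvalues A) lam1 →
    0 < cDF → AssumptionA2 F cDF → AssumptionA3 G cDG cD2G → F 0 = 0 → G 0 = 0 →
    -- the driving path
    ∀ ω : ℝ → V, (∀ T : ℝ, 0 < T → IsHolderOn β' ω 0 T) →
    -- the times
    ∀ (μ D : ℝ) (T : ℕ → ℝ), 0 < μ → μ < 1 / (cS * cDF) →
    AssumptionS1 c cDF cDG β' μ ω T → AssumptionS2 μ D T → 0 < criticalRate lam cS cDF μ D →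
    -- exponential decay, uniformly for bounded sets of initial conditions
    ∀ ρ : ℝ, 0 < ρ → ρ < criticalRate lam cS cDF μ D →
      (∀ (u₀ : V) (u : ℝ → V), IsMildSolution α β S F G ω u₀ u →
        Tendsto (fun t => ‖u t‖ * Real.exp (ρ * t)) atTop (𝓝 0)) ∧
      (∀ B : Set V, Bornology.IsBounded B → ∀ ε : ℝ, 0 < ε → ∃ t₀ : ℝ, ∀ t : ℝ, t₀ ≤ t →
        ∀ u₀ ∈ B, ∀ u : ℝ → V, IsMildSolution α β S F G ω u₀ u →
          ‖u t‖ * Real.exp (ρ * t) < ε) := by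
  have hx : IsYoungExponents α β β' := ⟨by linarith, hαβ, by linarith, by linarith, hββ'⟩
  have hγ := hx.right_pos
  have hD2 := hx.two_le_driftConst
  -- The summand `1` makes the first constant positive. The second only has to dominate `driftConst
  -- β`, which its square does since `driftConst β ≥ 2`.
  refine ⟨noiseConst α β β' + 1, by linarith [hx.noiseConst_nonneg], fun lam lam1 hlam hlam1 =>
    ⟨driftConst β ^ 2, by positivity, ?_⟩⟩
  intro c cS hc hcS V _ _ _ ι e A S F G cDF cDG cD2G hA he hl hcDF hF hG hF0 hG0 ω hω μ D T hμ
    hμ' hS1 hS2 hcr ρ hρ hρ'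
  have hι : Countable ι := hA.countable he
  obtain ⟨ν, hS⟩ := hA.exists_isDiagonalSemigroup he hl
  have hsys : IsEvolutionSystem e S ν F G ω α β β' lam1 cDF cDG :=
    ⟨hx, hS, by linarith, hcDF.le, hG.nonneg, hF, hG.norm_sub_le, hF0, hG0,
      IsHolderOn.exists_isHolderWithOn hγ hω⟩
  have hcS0 : 0 < cS := lt_of_lt_of_le (by positivity) hcS
  have hc' : noiseConst α β β' ≤ c := by linarith
  have hc0 : 0 ≤ c := hx.noiseConst_nonneg.trans hc'
  have hcDG := hG.nonneg
  set x := cS * cDF * μ with hxdef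
  have hx0 : 0 < x := by positivity
  have hx1 : x < 1 := by
    rw [lt_div_iff₀ (by positivity)] at hμ'
    rw [hxdef]; linarith
  set κ := cDF * μ with hκ
  have hκ0 : 0 < κ := by positivity
  set q := driftConst β * κ with hq
  have hDκ : driftConst β * κ ≤ x := by
    rw [hxdef, mul_assoc]
    gcongr
    nlinarith
  have hq1 : q < 1 := hDκ.trans_lt hx1
  -- `r` will bound the deviation from the linear flow per step, and `η / D` is the term subtracted
  -- from `lam` in the critical rate.
  set r := x / (1 - x) with hr
  have hr0 : 0 ≤ r := div_nonneg hx0.le (by linarith)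
  set η := r * Real.exp (lam * μ) with hη
  have hη0 : 0 ≤ η := by positivity
  set C := driftConst β / (1 - q) with hC
  have hC0 : 0 ≤ C := div_nonneg (by linarith) (by linarith)
  have hκC : κ * C ≤ r := by
    rw [hC, hr, mul_div_assoc']
    have h1 : κ * driftConst β ≤ x := by rw [mul_comm]; exact hDκ
    exact div_le_div₀ hx0.le h1 (by linarith) (by linarith)
  have hTnn : ∀ k, 0 ≤ T k := fun k => by
    rw [← hS1.zero]; exact hS1.increasing.monotone (Nat.zero_le k)
  have hT1 : ∀ k, T k < T (k + 1) := fun k => hS1.increasing (Nat.lt_succ_self k)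
  have hstepμ : ∀ k, T (k + 1) - T k ≤ μ := fun k => by
    have h1 := hS1.balance k
    have h2 : 0 ≤ c * cDG * holderSeminorm β' (wienerShift (T k) ω) 0 (T (k + 1) - T k)
        * (T (k + 1) - T k) ^ β' := by
      have h3 := holderSeminorm_nonneg (β := β') (wienerShift (T k) ω) 0 (T (k + 1) - T k)
      have h4 := Real.rpow_nonneg (sub_pos.2 (hT1 k)).le β'
      positivity
    have h5 : cDF * (T (k + 1) - T k) ≤ cDF * μ := by linarith
    exact le_of_mul_le_mul_left h5 hcDF
  have hinterval : ∀ (u₀ : V) (u : ℝ → V), IsMildSolution α β S F G ω u₀ u → ∀ k,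
      (∀ t ∈ Icc (T k) (T (k + 1)), ‖u t‖ ≤ C * ‖u (T k)‖) ∧
      ‖u (T (k + 1))‖ ≤ Real.exp (-(lam * (T (k + 1) - T k)) + η) * ‖u (T k)‖ := by
    intro u₀ u hu k
    have h1 := hsys.norm_le_and_norm_le hu (hTnn k) (hT1 k).le (holderSeminorm_nonneg _ _ _)
      (isHolderWithOn_holderSeminorm hγ (hTnn k) (hω _ ((hTnn k).trans_lt (hT1 k)))) hc'
      (hS1.balance k).le hq1
    refine ⟨h1.1, h1.2.trans ?_⟩
    have hΔ := (sub_pos.2 (hT1 k)).le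
    have hΔμ := hstepμ k
    set Δ := T (k + 1) - T k
    have h2 : Real.exp (-(lam1 * Δ)) ≤ Real.exp (-(lam * Δ)) := by gcongr
    -- Since `Δ ≤ μ`, the additive error `r` can be written with the factor `exp (-lam Δ)` at the
    -- price of `exp (lam μ)`. This is where that factor of the critical rate comes from.
    have h3 : 1 ≤ Real.exp (-(lam * Δ)) * Real.exp (lam * μ) := by
      rw [← Real.exp_add]
      exact Real.one_le_exp (by nlinarith)
    have h4 : 1 + η ≤ Real.exp η := by linarith [Real.add_one_le_exp η]
    calc Real.exp (-(lam1 * Δ)) * ‖u (T k)‖ + κ * (C * ‖u (T k)‖)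
        = (Real.exp (-(lam1 * Δ)) + κ * C * 1) * ‖u (T k)‖ := by ring
      _ ≤ (Real.exp (-(lam * Δ)) + r * (Real.exp (-(lam * Δ)) * Real.exp (lam * μ))) *
          ‖u (T k)‖ := by gcongr
      _ = Real.exp (-(lam * Δ)) * (1 + η) * ‖u (T k)‖ := by rw [hη]; ring
      _ ≤ Real.exp (-(lam * Δ)) * Real.exp η * ‖u (T k)‖ := by gcongr
      _ = _ := by rw [← Real.exp_add]
  obtain ⟨hD0, -, hDlim⟩ := hS2
  have hcrit : criticalRate lam cS cDF μ D = lam - η / D := by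
    rw [criticalRate, hη, hr, ← hxdef]
    congr 1
    rw [div_mul_eq_mul_div, div_mul_eq_mul_div, div_div]
  rw [hcrit] at hρ'
  have hlamρ : 0 < lam - ρ := by
    have : 0 ≤ η / D := by positivity
    linarith
  have hηD : η / (lam - ρ) < D := by
    rw [div_lt_iff₀ hlamρ]
    have : η / D < lam - ρ := by linarith
    rw [div_lt_iff₀ hD0] at this
    linarith
  -- A bound on the `liminf` yields linear growth only with a slope `d < D`. The strict inequality
  -- for `ρ` leaves room for `d` with `ρ < lam - η / d`.
  obtain ⟨d, hd1, hd2⟩ := exists_between hηD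
  have hd0 : 0 < d := lt_of_le_of_lt (by positivity) hd1
  have hσ : ρ < lam - η / d := by
    rw [div_lt_iff₀ hlamρ] at hd1
    have : η / d < lam - ρ := by rw [div_lt_iff₀ hd0]; linarith
    linarith
  obtain ⟨k₀, hk₀⟩ := eventually_atTop.1
    (eventually_mul_le_of_lt_liminf hTnn (hd2.trans_le hDlim))
  set σ := lam - η / d - ρ
  have hσ0 : 0 < σ := by simp only [σ]; linarith
  -- The index `k₀` and all constants are independent of the initial value, so this one bound gives
  -- both the limit and its uniformity.
  have hbound : ∀ t, T k₀ ≤ t → ∀ (u₀ : V) (u : ℝ → V), IsMildSolution α β S F G ω u₀ u →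
      ‖u t‖ * Real.exp (ρ * t) ≤ C * Real.exp (lam * μ) * Real.exp (-(σ * t)) * ‖u₀‖ := by
    intro t ht u₀ u hu
    rw [← hsys.apply_zero hu]
    exact norm_mul_exp_le_of_contraction hS1.zero hS1.increasing.monotone hstepμ hd0 hη0 hC0 hρ.le
      hσ (fun k => (hinterval u₀ u hu k).2) (fun k => (hinterval u₀ u hu k).1) hk₀ ht
  have hdecay : ∀ R : ℝ, Tendsto (fun t => C * Real.exp (lam * μ) * Real.exp (-(σ * t)) * R) atTop
      (𝓝 0) := by
    intro R
    have h1 : Tendsto (fun t : ℝ => Real.exp (-(σ * t))) atTop (𝓝 0) :=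
      Real.tendsto_exp_neg_atTop_nhds_zero.comp (tendsto_id.const_mul_atTop hσ0)
    simpa using (h1.const_mul (C * Real.exp (lam * μ))).mul_const R
  refine ⟨fun u₀ u hu => ?_, fun B hB ε hε => ?_⟩
  · refine squeeze_zero' (Eventually.of_forall fun t => by positivity) ?_ (hdecay ‖u₀‖)
    filter_upwards [eventually_ge_atTop (T k₀)] with t ht using hbound t ht u₀ u hu
  · obtain ⟨R, hR⟩ := hB.exists_norm_le
    obtain ⟨t₁, ht₁⟩ := eventually_atTop.1 ((hdecay R).eventually (gt_mem_nhds hε))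
    refine ⟨max t₁ (T k₀), fun t ht u₀ hu₀ u hu => ?_⟩
    refine ((hbound t ((le_max_right _ _).trans ht) u₀ u hu).trans ?_).trans_lt
      (ht₁ t ((le_max_left _ _).trans ht))
    have := hR u₀ hu₀
    gcongr
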